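/- Let $M$ be a smooth finite-dimensional (Hausdorff, boundaryless) manifold and $n\ge 1$ an integer. A one-parameter family of diffeomorphisms of class $C^m$ is a $C^m$ map $(\lambda,p)\mapsto\Phi_\lambda(p)\in M$ on an open set $\mathcal D\subseteq\mathbb R\times M$ containing $\{0\}\times M$, with $\Phi_0=\mathrm{id}_M$, such that each $\Phi_\lambda$ is a $C^m$ diffeomorphism from the open set where it is defined onto an open subset of $M$. A gauge is a one-parameter family of diffeomorphisms of class (at least) $C^1$. Let $\varphi$ and $\psi$ be gauges and suppose that $\Phi_\lambda:=\varphi_\lambda^{-1}\circ\psi_\lambda$ (defined where this composition makes sense) is a one-parameter family of diffeomorphisms of class $C^n$. (a) There are vector fields $\xi_1,\dots,\xi_{n-1}$ on $M$, with $\xi_l$ of class $C^{n-l}$, generating (local) flows $\phi^{(1)},\dots,\phi^{(n-1)}$ such that the knight of rank $n-1$ $$\Psi_\lambda=\phi^{(n-1)}_{\lambda^{n-1}/(n-1)!}\circ\cdots\circ\phi^{(2)}_{\lambda^2/2}\circ\phi^{(1)}_\lambda$$ approximates $\Phi_\lambda$ up to the order $\lambda^n$, that is, $f(\Phi_\lambda(p))-f(\Psi_\lambda(p))=O(\lambda^n)$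 as $\lambda\to0$, for every $p\in M$ and every real function $f$ of class $C^n$ on $M$. (b) Let $\xi_1,\dots,\xi_{n-1}$ be any vector fields as in (a). Let $T_\lambda$ be a one-parameter family of tensor fields on $M$, of arbitrary type $(r,s)$, such that the family $\varphi_\lambda^*T_\lambda$ is jointly of class $C^n$ in $(\lambda,p)$ on the domain of $\varphi$. For a gauge $\chi\in\{\varphi,\psi\}$ put $\Delta T^\chi_\lambda:=\chi_\lambda^*T_\lambda-T_0$, let $\delta^0T^\chi:=T_0$ and, for $1\le k<n$, let $\delta^kT^\chi:=\left.\frac{d^k}{d\lambda^k}\right|_{0}\Delta T^\chi_\lambda$ be the coefficient of $\lambda^k/k!$ in the Taylor expansion of $\Delta T^\chi_\lambda$ at $\lambda=0$. Then, for all $0\le k<n$, at every point of $M$, $$\delta^kT^\psi=\sum_{l=0}^k\frac{k!}{(k-l)!}\sum_{(j_1,\dots,j_k)\in J_l}\frac{1}{2!^{\,j_2}\cdots k!^{\,j_k}\,j_1!\cdots j_k!}\;\pounds_{\xi_1}^{j_1}\cdots\pounds_{\xi_k}^{j_k}\,\delta^{k-l}T^\varphi ,$$ where $J_l:=\{(j_1,\dots,j_k)\in\mathbb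 N^k:\ \sum_{i=1}^k i\,j_i=l\}$, $\mathbb N\ni0$, and $\pounds_\xi$ is the Lie derivative along $\xi$. -/

import Mathlib

open scoped Manifold ContDiff Topology

noncomputable section

namespace GaugePerturbation

/-! ### Tensors on a vector space -/

/-- Tensors of type `(r, s)` on a finite-dimensional real vector space `V`: maps
`(α₁, …, α_r) ↦ (v₁, …, v_s) ↦ T(α₁, …, α_r; v₁, …, v_s)` that are linear in each covector `αᵢ`
and in each vector `vⱼ`. -/
abbrev Tensor (r s : ℕ) (V : Type*) [NormedAddCommGroup V] [NormedSpace ℝ V] : Type _ :=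
  ContinuousMultilinearMap ℝ (fun _ : Fin r => StrongDual ℝ V)
    (ContinuousMultilinearMap ℝ (fun _ : Fin s => V) ℝ)

section Linear

variable {r s : ℕ}
variable {V : Type*} [NormedAddCommGroup V] [NormedSpace ℝ V]
variable {W : Type*} [NormedAddCommGroup W] [NormedSpace ℝ W]

/-- Precomposition of covectors with a linear map: `α ↦ α ∘ A`. -/
def dualMap (A : V →L[ℝ] W) : StrongDual ℝ W →L[ℝ] StrongDual ℝ V :=
  ContinuousLinearMap.precomp ℝ A

/-- Apply linear maps to the arguments of a tensor: `P i` to the `i`-th covector argument and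
`Q j` to the `j`-th vector argument. -/
def Tensor.compArgs (T : Tensor r s W) (P : Fin r → (StrongDual ℝ V →L[ℝ] StrongDual ℝ W))
    (Q : Fin s → (V →L[ℝ] W)) : Tensor r s V :=
  (ContinuousMultilinearMap.compContinuousLinearMapL Q).compContinuousMultilinearMap
    (T.compContinuousLinearMap P)

theorem Tensor.compArgs_apply (T : Tensor r s W)
    (P : Fin r → (StrongDual ℝ V →L[ℝ] StrongDual ℝ W)) (Q : Fin s → (V →L[ℝ] W))
    (α : Fin r → StrongDual ℝ V) (v : Fin s → V) :
    T.compArgs P Q α v = T (fun i => P i (α i)) (fun j => Q j (v j)) := rfl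

/-- Pull-back of a tensor along a linear isomorphism `A : V → W`:
`(A^* T)(α; v) = T(α ∘ A⁻¹; A v)`. -/
def Tensor.pullback (A : V →L[ℝ] W) (T : Tensor r s W) : Tensor r s V :=
  T.compArgs (fun _ => dualMap A.inverse) (fun _ => A)

theorem Tensor.pullback_apply (A : V →L[ℝ] W) (T : Tensor r s W)
    (α : Fin r → StrongDual ℝ V) (v : Fin s → V) :
    T.pullback A α v = T (fun i => (α i).comp A.inverse) (fun j => A (v j)) := rfl

/-- The derivative at `t = 0` of the pull-back of the tensor `T` along `1 + t A`:
`∑ⱼ T(α; …, A vⱼ, …) - ∑ᵢ T(…, αᵢ ∘ A, …; v)`. -/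
def Tensor.derivation (A : V →L[ℝ] V) (T : Tensor r s V) : Tensor r s V :=
  (∑ j : Fin s, T.compArgs (fun _ => ContinuousLinearMap.id ℝ _)
      (Function.update (fun _ => ContinuousLinearMap.id ℝ V) j A))
    - ∑ i : Fin r, T.compArgs
      (Function.update (fun _ => ContinuousLinearMap.id ℝ _) i (dualMap A))
      (fun _ => ContinuousLinearMap.id ℝ V)

theorem Tensor.derivation_apply (A : V →L[ℝ] V) (T : Tensor r s V)
    (α : Fin r → StrongDual ℝ V) (v : Fin s → V) :
    T.derivation A α v = (∑ j, T α (Function.update v j (A (v j))))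
      - ∑ i, T (Function.update α i ((α i).comp A)) v := by
  simp only [Tensor.derivation, sub_apply, sum_apply,
    Tensor.compArgs_apply]
  congr 1
  · refine Finset.sum_congr rfl fun j _ => ?_
    congr 1
    funext i
    by_cases h : i = j
    · subst h; simp
    · simp [h]
  · refine Finset.sum_congr rfl fun j _ => ?_
    congr 2
    funext i
    by_cases h : i = j
    · subst h; simp [dualMap]
    · simp [h]

/-- The Lie derivative of a tensor field `T` on a vector space along the vector field `X`, given
by the classical formula (in components `X^c ∂_c T^{a…}_{b…} + T^{a…}_{c…} ∂_b X^c + … -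
T^{c…}_{b…} ∂_c X^a - …`). -/
def lieDerivativeSpace (X : V → V) (T : V → Tensor r s V) (u : V) : Tensor r s V :=
  fderiv ℝ T u (X u) + (T u).derivation (fderiv ℝ X u)

end Linear

/-! ### Tensor fields on a manifold -/

section Manifold

variable {r s : ℕ}
variable {E : Type*} [NormedAddCommGroup E] [NormedSpace ℝ E]
variable {M : Type*} [TopologicalSpace M] [ChartedSpace E M]
variable {N : Type*} [TopologicalSpace N] [ChartedSpace E N]

/-- The pull-back `f^* T` of a tensor field `T` on `M` under a local diffeomorphism `f : N → M`.
The value at `p` of a tensor field is a tensor on the tangent space `TangentSpace 𝓘(ℝ, E) p`, which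
is by definition the vector space `E`. -/
def pullbackField (f : N → M) (T : M → Tensor r s E) (p : N) : Tensor r s E :=
  Tensor.pullback (V := E) (W := E) (mfderiv 𝓘(ℝ, E) 𝓘(ℝ, E) f p) (T (f p))

/-- The components of the tensor field `T` in the preferred chart at `x`: a tensor field on `E`
(meaningful on the image of the chart). -/
def tensorInChart (x : M) (T : M → Tensor r s E) : E → Tensor r s E :=
  pullbackField (extChartAt 𝓘(ℝ, E) x).symm T

/-- The components of the vector field `X` in the preferred chart at `x`: a vector field on `E`
(meaningful on the image of the chart). -/
def vectorInChart (x : M) (X : (p : M) → TangentSpace 𝓘(ℝ, E) p) : E → E :=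
  VectorField.mpullback 𝓘(ℝ, E) 𝓘(ℝ, E) (extChartAt 𝓘(ℝ, E) x).symm X

/-- The Lie derivative `£_X T` of a tensor field along a vector field: at `p` it is computed in the
preferred chart at `p`. -/
def lieDerivative (X : (p : M) → TangentSpace 𝓘(ℝ, E) p) (T : M → Tensor r s E) :
    M → Tensor r s E := fun p =>
  pullbackField (extChartAt 𝓘(ℝ, E) p)
    (lieDerivativeSpace (vectorInChart p X) (tensorInChart p T)) p

/-- The family of tensor fields `S_t`, defined for `(t, p)` in the set `D ⊆ ℝ × M`, is jointly of
class `C^n` in `(t, p)`: so are its components in every preferred chart. -/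
def ContDiffTensorFamilyOn (n : ℕ) (S : ℝ → M → Tensor r s E) (D : Set (ℝ × M)) : Prop :=
  ∀ x : M, ContDiffOn ℝ n (fun z : ℝ × E => tensorInChart x (S z.1) z.2)
    {z | z.2 ∈ (extChartAt 𝓘(ℝ, E) x).target ∧ (z.1, (extChartAt 𝓘(ℝ, E) x).symm z.2) ∈ D}

/-! ### One-parameter families of diffeomorphisms, flows and knights -/

/-- The domain `{(t, p) | Φ_t(p) is defined} ⊆ ℝ × M` of a one-parameter family of maps, each
defined on an open subset of `M`. -/
def familyDomain (Φ : ℝ → OpenPartialHomeomorph M M) : Set (ℝ × M) :=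
  {z | z.2 ∈ (Φ z.1).source}

/-- One-parameter families of diffeomorphisms of `M`, of class `C^n`: the map
`(t, p) ↦ Φ_t(p)` is `C^n` on an open domain that contains `{0} × M`, `Φ_0(p) = p`, and each `Φ_t`
is a diffeomorphism from the set where it is defined onto its image. -/
structure IsDiffeoFamily (n : ℕ) (Φ : ℝ → OpenPartialHomeomorph M M) : Prop where
  isOpen_domain : IsOpen (familyDomain Φ)
  zero_mem : ∀ p : M, ((0 : ℝ), p) ∈ familyDomain Φ
  map_zero : ∀ p : M, Φ 0 p = p
  contMDiffOn : ContMDiffOn (𝓘(ℝ, ℝ).prod 𝓘(ℝ, E)) 𝓘(ℝ, E) n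
    (fun z : ℝ × M => Φ z.1 z.2) (familyDomain Φ)
  contMDiffOn_symm : ∀ t : ℝ, ContMDiffOn 𝓘(ℝ, E) 𝓘(ℝ, E) n (Φ t).symm (Φ t).target

/-- `φ` is a (local) flow on `M` with open domain `D ⊇ {0} × M`, generated by the vector field `X`:
for each `p`, `t ↦ φ_t(p)` is the integral curve of `X` through `p`, on an interval. -/
structure IsFlowOn (X : (p : M) → TangentSpace 𝓘(ℝ, E) p) (φ : ℝ → M → M) (D : Set (ℝ × M)) :
    Prop where
  isOpen_domain : IsOpen D
  zero_mem : ∀ p : M, ((0 : ℝ), p) ∈ D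
  ordConnected : ∀ p : M, {t : ℝ | (t, p) ∈ D}.OrdConnected
  map_zero : ∀ p : M, φ 0 p = p
  continuousOn : ContinuousOn (fun z : ℝ × M => φ z.1 z.2) D
  isMIntegralCurveOn : ∀ p : M, IsMIntegralCurveOn (fun t => φ t p) X {t : ℝ | (t, p) ∈ D}

/-- The knight of rank `k` built from the flows `φ 1, …, φ k`:
`φ^{(k)}_{t^k/k!} ∘ ⋯ ∘ φ^{(2)}_{t^2/2} ∘ φ^{(1)}_t`. -/
def knight (φ : ℕ → ℝ → M → M) : ℕ → ℝ → M → M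
  | 0, _, p => p
  | k + 1, t, p => φ (k + 1) (t ^ (k + 1) / (Nat.factorial (k + 1) : ℝ)) (knight φ k t p)

/-- `ξ 1, …, ξ (n - 1)` are vector fields, `ξ l` of class `C^{n-l}`, that generate a knight `Ψ` of
rank `n - 1` approximating `Φ` up to the order `t^n`: `f ∘ Φ_t - f ∘ Ψ_t = O(t^n)` as `t → 0`, at
each point, for all real functions `f` of class `C^n`. (Values `ξ l` for other `l` are
irrelevant.) -/
structure GeneratesApproximatingKnight [IsManifold 𝓘(ℝ, E) ∞ M] (n : ℕ)
    (Φ : ℝ → OpenPartialHomeomorph M M) (ξ : ℕ → (p : M) → TangentSpace 𝓘(ℝ, E) p) : Prop where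
  contMDiff : ∀ l : ℕ, 1 ≤ l → l < n →
    ContMDiff 𝓘(ℝ, E) (𝓘(ℝ, E).prod 𝓘(ℝ, E)) ((n - l : ℕ) : WithTop ℕ∞)
      (fun p : M => (⟨p, ξ l p⟩ : TangentBundle 𝓘(ℝ, E) M))
  exists_flows : ∃ (φ : ℕ → ℝ → M → M) (D : ℕ → Set (ℝ × M)),
    (∀ l : ℕ, 1 ≤ l → l < n → IsFlowOn (ξ l) (φ l) (D l)) ∧
    ∀ f : M → ℝ, ContMDiff 𝓘(ℝ, E) 𝓘(ℝ, ℝ) n f → ∀ p : M,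
      (fun t : ℝ => f (Φ t p) - f (knight φ (n - 1) t p)) =O[𝓝 0] (fun t : ℝ => t ^ n)

/-! ### Gauges and perturbations -/

/-- The change of gauge `Φ_t = φ_t⁻¹ ∘ ψ_t` (defined at `p` when `ψ_t(p)` lies in the image of
`φ_t`). -/
def gaugeChange (φ ψ : ℝ → OpenPartialHomeomorph M M) (t : ℝ) : OpenPartialHomeomorph M M :=
  (ψ t).trans (φ t).symm

/-- The perturbation `ΔT^φ_t = φ_t^* T_t - T_0` of the family of tensor fields `T_t` in the
gauge `φ`. -/
def perturbation (T : ℝ → M → Tensor r s E) (φ : ℝ → OpenPartialHomeomorph M M) (t : ℝ) (p : M) :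
    Tensor r s E :=
  pullbackField (φ t) (T t) p - T 0 p

/-- The perturbation `δ^k T^φ` of order `k`: the coefficient of `t^k/k!` in the Taylor expansion of
`ΔT^φ_t` at `t = 0` (for `k ≥ 1`), and `δ^0 T^φ = T_0`. -/
def perturbationOrder (T : ℝ → M → Tensor r s E) (φ : ℝ → OpenPartialHomeomorph M M) :
    ℕ → M → Tensor r s E
  | 0, p => T 0 p
  | k + 1, p => iteratedDeriv (k + 1) (fun t => perturbation T φ t p) 0

/-- The index set `{(j_1, …, j_k) ∈ ℕ^k | ∑ i j_i = l}` (with `j_i` written `j (i - 1)`). -/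
def weightedIndices (k l : ℕ) : Finset (Fin k → ℕ) :=
  (Fintype.piFinset fun _ : Fin k => Finset.range (l + 1)).filter
    fun j => ∑ i : Fin k, ((i : ℕ) + 1) * j i = l

theorem mem_weightedIndices {k l : ℕ} {j : Fin k → ℕ} :
    j ∈ weightedIndices k l ↔ ∑ i : Fin k, ((i : ℕ) + 1) * j i = l := by
  simp only [weightedIndices, Finset.mem_filter, Fintype.mem_piFinset, Finset.mem_range,
    and_iff_right_iff_imp]
  intro h i
  have h1 : ((i : ℕ) + 1) * j i ≤ ∑ i : Fin k, ((i : ℕ) + 1) * j i :=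
    Finset.single_le_sum (f := fun i : Fin k => ((i : ℕ) + 1) * j i)
      (fun _ _ => Nat.zero_le _) (Finset.mem_univ i)
  nlinarith [Nat.zero_le ((i : ℕ) * j i)]

/-- `£_{ξ_1}^{j_1} ⋯ £_{ξ_k}^{j_k} S` (the derivative along `ξ_k` is applied first). -/
def iteratedLie (ξ : ℕ → (p : M) → TangentSpace 𝓘(ℝ, E) p) {k : ℕ} (j : Fin k → ℕ)
    (S : M → Tensor r s E) : M → Tensor r s E :=
  (List.ofFn fun i : Fin k => (lieDerivative (r := r) (s := s) (ξ ((i : ℕ) + 1)))^[j i]).foldr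
    (fun L S' => L S') S

end Manifold

end GaugePerturbation

end

open scoped Manifold ContDiff Topology

namespace GaugePerturbation

open Asymptotics Filter Set Finset

/-! ### The formal series of a knight -/

section KnightCoeff

variable {H : Type*} [AddCommGroup H] [Module ℝ H]

/-- The coefficient of `t ^ k` in the formal series
`exp (t L₁) exp (t² L₂ / 2!) ⋯ exp (t ^ m L_m / m!) G`. -/
noncomputable def knightCoeff (L : ℕ → H → H) : ℕ → ℕ → H → H
  | 0, k, G => if k = 0 then G else 0
  | m + 1, k, G => ∑ j ∈ (range (k + 1)).filter (fun j => (m + 1) * j ≤ k),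
      (1 / ((Nat.factorial (m + 1) : ℝ) ^ j * (Nat.factorial j : ℝ))) •
        knightCoeff L m (k - (m + 1) * j) ((L (m + 1))^[j] G)

variable {H' : Type*} [AddCommGroup H'] [Module ℝ H']

/-- A graded relation preserved by the operators is preserved by the coefficients of knights. -/
theorem knightCoeff_rel {L : ℕ → H → H} {L' : ℕ → H' → H'} {R : ℕ → H → H' → Prop} {m : ℕ}
    (hzero : ∀ d a a', R d a a' → R d 0 0)
    (hadd : ∀ d a a' b b', R d a a' → R d b b' → R d (a + b) (a' + b'))
    (hsmul : ∀ d (c : ℝ) a a', R d a a' → R d (c • a) (c • a'))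
    (hmono : ∀ d e a a', e ≤ d → R d a a' → R e a a')
    (hL : ∀ i d a a', 1 ≤ i → i ≤ m → i ≤ d → R d a a' → R (d - i) (L i a) (L' i a'))
    {k d : ℕ} (hk : k ≤ d) {a : H} {a' : H'} (h : R d a a') :
    R (d - k) (knightCoeff L m k a) (knightCoeff L' m k a') := by
  induction m generalizing k d a a' with
  | zero =>
    by_cases h0 : k = 0
    · simpa [knightCoeff, h0] using h
    · simpa [knightCoeff, h0] using hzero _ _ _ (hmono d (d - k) a a' (Nat.sub_le _ _) h)
  | succ m ih =>
    have hiter : ∀ j, (m + 1) * j ≤ d →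
        R (d - (m + 1) * j) ((L (m + 1))^[j] a) ((L' (m + 1))^[j] a') := by
      intro j
      induction j with
      | zero => intro _; simpa using h
      | succ j ihj =>
        intro hj
        rw [Function.iterate_succ_apply', Function.iterate_succ_apply', mul_add, mul_one,
          ← Nat.sub_sub]
        rw [mul_add, mul_one] at hj
        exact hL _ _ _ _ (by omega) le_rfl (by omega) (ihj (by omega))
    simp only [knightCoeff]
    have hz : R (d - k) 0 0 := hzero _ _ _ (hmono d (d - k) a a' (Nat.sub_le _ _) h)
    have hterm : ∀ j ∈ (range (k + 1)).filter (fun j => (m + 1) * j ≤ k),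
        R (d - k) ((1 / ((Nat.factorial (m + 1) : ℝ) ^ j * (Nat.factorial j : ℝ))) •
          knightCoeff L m (k - (m + 1) * j) ((L (m + 1))^[j] a))
          ((1 / ((Nat.factorial (m + 1) : ℝ) ^ j * (Nat.factorial j : ℝ))) •
          knightCoeff L' m (k - (m + 1) * j) ((L' (m + 1))^[j] a')) := by
      intro j hj
      have hj' := (Finset.mem_filter.1 hj).2
      have := ih (fun i d a a' h1 h2 => hL i d a a' h1 (by omega))
        (k := k - (m + 1) * j) (by omega) (hiter j (by omega))
      rw [show d - (m + 1) * j - (k - (m + 1) * j) = d - k by omega] at this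
      exact hsmul _ _ _ _ this
    revert hterm
    generalize (range (k + 1)).filter (fun j => (m + 1) * j ≤ k) = s
    intro hterm
    induction s using Finset.induction_on with
    | empty => simpa using hz
    | insert x s hx ihs =>
      rw [Finset.sum_insert hx, Finset.sum_insert hx]
      exact hadd _ _ _ _ _ (hterm x (by simp)) (ihs fun j hj => hterm j (by simp [hj]))

theorem knightCoeff_succ_of_le (L : ℕ → H → H) {m k : ℕ} (h : k ≤ m) (G : H) :
    knightCoeff L (m + 1) k G = knightCoeff L m k G := by
  have : (range (k + 1)).filter (fun j => (m + 1) * j ≤ k) = {0} := by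
    ext j
    simp only [Finset.mem_filter, Finset.mem_range, Finset.mem_singleton]
    refine ⟨fun hj => ?_, by rintro rfl; simp⟩
    by_contra h0
    have : 1 ≤ j := Nat.one_le_iff_ne_zero.2 h0
    nlinarith [hj.2]
  simp [knightCoeff, this]

theorem knightCoeff_of_le (L : ℕ → H → H) {m m' k : ℕ} (h : k ≤ m) (hm : m ≤ m') (G : H) :
    knightCoeff L m' k G = knightCoeff L m k G := by
  induction m', hm using Nat.le_induction with
  | base => rfl
  | succ m' hm ih => rw [knightCoeff_succ_of_le L (h.trans hm), ih]

theorem knightCoeff_zero_right (L : ℕ → H → H) (m : ℕ) (G : H) : knightCoeff L m 0 G = G := by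
  rw [knightCoeff_of_le L le_rfl (Nat.zero_le m)]
  simp [knightCoeff]

theorem knightCoeff_succ_self (L : ℕ → H → H) (m : ℕ) (G : H) :
    knightCoeff L (m + 1) (m + 1) G =
      knightCoeff L m (m + 1) G + (1 / (Nat.factorial (m + 1) : ℝ)) • L (m + 1) G := by
  have : (range (m + 1 + 1)).filter (fun j => (m + 1) * j ≤ m + 1) = {0, 1} := by
    ext j
    simp only [Finset.mem_filter, Finset.mem_range, Finset.mem_singleton, Finset.mem_insert]
    refine ⟨fun hj => ?_, by rintro (rfl | rfl) <;> simp⟩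
    by_contra h0
    have : 2 ≤ j := by omega
    nlinarith [hj.2]
  rw [knightCoeff, this, Finset.sum_pair (by simp)]
  simp [knightCoeff_zero_right]

theorem knightCoeff_congr {L L' : ℕ → H → H} {m : ℕ} (h : ∀ i, 1 ≤ i → i ≤ m → L i = L' i)
    (k : ℕ) (G : H) : knightCoeff L m k G = knightCoeff L' m k G := by
  induction m generalizing k G with
  | zero => rfl
  | succ m ih =>
    simp only [knightCoeff]
    refine Finset.sum_congr rfl fun j _ => ?_
    rw [h (m + 1) (by omega) le_rfl, ih fun i h1 h2 => h i h1 (by omega)]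

theorem weightedIndices_zero (l : ℕ) :
    weightedIndices 0 l = if l = 0 then {Fin.elim0} else ∅ := by
  ext j
  rw [mem_weightedIndices]
  split_ifs with h
  · simp [h, Subsingleton.elim j Fin.elim0]
  · simp [Ne.symm h]

/-- The coefficients of a knight as sums over weighted multi-indices. -/
theorem sum_weightedIndices_eq_knightCoeff (L : ℕ → H → H) (m l : ℕ) (G : H) :
    ∑ j ∈ weightedIndices m l, (1 / ∏ i : Fin m,
        ((Nat.factorial ((i : ℕ) + 1) : ℝ) ^ j i * (Nat.factorial (j i) : ℝ))) •
        (List.ofFn fun i : Fin m => (L ((i : ℕ) + 1))^[j i]).foldr (fun L S' => L S') G =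
      knightCoeff L m l G := by
  induction m generalizing l G with
  | zero =>
    rw [weightedIndices_zero]
    split_ifs with h <;> simp [knightCoeff, h]
  | succ m ih =>
    simp only [knightCoeff]
    simp_rw [← ih, Finset.smul_sum]
    rw [Finset.sum_sigma']
    refine Finset.sum_bij' (fun j _ => ⟨j (Fin.last m), fun i => j i.castSucc⟩)
      (fun x _ => Fin.snoc (α := fun _ => ℕ) x.2 x.1) ?_ ?_ ?_ ?_ ?_
    · intro j hj
      rw [mem_weightedIndices, Fin.sum_univ_castSucc] at hj
      simp only [Finset.mem_sigma, Finset.mem_filter, Finset.mem_range, mem_weightedIndices]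
      simp only [Fin.val_castSucc, Fin.val_last] at hj
      refine ⟨⟨?_, by omega⟩, by omega⟩
      have : j (Fin.last m) ≤ (m + 1) * j (Fin.last m) := Nat.le_mul_of_pos_left _ (by omega)
      omega
    · rintro ⟨a, j⟩ hj
      simp only [Finset.mem_sigma, Finset.mem_filter, Finset.mem_range, mem_weightedIndices] at hj
      rw [mem_weightedIndices, Fin.sum_univ_castSucc]
      simp only [Fin.snoc_castSucc, Fin.snoc_last, Fin.val_castSucc, Fin.val_last]
      omega
    · intro j _
      exact Fin.snoc_init_self (α := fun _ => ℕ) j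
    · rintro ⟨a, j⟩ _
      simp
    · intro j _
      rw [List.ofFn_succ', List.concat_eq_append, List.foldr_append, smul_smul,
        Fin.prod_univ_castSucc]
      simp only [Fin.val_castSucc, Fin.val_last, List.foldr_cons, List.foldr_nil]
      congr 1
      rw [one_div_mul_one_div, mul_comm]

end KnightCoeff

/-! ### Asymptotic expansions -/

section Expansions

variable {F : Type*} [NormedAddCommGroup F] [NormedSpace ℝ F]

theorem eq_zero_of_sum_pow_smul_isLittleO {N : ℕ} {a : ℕ → F}
    (h : (fun t : ℝ => ∑ k ∈ range (N + 1), t ^ k • a k) =o[𝓝[≠] 0] fun t : ℝ => t ^ N) :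
    ∀ k ≤ N, a k = 0 := by
  induction N generalizing a with
  | zero =>
    intro k hk
    obtain rfl : k = 0 := by omega
    have h1 : Tendsto (fun _ : ℝ => a 0) (𝓝[≠] 0) (𝓝 0) := by
      simpa using h
    exact tendsto_nhds_unique tendsto_const_nhds h1
  | succ N ih =>
    have h0 : a 0 = 0 := by
      have h1 : Tendsto (fun t : ℝ => ∑ k ∈ range (N + 1 + 1), t ^ k • a k) (𝓝[≠] 0)
          (𝓝 (∑ k ∈ range (N + 1 + 1), (0 : ℝ) ^ k • a k)) := by
        refine Tendsto.mono_left ?_ nhdsWithin_le_nhds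
        refine Continuous.tendsto (f := fun t : ℝ => ∑ k ∈ range (N + 1 + 1), t ^ k • a k) ?_ 0
        fun_prop
      have h2 : Tendsto (fun t : ℝ => ∑ k ∈ range (N + 1 + 1), t ^ k • a k) (𝓝[≠] 0) (𝓝 0) := by
        refine h.trans_tendsto (Tendsto.mono_left ?_ nhdsWithin_le_nhds)
        have : Tendsto (fun t : ℝ => t ^ (N + 1)) (𝓝 0) (𝓝 (0 ^ (N + 1))) :=
          (continuous_pow (N + 1)).tendsto 0
        simpa using this
      have h3 := tendsto_nhds_unique h1 h2
      rw [Finset.sum_range_succ'] at h3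
      simpa using h3
    have h4 : (fun t : ℝ => ∑ k ∈ range (N + 1), t ^ k • a (k + 1)) =o[𝓝[≠] 0]
        fun t : ℝ => t ^ N := by
      have h5 : (fun t : ℝ => t⁻¹ • ∑ k ∈ range (N + 1 + 1), t ^ k • a k) =o[𝓝[≠] 0]
          fun t : ℝ => t⁻¹ • t ^ (N + 1) := (isBigO_refl _ _).smul_isLittleO h
      refine h5.congr' ?_ ?_
      · filter_upwards [self_mem_nhdsWithin] with t ht
        rw [Finset.sum_range_succ', h0]
        simp only [pow_zero, smul_zero, add_zero, Finset.smul_sum, smul_smul, pow_succ']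
        refine Finset.sum_congr rfl fun k _ => ?_
        rw [inv_mul_cancel_left₀ ht]
      · filter_upwards [self_mem_nhdsWithin] with t ht
        rw [pow_succ', smul_eq_mul, inv_mul_cancel_left₀ ht]
    intro k hk
    rcases k with _ | k
    · exact h0
    · exact ih h4 k (by omega)

/-- Uniqueness of the coefficients of an asymptotic expansion in powers of `t`. -/
theorem eq_of_sum_pow_smul_isLittleO {N : ℕ} {a b : ℕ → F} {f : ℝ → F}
    (ha : (fun t : ℝ => f t - ∑ k ∈ range (N + 1), t ^ k • a k) =o[𝓝 0] fun t : ℝ => t ^ N)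
    (hb : (fun t : ℝ => f t - ∑ k ∈ range (N + 1), t ^ k • b k) =o[𝓝 0] fun t : ℝ => t ^ N) :
    ∀ k ≤ N, a k = b k := by
  intro k hk
  have := eq_zero_of_sum_pow_smul_isLittleO (N := N) (a := fun k => a k - b k)
    (((hb.sub ha).mono nhdsWithin_le_nhds).congr_left fun t => by
      simp only [smul_sub, Finset.sum_sub_distrib]; abel) k hk
  exact sub_eq_zero.1 this

theorem isBigO_pow_pow_of_le {W : Type*} {l : Filter W} {f : W → ℝ} (hf : Tendsto f l (𝓝 0))
    {a b : ℕ} (h : b ≤ a) : (fun z => f z ^ a) =O[l] fun z => f z ^ b := by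
  have h1 : (fun z => f z ^ (a - b) * f z ^ b) =O[l] fun z => (1 : ℝ) * f z ^ b := by
    refine IsBigO.mul ?_ (isBigO_refl _ _)
    exact (hf.pow (a - b)).isBigO_one ℝ
  refine h1.congr (fun z => ?_) fun z => one_mul _
  rw [← pow_add, Nat.sub_add_cancel h]

theorem isLittleO_pow_pow_of_lt {W : Type*} {l : Filter W} {f : W → ℝ} (hf : Tendsto f l (𝓝 0))
    {a b : ℕ} (h : b < a) : (fun z => f z ^ a) =o[l] fun z => f z ^ b := by
  have h1 : (fun z => f z ^ (a - b) * f z ^ b) =o[l] fun z => (1 : ℝ) * f z ^ b := by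
    refine IsLittleO.mul_isBigO ?_ (isBigO_refl _ _)
    rw [isLittleO_one_iff]
    simpa [Nat.sub_ne_zero_of_lt h] using hf.pow (a - b)
  refine h1.congr (fun z => ?_) fun z => one_mul _
  rw [← pow_add, Nat.sub_add_cancel h.le]

variable {W : Type*} [NormedAddCommGroup W]

theorem tendsto_fst_nhds_zero (w₀ : W) :
    Tendsto (fun z : ℝ × W => z.1) (𝓝 ((0 : ℝ), w₀)) (𝓝 0) :=
  continuous_fst.tendsto' _ _ rfl

/-- Mean value inequality with parameters. -/
theorem eventually_norm_le_of_hasDerivAt {R R' : ℝ × W → F} {g : ℝ → ℝ} {w₀ : W} {C : ℝ}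
    (hC : 0 ≤ C) (hg : MonotoneOn g (Ici 0))
    (hR0 : ∀ᶠ w in 𝓝 w₀, R (0, w) = 0)
    (hd : ∀ᶠ z in 𝓝 ((0 : ℝ), w₀), HasDerivAt (fun s => R (s, z.2)) (R' z) z.1)
    (hb : ∀ᶠ z in 𝓝 ((0 : ℝ), w₀), ‖R' z‖ ≤ C * g |z.1|) :
    ∀ᶠ z in 𝓝 ((0 : ℝ), w₀), ‖R z‖ ≤ C * (|z.1| * g |z.1|) := by
  have h1 := (hd.and hb).and ((continuous_snd.tendsto ((0 : ℝ), w₀)).eventually hR0)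
  obtain ⟨δ, hδ, hball⟩ := Metric.eventually_nhds_iff_ball.1 h1
  filter_upwards [Metric.ball_mem_nhds ((0 : ℝ), w₀) hδ] with z hz
  rw [← ball_prod_same, Set.mem_prod, mem_ball_zero_iff, Real.norm_eq_abs] at hz
  have hseg : ∀ s ∈ segment ℝ (0 : ℝ) z.1, |s| ≤ |z.1| := by
    intro s hs
    rw [segment_eq_uIcc] at hs
    simpa using Set.abs_sub_left_of_mem_uIcc hs
  have hmem : ∀ s ∈ segment ℝ (0 : ℝ) z.1, (s, z.2) ∈ Metric.ball ((0 : ℝ), w₀) δ := by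
    intro s hs
    rw [← ball_prod_same, Set.mem_prod, mem_ball_zero_iff, Real.norm_eq_abs]
    exact ⟨(hseg s hs).trans_lt hz.1, hz.2⟩
  have h2 := Convex.norm_image_sub_le_of_norm_hasDerivWithin_le
    (f := fun s => R (s, z.2)) (f' := fun s => R' (s, z.2)) (C := C * g |z.1|)
    (s := segment ℝ 0 z.1) (x := 0) (y := z.1)
    (fun s hs => (hball _ (hmem s hs)).1.1.hasDerivWithinAt)
    (fun s hs => ((hball _ (hmem s hs)).1.2).trans
      (mul_le_mul_of_nonneg_left (hg (abs_nonneg s) (abs_nonneg z.1) (hseg s hs)) hC))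
    (convex_segment _ _) (left_mem_segment _ _ _) (right_mem_segment _ _ _)
  have h3 : R (0, z.2) = 0 := (hball _ (hmem 0 (left_mem_segment _ _ _))).2
  rw [h3, sub_zero, sub_zero, Real.norm_eq_abs] at h2
  calc ‖R z‖ ≤ C * g |z.1| * |z.1| := h2
    _ = _ := by ring

theorem isLittleO_of_hasDerivAt {R R' : ℝ × W → F} {g : ℝ → ℝ} {w₀ : W}
    (hg : MonotoneOn g (Ici 0)) (hg0 : ∀ x, 0 ≤ x → 0 ≤ g x)
    (hR0 : ∀ᶠ w in 𝓝 w₀, R (0, w) = 0)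
    (hd : ∀ᶠ z in 𝓝 ((0 : ℝ), w₀), HasDerivAt (fun s => R (s, z.2)) (R' z) z.1)
    (ho : R' =o[𝓝 ((0 : ℝ), w₀)] fun z => g |z.1|) :
    R =o[𝓝 ((0 : ℝ), w₀)] fun z => |z.1| * g |z.1| := by
  refine isLittleO_iff.2 fun C hC => ?_
  have h1 := eventually_norm_le_of_hasDerivAt hC.le hg hR0 hd (by
    filter_upwards [isLittleO_iff.1 ho hC] with z hz
    rwa [Real.norm_of_nonneg (hg0 _ (abs_nonneg _))] at hz)
  filter_upwards [h1] with z hz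
  rwa [Real.norm_of_nonneg (mul_nonneg (abs_nonneg _) (hg0 _ (abs_nonneg _)))]

/-- The slice `{u | (0, u) ∈ O}`. -/
def zeroSlice (O : Set (ℝ × W)) : Set W := {u | ((0 : ℝ), u) ∈ O}

theorem isOpen_zeroSlice {O : Set (ℝ × W)} (hO : IsOpen O) : IsOpen (zeroSlice O) :=
  hO.preimage (by fun_prop : Continuous fun u : W => ((0 : ℝ), u))

theorem eventually_mem_slice {O : Set (ℝ × W)} (hO : IsOpen O) {u : W} {t : ℝ} (h : (t, u) ∈ O) :
    ∀ᶠ s in 𝓝 t, (s, u) ∈ O :=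
  (by fun_prop : Continuous fun s : ℝ => (s, u)).continuousAt.eventually (hO.mem_nhds h)

variable [NormedSpace ℝ W]

/-- The partial derivative with respect to time. -/
noncomputable def timeDeriv (H : ℝ × W → F) (z : ℝ × W) : F := fderiv ℝ H z (1, 0)

theorem hasDerivAt_timeDeriv {H : ℝ × W → F} {z : ℝ × W} (h : DifferentiableAt ℝ H z) :
    HasDerivAt (fun t => H (t, z.2)) (timeDeriv H z) z.1 := by
  have h1 : HasDerivAt (fun t : ℝ => (t, z.2)) ((1 : ℝ), (0 : W)) z.1 :=
    (hasDerivAt_id z.1).prodMk (hasDerivAt_const _ _)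
  exact HasFDerivAt.comp_hasDerivAt z.1 (f := fun t : ℝ => (t, z.2)) h.hasFDerivAt h1

theorem contDiffOn_timeDeriv {H : ℝ × W → F} {O : Set (ℝ × W)} (hO : IsOpen O) {m : ℕ}
    (h : ContDiffOn ℝ (m + 1 : ℕ) H O) : ContDiffOn ℝ m (timeDeriv H) O :=
  (h.fderiv_of_isOpen hO (by norm_cast)).clm_apply contDiffOn_const

theorem iteratedDeriv_succ_slice {H : ℝ × W → F} {O : Set (ℝ × W)} (hO : IsOpen O)
    (h : DifferentiableOn ℝ H O) {u : W} (hu : u ∈ zeroSlice O) (k : ℕ) :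
    iteratedDeriv (k + 1) (fun t => H (t, u)) 0 =
      iteratedDeriv k (fun t => timeDeriv H (t, u)) 0 := by
  rw [iteratedDeriv_succ']
  refine Filter.EventuallyEq.iteratedDeriv_eq k ?_
  filter_upwards [eventually_mem_slice hO hu] with t ht
  exact (hasDerivAt_timeDeriv (z := (t, u)) ((h _ ht).differentiableAt (hO.mem_nhds ht))).deriv

theorem contDiffOn_iteratedDeriv_slice {H : ℝ × W → F} {O : Set (ℝ × W)} (hO : IsOpen O)
    {m k : ℕ} (h : ContDiffOn ℝ m H O) (hk : k ≤ m) :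
    ContDiffOn ℝ (m - k : ℕ) (fun u => iteratedDeriv k (fun t => H (t, u)) 0) (zeroSlice O) := by
  induction k generalizing m H with
  | zero =>
    simp only [iteratedDeriv_zero]
    exact h.comp (by fun_prop : ContDiff ℝ m fun u : W => ((0 : ℝ), u)).contDiffOn fun u hu => hu
  | succ k ih =>
    obtain ⟨m, rfl⟩ : ∃ m', m = m' + 1 := ⟨m - 1, by omega⟩
    have h1 := ih (contDiffOn_timeDeriv hO h) (by omega)
    rw [Nat.add_sub_add_right]
    exact h1.congr fun u hu =>
      iteratedDeriv_succ_slice hO (h.differentiableOn (by norm_cast)) hu k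

/-- Taylor's formula in the time variable, locally uniformly in the space variable. -/
theorem time_taylor {H : ℝ × W → F} {O : Set (ℝ × W)} (hO : IsOpen O) {m : ℕ}
    (h : ContDiffOn ℝ m H O) {u₀ : W} (hu : u₀ ∈ zeroSlice O) :
    (fun z : ℝ × W => H z - ∑ k ∈ range (m + 1), z.1 ^ k •
      ((1 / (Nat.factorial k : ℝ)) • iteratedDeriv k (fun t => H (t, z.2)) 0))
      =o[𝓝 ((0 : ℝ), u₀)] fun z => z.1 ^ m := by
  have hev : ∀ᶠ w in 𝓝 u₀, w ∈ zeroSlice O := (isOpen_zeroSlice hO).mem_nhds hu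
  induction m generalizing H with
  | zero =>
    simp only [zero_add, Finset.range_one, Finset.sum_singleton, pow_zero, Nat.factorial_zero,
      Nat.cast_one, iteratedDeriv_zero, one_smul, isLittleO_one_iff, div_one]
    have hc : ContinuousAt H (0, u₀) := h.continuousOn.continuousAt (hO.mem_nhds hu)
    have hc' : Tendsto (fun z : ℝ × W => H (0, z.2)) (𝓝 (0, u₀)) (𝓝 (H (0, u₀))) :=
      hc.tendsto.comp ((by fun_prop : Continuous fun z : ℝ × W => ((0 : ℝ), z.2)).tendsto' _ _ rfl)
    simpa using hc.tendsto.sub hc'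
  | succ m ih =>
    have hdiff : DifferentiableOn ℝ H O := h.differentiableOn (by norm_cast)
    have h1 := ih (contDiffOn_timeDeriv hO h)
    have key := isLittleO_of_hasDerivAt (R := fun z : ℝ × W => H z -
        ∑ k ∈ range (m + 1 + 1), z.1 ^ k •
          ((1 / (Nat.factorial k : ℝ)) • iteratedDeriv k (fun t => H (t, z.2)) 0))
      (g := fun x => x ^ m) (w₀ := u₀)
      (R' := fun z : ℝ × W => timeDeriv H z - ∑ k ∈ range (m + 1), z.1 ^ k •
        ((1 / (Nat.factorial k : ℝ)) • iteratedDeriv k (fun t => timeDeriv H (t, z.2)) 0))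
      (fun a ha b _ hab => pow_le_pow_left₀ ha hab m) (fun x hx => pow_nonneg hx m)
      (by
        refine Eventually.of_forall fun w => ?_
        rw [Finset.sum_range_succ']
        simp)
      (by
        filter_upwards [hO.mem_nhds hu,
          (continuous_snd.tendsto ((0 : ℝ), u₀)).eventually hev] with z hz hz'
        refine (hasDerivAt_timeDeriv ((hdiff z hz).differentiableAt (hO.mem_nhds hz))).sub ?_
        simp only [← iteratedDeriv_succ_slice hO hdiff hz']
        simp only [Finset.sum_range_succ' _ (m + 1)]
        simp only [pow_zero, one_smul, Nat.factorial_zero]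
        refine HasDerivAt.add_const _ ?_
        refine HasDerivAt.fun_sum fun k _ => ?_
        have h3 : HasDerivAt (fun t : ℝ => t ^ (k + 1)) (((k + 1 : ℕ) : ℝ) * z.1 ^ k) z.1 := by
          simpa using hasDerivAt_pow (k + 1) z.1
        convert h3.smul_const ((1 / (Nat.factorial (k + 1) : ℝ)) •
          iteratedDeriv (k + 1) (fun t => H (t, z.2)) 0) using 1
        rw [smul_smul, smul_smul]
        congr 1
        rw [Nat.factorial_succ]
        have : (Nat.factorial k : ℝ) ≠ 0 := by positivity
        push_cast
        field_simp)
      (by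
        refine h1.trans_isBigO (IsBigO.of_norm_le fun z => ?_)
        simp)
    refine key.trans_isBigO (IsBigO.of_bound 1 (Eventually.of_forall fun z => ?_))
    simp [pow_succ']

/-- The derivative in the space variable commutes with time derivatives at time `0`. -/
theorem iteratedDeriv_fderiv_slice {E : Type*} [NormedAddCommGroup E] [NormedSpace ℝ E]
    {H : ℝ × E → F} {O : Set (ℝ × E)} (hO : IsOpen O)
    {m k : ℕ} (h : ContDiffOn ℝ m H O) (hk : k + 1 ≤ m) {u : E} (hu : u ∈ zeroSlice O) :
    iteratedDeriv k (fun t => fderiv ℝ (fun v => H (t, v)) u) 0 =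
      fderiv ℝ (fun v => iteratedDeriv k (fun t => H (t, v)) 0) u := by
  induction k generalizing m H with
  | zero => simp
  | succ k ih =>
    obtain ⟨m, rfl⟩ : ∃ m', m = m' + 1 := ⟨m - 1, by omega⟩
    have hdiff : DifferentiableOn ℝ H O := h.differentiableOn (by norm_cast)
    have h1 := ih (contDiffOn_timeDeriv hO h) (by omega)
    have hslice : ∀ z ∈ O, fderiv ℝ (fun v => H (z.1, v)) z.2 =
        (fderiv ℝ H z).comp (ContinuousLinearMap.inr ℝ ℝ E) := by
      intro z hz
      have h2 : HasFDerivAt (fun v : E => (z.1, v)) (ContinuousLinearMap.inr ℝ ℝ E) z.2 :=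
        hasFDerivAt_prodMk_right z.1 z.2
      exact (HasFDerivAt.comp z.2 (g := H) (f := fun v : E => (z.1, v))
        ((hdiff z hz).differentiableAt (hO.mem_nhds hz)).hasFDerivAt h2).fderiv
    have hd2 : ∀ z ∈ O, DifferentiableAt ℝ (fderiv ℝ H) z := fun z hz =>
      ((h.fderiv_of_isOpen hO (m := 1) (by norm_cast; omega)).differentiableOn
        one_ne_zero z hz).differentiableAt (hO.mem_nhds hz)
    rw [iteratedDeriv_succ']
    have e1 : deriv (fun t => fderiv ℝ (fun v => H (t, v)) u) =ᶠ[𝓝 0]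
        fun t => fderiv ℝ (fun v => timeDeriv H (t, v)) u := by
      filter_upwards [eventually_mem_slice hO hu] with t ht
      have e2 : (fun t => fderiv ℝ (fun v => H (t, v)) u) =ᶠ[𝓝 t]
          fun t => (fderiv ℝ H (t, u)).comp (ContinuousLinearMap.inr ℝ ℝ E) := by
        filter_upwards [eventually_mem_slice hO ht] with s hs
        exact hslice _ hs
      rw [e2.deriv_eq]
      have h3 : HasFDerivAt (fun v : E => (t, v)) (ContinuousLinearMap.inr ℝ ℝ E) u :=
        hasFDerivAt_prodMk_right t u
      have h4 : HasFDerivAt (fun v => timeDeriv H (t, v))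
          (((fderiv ℝ (fderiv ℝ H) (t, u)).flip ((1 : ℝ), (0 : E))).comp
            (ContinuousLinearMap.inr ℝ ℝ E)) u := by
        have h5 : HasFDerivAt (timeDeriv H) ((fderiv ℝ (fderiv ℝ H) (t, u)).flip (1, 0)) (t, u) := by
          have := (hd2 _ ht).hasFDerivAt.clm_apply (hasFDerivAt_const ((1 : ℝ), (0 : E)) (t, u))
          exact this.congr_fderiv (by rw [ContinuousLinearMap.comp_zero, zero_add])
        exact HasFDerivAt.comp u (f := fun v : E => (t, v)) h5 h3
      have h6 : HasDerivAt (fun t => (fderiv ℝ H (t, u)).comp (ContinuousLinearMap.inr ℝ ℝ E))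
          ((fderiv ℝ (fderiv ℝ H) (t, u) (1, 0)).comp (ContinuousLinearMap.inr ℝ ℝ E)) t := by
        have := hasDerivAt_timeDeriv (z := (t, u)) (hd2 _ ht)
        have h7 := this.clm_comp (hasDerivAt_const t (ContinuousLinearMap.inr ℝ ℝ E))
        simpa [timeDeriv] using h7
      rw [h6.deriv, h4.fderiv]
      ext v
      simp only [ContinuousLinearMap.comp_apply, ContinuousLinearMap.flip_apply]
      have hsymm : IsSymmSndFDerivAt ℝ H (t, u) :=
        (h.contDiffAt (hO.mem_nhds ht)).isSymmSndFDerivAt (by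
          simp only [minSmoothness_of_isRCLikeNormedField]; norm_cast; omega)
      exact hsymm _ _
    rw [e1.iteratedDeriv_eq, h1]
    refine Filter.EventuallyEq.fderiv_eq ?_
    filter_upwards [(isOpen_zeroSlice hO).mem_nhds hu] with v hv
    exact (iteratedDeriv_succ_slice hO hdiff hv k).symm

end Expansions

end GaugePerturbation

namespace GaugePerturbation

open Asymptotics Filter Set Finset

/-! ### Expansions along flows and knights on a normed space -/

section FlowExpansion

variable {W : Type*} [NormedAddCommGroup W] [NormedSpace ℝ W]
variable {F : Type*} [NormedAddCommGroup F] [NormedSpace ℝ F]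

/-- The derivative of a function along a vector field. -/
noncomputable def along (X : W → W) (G : W → F) (w : W) : F := fderiv ℝ G w (X w)

/-- `θ` is a flow of `X` for small times, near the points of `U`. -/
structure IsLocalFlowOn (X : W → W) (θ : ℝ → W → W) (U : Set W) : Prop where
  tendsto : ∀ w ∈ U, Tendsto (fun z : ℝ × W => θ z.1 z.2) (𝓝 ((0 : ℝ), w)) (𝓝 w)
  map_zero : ∀ w ∈ U, θ 0 w = w
  hasDerivAt : ∀ w ∈ U, ∀ᶠ z in 𝓝 ((0 : ℝ), w),
    HasDerivAt (fun s => θ s z.2) (X (θ z.1 z.2)) z.1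

variable {X : W → W} {θ : ℝ → W → W} {U : Set W} {M i d : ℕ} {G : W → F}

theorem contDiffOn_along (hU : IsOpen U) (hX : ContDiffOn ℝ (M - i : ℕ) X U) (hi : 1 ≤ i)
    (hid : i ≤ d) (hd : d ≤ M) (hG : ContDiffOn ℝ d G U) :
    ContDiffOn ℝ (d - i : ℕ) (along X G) U :=
  (hG.fderiv_of_isOpen hU (by norm_cast; omega)).clm_apply
    (hX.of_le (by norm_cast; omega))

theorem contDiffOn_along_iterate (hU : IsOpen U) (hX : ContDiffOn ℝ (M - i : ℕ) X U) (hi : 1 ≤ i)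
    (hd : d ≤ M) (hG : ContDiffOn ℝ d G U) {j : ℕ} (hj : i * j ≤ d) :
    ContDiffOn ℝ (d - i * j : ℕ) ((along X)^[j] G) U := by
  induction j with
  | zero => simpa using hG
  | succ j ih =>
    rw [mul_add, mul_one] at hj
    rw [Function.iterate_succ_apply', mul_add, mul_one, ← Nat.sub_sub]
    exact contDiffOn_along hU hX hi (by omega) (by omega) (ih (by omega))

theorem IsLocalFlowOn.eventually_mem (hθ : IsLocalFlowOn X θ U) (hU : IsOpen U) {w : W}
    (hw : w ∈ U) : ∀ᶠ z in 𝓝 ((0 : ℝ), w), θ z.1 z.2 ∈ U :=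
  (hθ.tendsto w hw).eventually (hU.mem_nhds hw)

theorem IsLocalFlowOn.isBigO_sub (hθ : IsLocalFlowOn X θ U) (hU : IsOpen U)
    (hX : ContinuousOn X U) {w : W} (hw : w ∈ U) :
    (fun z : ℝ × W => θ z.1 z.2 - z.2) =O[𝓝 ((0 : ℝ), w)] fun z => z.1 := by
  have hc : Tendsto (fun z : ℝ × W => X (θ z.1 z.2)) (𝓝 (0, w)) (𝓝 (X w)) :=
    (hX.continuousAt (hU.mem_nhds hw)).tendsto.comp (hθ.tendsto w hw)
  have hb : ∀ᶠ z : ℝ × W in 𝓝 (0, w), ‖X (θ z.1 z.2)‖ ≤ (‖X w‖ + 1) * (fun _ : ℝ => 1) |z.1| := by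
    filter_upwards [hc.norm.eventually (gt_mem_nhds (lt_add_one ‖X w‖))] with z hz
    simpa using hz.le
  have h := eventually_norm_le_of_hasDerivAt (R := fun z : ℝ × W => θ z.1 z.2 - z.2)
    (by positivity) (monotoneOn_const) (by
      filter_upwards [hU.mem_nhds hw] with q hq
      simp [hθ.map_zero q hq]) (by
      filter_upwards [hθ.hasDerivAt w hw] with z hz using hz.sub_const _) hb
  refine IsBigO.of_bound (‖X w‖ + 1) ?_
  filter_upwards [h] with z hz
  simpa using hz

theorem IsLocalFlowOn.hasDerivAt_comp (hθ : IsLocalFlowOn X θ U) (hU : IsOpen U)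
    (hG : DifferentiableOn ℝ G U) {w : W} (hw : w ∈ U) :
    ∀ᶠ z in 𝓝 ((0 : ℝ), w),
      HasDerivAt (fun s => G (θ s z.2)) (along X G (θ z.1 z.2)) z.1 := by
  filter_upwards [hθ.hasDerivAt w hw, hθ.eventually_mem hU hw] with z hz hz'
  exact HasFDerivAt.comp_hasDerivAt z.1 (f := fun s => θ s z.2)
    ((hG _ hz').differentiableAt (hU.mem_nhds hz')).hasFDerivAt hz

/-- Taylor's formula along a flow; the exponent of the remainder takes into account that each
derivative along `X` costs `i` degrees of differentiability. -/
theorem IsLocalFlowOn.expansion (hθ : IsLocalFlowOn X θ U) (hU : IsOpen U)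
    (hX : ContDiffOn ℝ (M - i : ℕ) X U) (hi : 1 ≤ i) (hd : d ≤ M)
    (hG : ContDiffOn ℝ d G U) {w : W} (hw : w ∈ U) :
    (fun z : ℝ × W => G (θ z.1 z.2) - ∑ j ∈ range (d / i + 1),
      z.1 ^ j • ((1 / (Nat.factorial j : ℝ)) • (along X)^[j] G z.2))
      =o[𝓝 ((0 : ℝ), w)] fun z => |z.1| ^ ((d : ℝ) / i) := by
  induction d using Nat.strong_induction_on generalizing G with
  | _ d ih =>
  have hi' : (0 : ℝ) < i := by exact_mod_cast hi
  by_cases hdi : d < i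
  · simp only [Nat.div_eq_of_lt hdi, zero_add, Finset.range_one, Finset.sum_singleton, pow_zero,
      Nat.factorial_zero, Nat.cast_one, div_one, one_smul, Function.iterate_zero, id_eq]
    have hsnd : Tendsto (fun z : ℝ × W => z.2) (𝓝 (0, w)) (𝓝 w) := continuous_snd.tendsto' _ _ rfl
    rcases Nat.eq_zero_or_pos d with rfl | hd0
    · simp only [Nat.cast_zero, zero_div, Real.rpow_zero, isLittleO_one_iff]
      have hc := hG.continuousOn.continuousAt (hU.mem_nhds hw)
      simpa using (hc.tendsto.comp (hθ.tendsto w hw)).sub (hc.tendsto.comp hsnd)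
    · have hG1 : ContDiffAt ℝ 1 G w :=
        (hG.contDiffAt (hU.mem_nhds hw)).of_le (by exact_mod_cast hd0)
      obtain ⟨K, t, ht, hK⟩ := hG1.exists_lipschitzOnWith
      have h1 : (fun z : ℝ × W => G (θ z.1 z.2) - G z.2) =O[𝓝 ((0 : ℝ), w)]
          fun z => θ z.1 z.2 - z.2 := by
        refine IsBigO.of_bound K ?_
        filter_upwards [(hθ.tendsto w hw).eventually ht, hsnd.eventually ht] with z h2 h3
        exact hK.norm_sub_le h2 h3
      refine (h1.trans (hθ.isBigO_sub hU hX.continuousOn hw)).trans_isLittleO ?_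
      have h4 : (fun x : ℝ => x) =o[𝓝 0] fun x : ℝ => |x| ^ ((d : ℝ) / i) := by
        have e1 : (d : ℝ) / i < 1 := by rw [div_lt_one hi']; exact_mod_cast hdi
        have e0 : 0 ≤ (d : ℝ) / i := by positivity
        have h5 : (fun x : ℝ => |x| ^ (1 - (d : ℝ) / i) * |x| ^ ((d : ℝ) / i)) =o[𝓝 0]
            fun x : ℝ => 1 * |x| ^ ((d : ℝ) / i) := by
          refine IsLittleO.mul_isBigO ?_ (isBigO_refl _ _)
          rw [isLittleO_one_iff]
          have : ContinuousAt (fun x : ℝ => |x| ^ (1 - (d : ℝ) / i)) 0 :=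
            (continuous_abs.continuousAt).rpow_const (Or.inr (by linarith))
          simpa [ContinuousAt, Real.zero_rpow (by linarith : 1 - (d : ℝ) / i ≠ 0)] using this
        refine (IsBigO.of_bound 1 (Eventually.of_forall fun x => ?_)).trans_isLittleO
          (h5.congr_right fun x => one_mul _)
        rw [← Real.rpow_add_of_nonneg (abs_nonneg x) (by linarith) e0]
        simp
      exact h4.comp_tendsto (tendsto_fst_nhds_zero w)
  · push Not at hdi
    have hdiff : DifferentiableOn ℝ G U := hG.differentiableOn (by norm_cast; omega)
    have h1 := ih (d - i) (by omega) (by omega) (contDiffOn_along hU hX hi hdi hd hG)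
    have hdiv : d / i = (d - i) / i + 1 := Nat.div_eq_sub_div hi hdi
    have hexp : ((d - i : ℕ) : ℝ) / i = (d : ℝ) / i - 1 := by
      rw [Nat.cast_sub hdi, sub_div, div_self hi'.ne']
    have hexp0 : 0 ≤ ((d - i : ℕ) : ℝ) / i := by positivity
    have key := isLittleO_of_hasDerivAt (g := fun x => x ^ (((d - i : ℕ) : ℝ) / i)) (w₀ := w)
      (R := fun z : ℝ × W => G (θ z.1 z.2) - ∑ j ∈ range (d / i + 1),
        z.1 ^ j • ((1 / (Nat.factorial j : ℝ)) • (along X)^[j] G z.2))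
      (fun a ha b _ hab => Real.rpow_le_rpow ha hab hexp0)
      (fun x hx => Real.rpow_nonneg hx _)
      (by
        filter_upwards [hU.mem_nhds hw] with q hq
        rw [Finset.sum_range_succ']
        simp [hθ.map_zero q hq])
      (by
        filter_upwards [hθ.hasDerivAt_comp hU hdiff hw] with z hz
        refine hz.sub (HasDerivAt.congr_deriv (f' := ∑ j ∈ range ((d - i) / i + 1),
          z.1 ^ j • ((1 / (Nat.factorial j : ℝ)) • (along X)^[j] (along X G) z.2)) ?_ rfl)
        rw [hdiv]
        simp only [Finset.sum_range_succ' _ ((d - i) / i + 1), pow_zero, one_smul]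
        refine HasDerivAt.add_const _ (HasDerivAt.fun_sum fun k _ => ?_)
        have h3 : HasDerivAt (fun t : ℝ => t ^ (k + 1)) (((k + 1 : ℕ) : ℝ) * z.1 ^ k) z.1 := by
          simpa using hasDerivAt_pow (k + 1) z.1
        convert h3.smul_const ((1 / (Nat.factorial (k + 1) : ℝ)) • (along X)^[k + 1] G z.2) using 1
        rw [smul_smul, smul_smul, Function.iterate_succ_apply]
        congr 1
        rw [Nat.factorial_succ]
        have : (Nat.factorial k : ℝ) ≠ 0 := by positivity
        push_cast
        field_simp) h1
    refine key.congr_right fun z => ?_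
    have : (d : ℝ) / i = 1 + ((d - i : ℕ) : ℝ) / i := by rw [hexp]; ring
    rw [this, Real.rpow_add_of_nonneg (abs_nonneg _) zero_le_one hexp0, Real.rpow_one]

theorem sum_knight_rearrange {i : ℕ} (hi : 1 ≤ i) (d : ℕ) (t : ℝ) (C : ℕ → ℕ → F) :
    ∑ j ∈ range (d / i + 1), (t ^ i / (Nat.factorial i : ℝ)) ^ j • ((1 / (Nat.factorial j : ℝ)) •
      ∑ k ∈ range (d - i * j + 1), t ^ k • C j k) =
    ∑ k ∈ range (d + 1), t ^ k • ∑ j ∈ (range (k + 1)).filter (fun j => i * j ≤ k),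
      (1 / ((Nat.factorial i : ℝ) ^ j * (Nat.factorial j : ℝ))) • C j (k - i * j) := by
  simp_rw [Finset.smul_sum]
  rw [Finset.sum_sigma', Finset.sum_sigma']
  refine Finset.sum_bij' (fun x _ => ⟨x.2 + i * x.1, x.1⟩) (fun x _ => ⟨x.2, x.1 - i * x.2⟩)
    ?_ ?_ ?_ ?_ ?_
  · rintro ⟨j, k⟩ h
    simp only [Finset.mem_sigma, Finset.mem_range, Finset.mem_filter, Nat.lt_succ_iff] at h ⊢
    have h1 : i * j ≤ d := (Nat.le_div_iff_mul_le hi).1 h.1 |>.trans_eq' (mul_comm _ _)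
    have h2 : j ≤ i * j := Nat.le_mul_of_pos_left _ hi
    omega
  · rintro ⟨k, j⟩ h
    simp only [Finset.mem_sigma, Finset.mem_range, Finset.mem_filter, Nat.lt_succ_iff] at h ⊢
    refine ⟨(Nat.le_div_iff_mul_le hi).2 ?_, by omega⟩
    rw [mul_comm]; omega
  · rintro ⟨j, k⟩ _
    simp
  · rintro ⟨k, j⟩ h
    simp only [Finset.mem_sigma, Finset.mem_range, Finset.mem_filter, Nat.lt_succ_iff] at h
    simp [Nat.sub_add_cancel h.2.2]
  · rintro ⟨j, k⟩ _
    simp only [smul_smul, Nat.add_sub_cancel]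
    congr 1
    rw [div_pow, pow_add, pow_mul]
    field_simp

variable {X : ℕ → W → W} {θ : ℕ → ℝ → W → W} {m : ℕ}

theorem tendsto_knight (hθ : ∀ i, 1 ≤ i → i ≤ m → IsLocalFlowOn (X i) (θ i) U) {w : W}
    (hw : w ∈ U) :
    Tendsto (fun z : ℝ × W => knight θ m z.1 z.2) (𝓝 ((0 : ℝ), w)) (𝓝 w) := by
  induction m with
  | zero => exact continuous_snd.tendsto' _ _ rfl
  | succ m ih =>
    have h1 := ih fun i h1 h2 => hθ i h1 (by omega)
    have h2 : Tendsto (fun z : ℝ × W => z.1 ^ (m + 1) / (Nat.factorial (m + 1) : ℝ))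
        (𝓝 ((0 : ℝ), w)) (𝓝 0) := by
      have := ((tendsto_fst_nhds_zero w).pow (m + 1)).div_const (Nat.factorial (m + 1) : ℝ)
      simpa using this
    exact ((hθ (m + 1) (by omega) le_rfl).tendsto w hw).comp (h2.prodMk_nhds h1)

theorem contDiffOn_knightCoeff (hU : IsOpen U)
    (hX : ∀ i, 1 ≤ i → i ≤ m → ContDiffOn ℝ (M - i : ℕ) (X i) U) (hd : d ≤ M)
    (hG : ContDiffOn ℝ d G U) {k : ℕ} (hk : k ≤ d) :
    ContDiffOn ℝ (d - k : ℕ) (knightCoeff (fun i => along (X i)) m k G) U := by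
  refine (knightCoeff_rel (L := fun i => along (X i)) (L' := fun i => along (F := F) (X i))
    (R := fun d G _ => d ≤ M ∧ ContDiffOn ℝ d G U) (a' := G) ?_ ?_ ?_ ?_ ?_ hk ⟨hd, hG⟩).2
  · exact fun d a a' h => ⟨h.1, contDiffOn_const⟩
  · exact fun d a a' b b' h h' => ⟨h.1, h.2.add h'.2⟩
  · exact fun d c a a' h => ⟨h.1, h.2.const_smul c⟩
  · exact fun d e a a' hed h => ⟨hed.trans h.1, h.2.of_le (by exact_mod_cast hed)⟩
  · exact fun i d a a' h1 h2 h3 h => ⟨by omega, contDiffOn_along hU (hX i h1 h2) h1 h3 h.1 h.2⟩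

/-- The expansion of a function along a knight. -/
theorem knight_expansion (hU : IsOpen U)
    (hX : ∀ i, 1 ≤ i → i ≤ m → ContDiffOn ℝ (M - i : ℕ) (X i) U)
    (hθ : ∀ i, 1 ≤ i → i ≤ m → IsLocalFlowOn (X i) (θ i) U) (hd : d ≤ M)
    (hG : ContDiffOn ℝ d G U) {w : W} (hw : w ∈ U) :
    (fun z : ℝ × W => G (knight θ m z.1 z.2) - ∑ k ∈ range (d + 1),
      z.1 ^ k • knightCoeff (fun i => along (X i)) m k G z.2)
      =o[𝓝 ((0 : ℝ), w)] fun z => z.1 ^ d := by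
  induction m generalizing d G with
  | zero =>
    refine (isLittleO_zero _ _).congr_left fun z => ?_
    rw [Finset.sum_range_succ']
    simp [knight, knightCoeff]
  | succ m ih =>
    have hθm : ∀ i, 1 ≤ i → i ≤ m → IsLocalFlowOn (X i) (θ i) U :=
      fun i h1 h2 => hθ i h1 (by omega)
    have hX1 := hX (m + 1) (by omega) le_rfl
    have hs : Tendsto (fun z : ℝ × W => z.1 ^ (m + 1) / (Nat.factorial (m + 1) : ℝ))
        (𝓝 ((0 : ℝ), w)) (𝓝 0) := by
      have := ((tendsto_fst_nhds_zero w).pow (m + 1)).div_const (Nat.factorial (m + 1) : ℝ)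
      simpa using this
    have hA := ((hθ (m + 1) (by omega) le_rfl).expansion hU hX1 (by omega) hd hG hw).comp_tendsto
      (hs.prodMk_nhds (tendsto_knight hθm hw))
    have hpow : (fun z : ℝ × W => |z.1 ^ (m + 1) / (Nat.factorial (m + 1) : ℝ)| ^
        ((d : ℝ) / (m + 1 : ℕ))) =O[𝓝 ((0 : ℝ), w)] fun z => z.1 ^ d := by
      refine IsBigO.of_bound ((1 / (Nat.factorial (m + 1) : ℝ)) ^ ((d : ℝ) / (m + 1 : ℕ)))
        (Eventually.of_forall fun z => ?_)
      rw [abs_div, abs_pow, Nat.abs_cast, div_eq_mul_one_div,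
        Real.mul_rpow (by positivity) (by positivity), ← Real.rpow_natCast,
        ← Real.rpow_mul (abs_nonneg _), mul_div_cancel₀ _ (by positivity), Real.rpow_natCast,
        Real.norm_of_nonneg (by positivity), norm_pow, Real.norm_eq_abs, mul_comm]
    have hA' := hA.trans_isBigO hpow
    have hB : (fun z : ℝ × W => ∑ j ∈ range (d / (m + 1) + 1),
        (z.1 ^ (m + 1) / (Nat.factorial (m + 1) : ℝ)) ^ j • ((1 / (Nat.factorial j : ℝ)) •
        ((along (X (m + 1)))^[j] G (knight θ m z.1 z.2) - ∑ k ∈ range (d - (m + 1) * j + 1),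
          z.1 ^ k • knightCoeff (fun i => along (X i)) m k ((along (X (m + 1)))^[j] G) z.2)))
        =o[𝓝 ((0 : ℝ), w)] fun z => z.1 ^ d := by
      refine IsLittleO.fun_sum fun j hj => ?_
      have hj' : (m + 1) * j ≤ d := by
        rw [mul_comm]
        exact (Nat.le_div_iff_mul_le (by omega)).1 (Nat.lt_succ_iff.1 (Finset.mem_range.1 hj))
      have h1 := ih (fun i h1 h2 => hX i h1 (by omega)) hθm (d := d - (m + 1) * j) (by omega)
        (contDiffOn_along_iterate hU hX1 (by omega) hd hG hj')
      have h2 : (fun z : ℝ × W => (z.1 ^ (m + 1) / (Nat.factorial (m + 1) : ℝ)) ^ j)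
          =O[𝓝 ((0 : ℝ), w)] fun z => z.1 ^ ((m + 1) * j) := by
        refine IsBigO.of_bound ((1 / (Nat.factorial (m + 1) : ℝ)) ^ j)
          (Eventually.of_forall fun z => le_of_eq ?_)
        rw [div_eq_mul_one_div, mul_pow, ← pow_mul, norm_mul, mul_comm,
          Real.norm_of_nonneg (by positivity : 0 ≤ (1 / (Nat.factorial (m + 1) : ℝ)) ^ j)]
      refine (h2.smul_isLittleO (h1.const_smul_left (1 / (Nat.factorial j : ℝ)))).congr_right
        fun z => ?_
      rw [smul_eq_mul, ← pow_add, Nat.add_sub_cancel' hj']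
    refine (hA'.add hB).congr_left fun z => ?_
    simp only [Function.comp_apply, smul_sub, Finset.sum_sub_distrib]
    rw [sub_add_sub_cancel, sum_knight_rearrange (by omega)]
    simp only [knight, knightCoeff, Finset.sum_apply, Pi.smul_apply]

end FlowExpansion

end GaugePerturbation

namespace GaugePerturbation

open Asymptotics Filter Set

set_option maxSynthPendingDepth 3

/-! ### Pull-back of tensors as a smooth function -/

section TensorCalculus

variable {r s : ℕ}
variable {V : Type*} [NormedAddCommGroup V] [NormedSpace ℝ V]
variable {W : Type*} [NormedAddCommGroup W] [NormedSpace ℝ W]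
variable {Z : Type*} [NormedAddCommGroup Z] [NormedSpace ℝ Z]

/-- Pull-back of tensors along a fixed map, as a continuous linear map. -/
noncomputable def Tensor.pullbackL (A : V →L[ℝ] W) : Tensor r s W →L[ℝ] Tensor r s V :=
  (ContinuousLinearMap.compContinuousMultilinearMapL ℝ _ _ _
    (ContinuousMultilinearMap.compContinuousLinearMapL fun _ : Fin s => A)).comp
    (ContinuousMultilinearMap.compContinuousLinearMapL fun _ : Fin r => dualMap A.inverse)

theorem Tensor.pullbackL_apply (A : V →L[ℝ] W) (T : Tensor r s W) :
    Tensor.pullbackL A T = T.pullback A := rfl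

theorem Tensor.pullback_id (T : Tensor r s V) :
    T.pullback (ContinuousLinearMap.id ℝ V) = T := by
  ext α v
  simp [Tensor.pullback_apply]

theorem Tensor.pullback_comp {A : V →L[ℝ] W} {B : W →L[ℝ] Z} (hA : A.IsInvertible)
    (T : Tensor r s Z) : T.pullback (B.comp A) = (T.pullback B).pullback A := by
  ext α v
  simp [Tensor.pullback_apply, hA.inverse_comp_of_right, ContinuousLinearMap.comp_assoc]

theorem Tensor.contDiffAt_pullbackL [CompleteSpace V] {n : WithTop ℕ∞} {A : V →L[ℝ] W}
    (hA : A.IsInvertible) :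
    ContDiffAt ℝ n (fun A : V →L[ℝ] W => Tensor.pullbackL (r := r) (s := s) A) A := by
  have h1 : ContDiff ℝ n fun A : V →L[ℝ] W =>
      ContinuousMultilinearMap.compContinuousLinearMapContinuousMultilinear ℝ
        (fun _ : Fin s => V) (fun _ => W) ℝ (fun _ => A) :=
    (ContinuousMultilinearMap.contDiff _).comp (contDiff_pi.2 fun _ => contDiff_id)
  have h2 : ContDiffAt ℝ n (fun A : V →L[ℝ] W =>
      ContinuousMultilinearMap.compContinuousLinearMapContinuousMultilinear ℝ
        (fun _ : Fin r => StrongDual ℝ V) (fun _ => StrongDual ℝ W)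
        (ContinuousMultilinearMap ℝ (fun _ : Fin s => W) ℝ) (fun _ => dualMap A.inverse)) A := by
    refine (ContinuousMultilinearMap.contDiff _).contDiffAt.comp A (contDiffAt_pi.2 fun _ => ?_)
    exact (ContinuousLinearMap.contDiff (ContinuousLinearMap.compL ℝ W V ℝ).flip).contDiffAt.comp A
      hA.contDiffAt_map_inverse
  exact ((ContinuousLinearMap.contDiff (ContinuousLinearMap.compContinuousMultilinearMapL ℝ
    (fun _ : Fin r => StrongDual ℝ V) (ContinuousMultilinearMap ℝ (fun _ : Fin s => W) ℝ)
    (ContinuousMultilinearMap ℝ (fun _ : Fin s => V) ℝ))).comp h1).contDiffAt.clm_comp h2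

theorem isInvertible_id : (ContinuousLinearMap.id ℝ V).IsInvertible :=
  ⟨ContinuousLinearEquiv.refl ℝ V, rfl⟩

theorem isOpen_setOf_isInvertible [CompleteSpace V] :
    IsOpen {A : V →L[ℝ] W | A.IsInvertible} :=
  ContinuousLinearEquiv.isOpen

theorem hasDerivAt_inverse_id_add_smul [CompleteSpace V] (B : V →L[ℝ] V) :
    HasDerivAt (fun t : ℝ => (ContinuousLinearMap.id ℝ V + t • B).inverse) (-B) 0 := by
  have h1 : HasDerivAt (fun t : ℝ => ContinuousLinearMap.id ℝ V + t • B) B 0 := by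
    simpa using ((hasDerivAt_id (0 : ℝ)).smul_const B).const_add (ContinuousLinearMap.id ℝ V)
  have h2 := hasFDerivAt_ringInverse (𝕜 := ℝ) (1 : (V →L[ℝ] V)ˣ)
  rw [ContinuousLinearMap.ringInverse_eq_inverse] at h2
  have h3 := HasFDerivAt.comp_hasDerivAt_of_eq (0 : ℝ) h2 h1 (by simp; rfl)
  refine h3.congr_deriv ?_
  simp

/-- The derivative of the pull-back along `1 + t B`. -/
theorem Tensor.hasDerivAt_pullback_id_add_smul [CompleteSpace V] (B : V →L[ℝ] V)
    (T : Tensor r s V) :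
    HasDerivAt (fun t : ℝ => T.pullback (ContinuousLinearMap.id ℝ V + t • B)) (T.derivation B)
      0 := by
  have h1 : HasDerivAt (fun t : ℝ => ContinuousLinearMap.id ℝ V + t • B) B 0 := by
    simpa using ((hasDerivAt_id (0 : ℝ)).smul_const B).const_add (ContinuousLinearMap.id ℝ V)
  have hd : DifferentiableAt ℝ
      (fun t : ℝ => T.pullback (ContinuousLinearMap.id ℝ V + t • B)) 0 := by
    have h2 : DifferentiableAt ℝ (fun A : V →L[ℝ] V => Tensor.pullbackL (r := r) (s := s) A)
        (ContinuousLinearMap.id ℝ V + (0 : ℝ) • B) :=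
      (Tensor.contDiffAt_pullbackL (n := 1) (by simpa using isInvertible_id)).differentiableAt
        one_ne_zero
    exact (DifferentiableAt.comp (0 : ℝ) (f := fun t : ℝ => ContinuousLinearMap.id ℝ V + t • B)
      h2 h1.differentiableAt).clm_apply (differentiableAt_const T)
  refine hd.hasDerivAt.congr_deriv ?_
  ext α v
  have h3 := ((ContinuousMultilinearMap.apply ℝ (fun _ : Fin s => V) ℝ v).comp
    (ContinuousMultilinearMap.apply ℝ (fun _ : Fin r => StrongDual ℝ V)
      (ContinuousMultilinearMap ℝ (fun _ : Fin s => V) ℝ) α)).hasFDerivAt.comp_hasDerivAt (0 : ℝ)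
      hd.hasDerivAt
  have ha : ∀ i, HasFDerivAt (fun t : ℝ => (α i).comp
      (ContinuousLinearMap.id ℝ V + t • B).inverse)
      (ContinuousLinearMap.toSpanSingleton ℝ (-((α i).comp B))) 0 := by
    intro i
    have := (hasDerivAt_const (0 : ℝ) (α i)).clm_comp (hasDerivAt_inverse_id_add_smul B)
    refine this.hasFDerivAt.congr_fderiv ?_
    ext
    simp
  have hb : ∀ j, HasFDerivAt (fun t : ℝ => (ContinuousLinearMap.id ℝ V + t • B) (v j))
      (ContinuousLinearMap.toSpanSingleton ℝ (B (v j))) 0 := by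
    intro j
    have := h1.clm_apply (hasDerivAt_const (0 : ℝ) (v j))
    refine this.hasFDerivAt.congr_fderiv ?_
    ext
    simp
  have h4 := ((hasFDerivAt_const T (0 : ℝ)).continuousMultilinearMap_apply
    ha).continuousMultilinearMap_apply hb
  have h5 := h3.unique h4.hasDerivAt
  refine Eq.trans h5 ?_
  rw [Tensor.derivation_apply]
  simp [ContinuousMultilinearMap.toContinuousLinearMap, sum_apply, neg_add_eq_sub]

/-- The derivative of `(A, T) ↦ A^* T`, in the direction `(A ∘ B)`-variation given on the left:
`A` moves as `(1 + t B) A`. -/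
theorem Tensor.fderiv_pullbackL_comp [CompleteSpace V] {A : V →L[ℝ] V} (hA : A.IsInvertible)
    (B : V →L[ℝ] V) (T : Tensor r s V) :
    fderiv ℝ (fun A : V →L[ℝ] V => Tensor.pullbackL (r := r) (s := s) A) A (B.comp A) T =
      (T.derivation B).pullback A := by
  have h1 : HasDerivAt (fun t : ℝ => (ContinuousLinearMap.id ℝ V + t • B).comp A) (B.comp A) 0 := by
    have h0 : HasDerivAt (fun t : ℝ => ContinuousLinearMap.id ℝ V + t • B) B 0 := by
      simpa using ((hasDerivAt_id (0 : ℝ)).smul_const B).const_add (ContinuousLinearMap.id ℝ V)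
    simpa using h0.clm_comp (hasDerivAt_const (0 : ℝ) A)
  have h2 : HasDerivAt (fun t : ℝ =>
      Tensor.pullbackL (r := r) (s := s) ((ContinuousLinearMap.id ℝ V + t • B).comp A) T)
      (fderiv ℝ (fun A : V →L[ℝ] V => Tensor.pullbackL (r := r) (s := s) A) A (B.comp A) T) 0 := by
    have h3 : DifferentiableAt ℝ (fun A : V →L[ℝ] V => Tensor.pullbackL (r := r) (s := s) A) A :=
      (Tensor.contDiffAt_pullbackL (n := 1) hA).differentiableAt one_ne_zero
    have h4 := HasFDerivAt.comp_hasDerivAt_of_eq (0 : ℝ) h3.hasFDerivAt h1 (by simp)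
    simpa using h4.clm_apply (hasDerivAt_const (0 : ℝ) T)
  have h5 : HasDerivAt (fun t : ℝ =>
      Tensor.pullbackL (r := r) (s := s) ((ContinuousLinearMap.id ℝ V + t • B).comp A) T)
      (Tensor.pullbackL A (T.derivation B)) 0 := by
    have h6 := (Tensor.pullbackL (r := r) (s := s) A).hasFDerivAt.comp_hasDerivAt (0 : ℝ)
      (Tensor.hasDerivAt_pullback_id_add_smul B T)
    refine h6.congr_of_eventuallyEq (Eventually.of_forall fun t => ?_)
    exact Tensor.pullback_comp hA T
  exact h2.unique h5

end TensorCalculus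

/-! ### Lifts to the frame bundle -/

section Frame

variable {r s : ℕ}
variable {E : Type*} [NormedAddCommGroup E] [NormedSpace ℝ E]
variable {F : Type*} [NormedAddCommGroup F] [NormedSpace ℝ F]

/-- The complete lift of a vector field to the frame bundle. -/
noncomputable def frameField (X : E → E) (w : E × (E →L[ℝ] E)) : E × (E →L[ℝ] E) :=
  (X w.1, (fderiv ℝ X w.1).comp w.2)

/-- A tensor field as a function on the frame bundle. -/
noncomputable def frameTensor (S : E → Tensor r s E) (w : E × (E →L[ℝ] E)) : Tensor r s E :=
  (S w.1).pullback w.2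

/-- The differential of a function, as a function on the frame bundle. -/
noncomputable def frameDifferential (g : E → F) (w : E × (E →L[ℝ] E)) : E →L[ℝ] F :=
  (fderiv ℝ g w.1).comp w.2

/-- The frames at the points of `U`. -/
def frameSet (U : Set E) : Set (E × (E →L[ℝ] E)) := U ×ˢ {A | A.IsInvertible}

theorem isOpen_frameSet [CompleteSpace E] {U : Set E} (hU : IsOpen U) : IsOpen (frameSet U) :=
  hU.prod isOpen_setOf_isInvertible

theorem contDiffOn_frameField {k : ℕ} {X : E → E} {U : Set E} (hU : IsOpen U)
    (hX : ContDiffOn ℝ (k + 1 : ℕ) X U) : ContDiffOn ℝ k (frameField X) (U ×ˢ univ) := by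
  have hfst : ContDiffOn ℝ k (fun w : E × (E →L[ℝ] E) => w.1) (U ×ˢ univ) := contDiffOn_fst
  have hmaps : MapsTo (fun w : E × (E →L[ℝ] E) => w.1) (U ×ˢ univ) U := fun w hw => hw.1
  exact ((hX.of_le (by norm_cast; omega)).comp hfst hmaps).prodMk
    (((hX.fderiv_of_isOpen hU (by norm_cast)).comp hfst hmaps).clm_comp contDiffOn_snd)

theorem contDiffOn_frameTensor [CompleteSpace E] {k : ℕ} {S : E → Tensor r s E} {U : Set E}
    (hS : ContDiffOn ℝ k S U) : ContDiffOn ℝ k (frameTensor S) (frameSet U) := by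
  have hfst : ContDiffOn ℝ k (fun w : E × (E →L[ℝ] E) => w.1) (frameSet U) := contDiffOn_fst
  have h1 := hS.comp hfst fun w hw => hw.1
  have h2 : ContDiffOn ℝ k (fun w : E × (E →L[ℝ] E) => Tensor.pullbackL (r := r) (s := s) w.2)
      (frameSet U) := fun w hw =>
    ((Tensor.contDiffAt_pullbackL hw.2).comp w contDiffAt_snd).contDiffWithinAt
  exact h2.clm_apply h1

theorem fderiv_frameTensor [CompleteSpace E] {S : E → Tensor r s E}
    {w : E × (E →L[ℝ] E)} (hS : DifferentiableAt ℝ S w.1) (hw : w.2.IsInvertible) :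
    DifferentiableAt ℝ (frameTensor S) w ∧ ∀ (a : E) (B : E →L[ℝ] E),
      fderiv ℝ (frameTensor S) w (a, B.comp w.2) =
        (fderiv ℝ S w.1 a + (S w.1).derivation B).pullback w.2 := by
  have h2 : DifferentiableAt ℝ (fun A : E →L[ℝ] E => Tensor.pullbackL (r := r) (s := s) A) w.2 :=
    (Tensor.contDiffAt_pullbackL (n := 1) hw).differentiableAt one_ne_zero
  have h3 := HasFDerivAt.clm_apply (HasFDerivAt.comp w h2.hasFDerivAt hasFDerivAt_snd)
    (HasFDerivAt.comp w hS.hasFDerivAt hasFDerivAt_fst)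
  refine ⟨h3.differentiableAt, fun a B => ?_⟩
  rw [show fderiv ℝ (frameTensor S) w = _ from h3.fderiv]
  simp only [← Tensor.pullbackL_apply, map_add]
  have := Tensor.fderiv_pullbackL_comp hw B (S w.1)
  simp only [← Tensor.pullbackL_apply] at this
  simp [← this]

/-- The Lie derivative of a tensor field is its derivative along the lifted vector field. -/
theorem along_frameField_frameTensor [CompleteSpace E] {S : E → Tensor r s E} {X : E → E}
    {w : E × (E →L[ℝ] E)} (hS : DifferentiableAt ℝ S w.1) (hw : w.2.IsInvertible) :
    along (frameField X) (frameTensor S) w = frameTensor (lieDerivativeSpace X S) w :=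
  (fderiv_frameTensor hS hw).2 _ _

theorem fderiv_along {g : E → F} {X : E → E} {u : E} (hg : ContDiffAt ℝ 2 g u)
    (hX : DifferentiableAt ℝ X u) (v : E) :
    fderiv ℝ (along X g) u v =
      fderiv ℝ (fderiv ℝ g) u v (X u) + fderiv ℝ g u (fderiv ℝ X u v) := by
  have h1 : DifferentiableAt ℝ (fderiv ℝ g) u :=
    (hg.fderiv_right (m := 1) (by norm_num)).differentiableAt one_ne_zero
  have h2 := h1.hasFDerivAt.clm_apply hX.hasFDerivAt
  rw [show fderiv ℝ (along X g) u = _ from h2.fderiv]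
  simp [add_comm]

theorem along_frameField_frameDifferential {g : E → F} {X : E → E} {w : E × (E →L[ℝ] E)}
    (hg : ContDiffAt ℝ 2 g w.1) (hX : DifferentiableAt ℝ X w.1) :
    along (frameField X) (frameDifferential g) w = frameDifferential (along X g) w := by
  have h1 : DifferentiableAt ℝ (fderiv ℝ g) w.1 :=
    (hg.fderiv_right (m := 1) (by norm_num)).differentiableAt one_ne_zero
  have h2 := (HasFDerivAt.comp w h1.hasFDerivAt hasFDerivAt_fst).clm_comp
    (hasFDerivAt_snd (𝕜 := ℝ) (p := w))
  have hsymm : IsSymmSndFDerivAt ℝ g w.1 :=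
    hg.isSymmSndFDerivAt (by simp [minSmoothness_of_isRCLikeNormedField])
  rw [along, show fderiv ℝ (frameDifferential g) w = _ from h2.fderiv]
  ext v
  simp only [frameDifferential, ContinuousLinearMap.comp_apply, fderiv_along hg hX]
  rw [hsymm (w.2 v) (X w.1)]
  simp [frameField, add_comm]

/-- The Lie derivative is natural under local diffeomorphisms. -/
theorem lieDerivativeSpace_pullback [CompleteSpace E] {g : E → E} {X Y : E → E}
    {S : E → Tensor r s E} {u : E} (hg : ContDiffAt ℝ 2 g u) (hinv : (fderiv ℝ g u).IsInvertible)
    (hXY : ∀ᶠ v in 𝓝 u, fderiv ℝ g v (Y v) = X (g v)) (hX : DifferentiableAt ℝ X (g u))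
    (hY : DifferentiableAt ℝ Y u) (hS : DifferentiableAt ℝ S (g u))
    {S' : E → Tensor r s E} (hS' : ∀ᶠ v in 𝓝 u, S' v = (S (g v)).pullback (fderiv ℝ g v)) :
    lieDerivativeSpace Y S' u = (lieDerivativeSpace X S (g u)).pullback (fderiv ℝ g u) := by
  have hg1 : DifferentiableAt ℝ g u := hg.differentiableAt two_ne_zero
  have hDg : DifferentiableAt ℝ (fderiv ℝ g) u :=
    (hg.fderiv_right (m := 1) (by norm_num)).differentiableAt one_ne_zero
  have hsymm : IsSymmSndFDerivAt ℝ g u :=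
    hg.isSymmSndFDerivAt (by simp [minSmoothness_of_isRCLikeNormedField])
  have hS'd : DifferentiableAt ℝ S' u := by
    have h0 : DifferentiableAt ℝ (fun A : E →L[ℝ] E => Tensor.pullbackL (r := r) (s := s) A)
      (fderiv ℝ g u) := (Tensor.contDiffAt_pullbackL (n := 1) hinv).differentiableAt one_ne_zero
    exact ((h0.comp u hDg).clm_apply (hS.comp u hg1)).congr_of_eventuallyEq hS'
  set w : E × (E →L[ℝ] E) := (u, ContinuousLinearMap.id ℝ E) with hw
  have hlift : HasFDerivAt (fun z : E × (E →L[ℝ] E) => (g z.1, (fderiv ℝ g z.1).comp z.2)) _ w :=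
    (HasFDerivAt.comp w hg1.hasFDerivAt hasFDerivAt_fst).prodMk
      ((HasFDerivAt.comp w hDg.hasFDerivAt hasFDerivAt_fst).clm_comp
        (hasFDerivAt_snd (𝕜 := ℝ) (p := w)))
  have hw' : (g w.1, (fderiv ℝ g w.1).comp w.2) = (g u, fderiv ℝ g u) := by simp [hw]
  have heq : frameTensor S' =ᶠ[𝓝 w]
      fun z => frameTensor S (g z.1, (fderiv ℝ g z.1).comp z.2) := by
    filter_upwards [(continuous_fst.tendsto w).eventually hS',
      (continuous_snd.tendsto w).eventually (isOpen_setOf_isInvertible.mem_nhds isInvertible_id)]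
      with z h1 h2
    rw [frameTensor, h1, ← Tensor.pullback_comp h2]
    rfl
  have hT := fderiv_frameTensor (S := S) (w := (g u, fderiv ℝ g u)) hS hinv
  have hcomp := HasFDerivAt.comp w (g := frameTensor S) (by rw [hw']; exact hT.1.hasFDerivAt) hlift
  have e1 : lieDerivativeSpace Y S' u = along (frameField Y) (frameTensor S') w := by
    rw [along_frameField_frameTensor (by exact hS'd) isInvertible_id, frameTensor,
      Tensor.pullback_id]
  have hX' : fderiv ℝ (fun v => fderiv ℝ g v (Y v)) u = (fderiv ℝ X (g u)).comp (fderiv ℝ g u) := by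
    rw [Filter.EventuallyEq.fderiv_eq hXY]
    exact (hX.hasFDerivAt.comp u hg1.hasFDerivAt).fderiv
  have hX'' : ∀ v, fderiv ℝ X (g u) (fderiv ℝ g u v) =
      fderiv ℝ g u (fderiv ℝ Y u v) + fderiv ℝ (fderiv ℝ g) u v (Y u) := by
    intro v
    have := DFunLike.congr_fun hX' v
    rw [(hDg.hasFDerivAt.clm_apply hY.hasFDerivAt).fderiv] at this
    simpa using this.symm
  rw [e1, along, heq.fderiv_eq]
  have e2 := hcomp.fderiv
  rw [Function.comp_def] at e2
  rw [e2]
  have e3 := hT.2 (X (g u)) (fderiv ℝ X (g u))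
  dsimp only at e3
  rw [lieDerivativeSpace, ← e3, ContinuousLinearMap.comp_apply]
  congr 1
  refine Prod.ext ?_ ?_
  · simp [frameField, hw, hXY.self_of_nhds]
  · ext v
    simp only [ContinuousLinearMap.comp_apply, hX'']
    simp [frameField, hw, hsymm (Y u) v]

end Frame

/-! ### Lifting flows to the frame bundle -/

section LiftFlow

variable {E : Type*} [NormedAddCommGroup E] [NormedSpace ℝ E]

/-- Linear differential equations for small times. -/
theorem exists_linear_ode_solution [CompleteSpace E] {C : ℝ → E →L[ℝ] E} {ε K : ℝ} (hε : 0 < ε)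
    (hK : 0 ≤ K) (hεK : 2 * K * ε ≤ 1) (hC : ContinuousOn C (Icc (-ε) ε))
    (hCK : ∀ s ∈ Icc (-ε) ε, ‖C s‖ ≤ K) :
    ∃ B : ℝ → E →L[ℝ] E, B 0 = ContinuousLinearMap.id ℝ E ∧
      (∀ s ∈ Ioo (-ε) ε, HasDerivAt B ((C s).comp (B s)) s) ∧ ∀ s, ‖B s‖ ≤ 2 := by
  lift K to NNReal using hK
  set t₀ : Icc (-ε) ε := ⟨0, by simp [hε.le]⟩ with ht₀
  have hnorm : ∀ B ∈ Metric.closedBall (ContinuousLinearMap.id ℝ E) ((1 : NNReal) : ℝ),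
      ‖B‖ ≤ 2 := by
    intro B hB
    rw [mem_closedBall_iff_norm] at hB
    calc ‖B‖ = ‖(B - ContinuousLinearMap.id ℝ E) + ContinuousLinearMap.id ℝ E‖ := by simp
      _ ≤ ‖B - ContinuousLinearMap.id ℝ E‖ + ‖ContinuousLinearMap.id ℝ E‖ := norm_add_le _ _
      _ ≤ 1 + 1 := add_le_add (by simpa using hB) ContinuousLinearMap.norm_id_le
      _ = 2 := by norm_num
  have hpl : IsPicardLindelof (fun s (B : E →L[ℝ] E) => (C s).comp B) t₀
      (ContinuousLinearMap.id ℝ E) 1 0 (2 * K) K := by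
    refine ⟨fun s hs => ?_, fun B _ => ?_, fun s hs B hB => ?_, ?_⟩
    · refine LipschitzOnWith.of_dist_le_mul fun A _ B _ => ?_
      rw [dist_eq_norm, dist_eq_norm, ← ContinuousLinearMap.comp_sub]
      exact (ContinuousLinearMap.opNorm_comp_le _ _).trans
        (mul_le_mul_of_nonneg_right (hCK s hs) (norm_nonneg _))
    · exact hC.clm_comp continuousOn_const
    · refine (ContinuousLinearMap.opNorm_comp_le _ _).trans ?_
      calc ‖C s‖ * ‖B‖ ≤ K * 2 := mul_le_mul (hCK s hs) (hnorm B hB) (norm_nonneg _) K.2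
        _ = ((2 * K : NNReal) : ℝ) := by push_cast; ring
    · simpa [ht₀] using hεK
  have hx : ContinuousLinearMap.id ℝ E ∈
      Metric.closedBall (ContinuousLinearMap.id ℝ E) ((0 : NNReal) : ℝ) := by simp
  obtain ⟨α, hα⟩ := ODE.FunSpace.exists_isFixedPt_next hpl hx
  refine ⟨α.compProj, ?_, fun s hs => ?_, fun s => hnorm _ ?_⟩
  · have : α.compProj (t₀ : ℝ) = ContinuousLinearMap.id ℝ E := by
      rw [ODE.FunSpace.compProj_val, ← hα, ODE.FunSpace.next_apply₀]
    exact this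
  · have hs' : s ∈ Icc (-ε) ε := Ioo_subset_Icc_self hs
    have h1 := (ODE.hasDerivWithinAt_picard_Icc t₀.2 hpl.continuousOn_uncurry
      α.continuous_compProj.continuousOn (fun _ _ => α.compProj_mem_closedBall hpl.mul_max_le)
      (ContinuousLinearMap.id ℝ E) hs').congr_of_mem (f₁ := α.compProj) (fun t ht => by
        nth_rw 1 [← hα]
        rw [ODE.FunSpace.compProj_of_mem ht, ODE.FunSpace.next_apply]) hs'
    exact h1.hasDerivAt (Icc_mem_nhds hs.1 hs.2)
  · exact α.compProj_mem_closedBall hpl.mul_max_le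

theorem IsLocalFlowOn.mono {W : Type*} [NormedAddCommGroup W] [NormedSpace ℝ W] {X : W → W}
    {θ : ℝ → W → W} {U U' : Set W} (h : IsLocalFlowOn X θ U) (hU : U' ⊆ U) :
    IsLocalFlowOn X θ U' :=
  ⟨fun w hw => h.tendsto w (hU hw), fun w hw => h.map_zero w (hU hw),
    fun w hw => h.hasDerivAt w (hU hw)⟩

/-- The flow of a `C¹` vector field lifts to a flow of the lifted vector field. -/
theorem IsLocalFlowOn.exists_frame_lift [CompleteSpace E] {X : E → E} {θ : ℝ → E → E} {U : Set E}
    (hθ : IsLocalFlowOn X θ U) (hU : IsOpen U) (hX : ContDiffOn ℝ 1 X U) {u₀ : E} (hu₀ : u₀ ∈ U) :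
    ∃ U' ⊆ U, IsOpen U' ∧ u₀ ∈ U' ∧ ∃ Θ : ℝ → E × (E →L[ℝ] E) → E × (E →L[ℝ] E),
      IsLocalFlowOn (frameField X) Θ (U' ×ˢ univ) ∧ ∀ t w, (Θ t w).1 = θ t w.1 := by
  have hD : ContinuousOn (fderiv ℝ X) U :=
    (hX.fderiv_of_isOpen hU (m := 0) (by norm_num)).continuousOn
  set K := ‖fderiv ℝ X u₀‖ + 1 with hK
  have hK0 : 0 < K := by positivity
  have hev : ∀ᶠ z : ℝ × E in 𝓝 (0, u₀), (HasDerivAt (fun s => θ s z.2) (X (θ z.1 z.2)) z.1 ∧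
      θ z.1 z.2 ∈ U) ∧ ‖fderiv ℝ X (θ z.1 z.2)‖ ≤ K := by
    refine ((hθ.hasDerivAt u₀ hu₀).and (hθ.eventually_mem hU hu₀)).and ?_
    have := ((hD.continuousAt (hU.mem_nhds hu₀)).tendsto.comp (hθ.tendsto u₀ hu₀)).norm
    filter_upwards [this.eventually (gt_mem_nhds (lt_add_one _))] with z hz using hz.le
  obtain ⟨δ, hδ, hball⟩ := Metric.eventually_nhds_iff_ball.1 hev
  simp only [← ball_prod_same, Set.mem_prod, mem_ball_zero_iff, Real.norm_eq_abs, and_imp,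
    Prod.forall] at hball
  set ε := min (δ / 2) (1 / (2 * K)) with hε
  have hε0 : 0 < ε := by positivity
  have hεδ : ε < δ := (min_le_left _ _).trans_lt (half_lt_self hδ)
  have hεK : 2 * K * ε ≤ 1 := by
    calc 2 * K * ε ≤ 2 * K * (1 / (2 * K)) :=
          mul_le_mul_of_nonneg_left (min_le_right _ _) (by positivity)
      _ = 1 := by field_simp
  have hsol : ∀ q : E, ∃ B : ℝ → E →L[ℝ] E, q ∈ Metric.ball u₀ δ →
      (B 0 = ContinuousLinearMap.id ℝ E ∧
      (∀ s ∈ Ioo (-ε) ε, HasDerivAt B ((fderiv ℝ X (θ s q)).comp (B s)) s) ∧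
      ∀ s, ‖B s‖ ≤ 2) := by
    intro q
    by_cases hq : q ∈ Metric.ball u₀ δ
    · have habs : ∀ s ∈ Icc (-ε) ε, |s| < δ := fun s hs => (abs_le.2 hs).trans_lt hεδ
      obtain ⟨B, hB⟩ := exists_linear_ode_solution (C := fun s => fderiv ℝ X (θ s q)) hε0 hK0.le hεK
        (fun s hs => by
          have h := (hball s q (habs s hs) hq).1
          exact ((hD.continuousAt (hU.mem_nhds h.2)).comp (f := fun s => θ s q)
            h.1.continuousAt).continuousWithinAt)
        (fun s hs => (hball s q (habs s hs) hq).2)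
      exact ⟨B, fun _ => hB⟩
    · exact ⟨0, fun h => absurd h hq⟩
  choose B hB using hsol
  have hBtend : ∀ u ∈ Metric.ball u₀ δ,
      Tendsto (fun z : ℝ × E => B z.2 z.1) (𝓝 (0, u)) (𝓝 (ContinuousLinearMap.id ℝ E)) := by
    intro u hu
    have hsu : ∀ᶠ z : ℝ × E in 𝓝 (0, u), z.1 ∈ Ioo (-ε) ε ∧ z.2 ∈ Metric.ball u₀ δ :=
      ((continuous_fst.tendsto (0, u)).eventually
        (Ioo_mem_nhds (by simpa using hε0) (by simpa using hε0))).and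
        ((continuous_snd.tendsto (0, u)).eventually (Metric.isOpen_ball.mem_nhds hu))
    have h := eventually_norm_le_of_hasDerivAt (w₀ := u)
      (R := fun z : ℝ × E => B z.2 z.1 - ContinuousLinearMap.id ℝ E)
      (R' := fun z => (fderiv ℝ X (θ z.1 z.2)).comp (B z.2 z.1)) (g := fun _ => 1) (C := K * 2)
      (by positivity) monotoneOn_const
      (by
        filter_upwards [Metric.isOpen_ball.mem_nhds hu] with q hq
        rw [(hB q hq).1, sub_self])
      (by
        filter_upwards [hsu] with z hz
        exact ((hB z.2 hz.2).2.1 z.1 hz.1).sub_const _)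
      (by
        filter_upwards [hsu] with z hz
        rw [mul_one]
        refine (ContinuousLinearMap.opNorm_comp_le _ _).trans ?_
        exact mul_le_mul (hball z.1 z.2 ((abs_lt.2 hz.1).trans hεδ) hz.2).2
          ((hB z.2 hz.2).2.2 z.1) (norm_nonneg _) hK0.le)
    have h2 : (fun z : ℝ × E => B z.2 z.1 - ContinuousLinearMap.id ℝ E) =O[𝓝 ((0 : ℝ), u)]
        fun z => z.1 := by
      refine IsBigO.of_bound (K * 2) ?_
      filter_upwards [h] with z hz
      simpa using hz
    simpa using (h2.trans_tendsto (tendsto_fst_nhds_zero u)).add_const (ContinuousLinearMap.id ℝ E)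
  refine ⟨Metric.ball u₀ δ ∩ U, inter_subset_right, Metric.isOpen_ball.inter hU,
    ⟨Metric.mem_ball_self hδ, hu₀⟩, fun t w => (θ t w.1, (B w.1 t).comp w.2), ⟨?_, ?_, ?_⟩,
    fun t w => rfl⟩
  · rintro ⟨u, A⟩ ⟨⟨hu, hu'⟩, -⟩
    have hπ : Tendsto (fun z : ℝ × E × (E →L[ℝ] E) => (z.1, z.2.1)) (𝓝 (0, u, A)) (𝓝 (0, u)) :=
      (by fun_prop : Continuous fun z : ℝ × E × (E →L[ℝ] E) => (z.1, z.2.1)).tendsto' _ _ rfl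
    have hπ' : Tendsto (fun z : ℝ × E × (E →L[ℝ] E) => z.2.2) (𝓝 (0, u, A)) (𝓝 A) :=
      (by fun_prop : Continuous fun z : ℝ × E × (E →L[ℝ] E) => z.2.2).tendsto' _ _ rfl
    refine ((hθ.tendsto u hu').comp hπ).prodMk_nhds ?_
    have hcomp : Continuous fun p : (E →L[ℝ] E) × (E →L[ℝ] E) => p.1.comp p.2 :=
      continuous_fst.clm_comp continuous_snd
    exact (hcomp.tendsto' (ContinuousLinearMap.id ℝ E, A) A (by simp)).comp
      (((hBtend u hu).comp hπ).prodMk_nhds hπ')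
  · rintro ⟨u, A⟩ ⟨⟨hu, hu'⟩, -⟩
    simp [hθ.map_zero u hu', (hB u hu).1]
  · rintro ⟨u, A⟩ ⟨⟨hu, hu'⟩, -⟩
    have hπ : Tendsto (fun z : ℝ × E × (E →L[ℝ] E) => (z.1, z.2.1)) (𝓝 (0, u, A)) (𝓝 (0, u)) :=
      (by fun_prop : Continuous fun z : ℝ × E × (E →L[ℝ] E) => (z.1, z.2.1)).tendsto' _ _ rfl
    have hsu : ∀ᶠ z : ℝ × E in 𝓝 (0, u), z.1 ∈ Ioo (-ε) ε ∧ z.2 ∈ Metric.ball u₀ δ :=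
      ((continuous_fst.tendsto (0, u)).eventually
        (Ioo_mem_nhds (by simpa using hε0) (by simpa using hε0))).and
        ((continuous_snd.tendsto (0, u)).eventually (Metric.isOpen_ball.mem_nhds hu))
    filter_upwards [hπ.eventually (hθ.hasDerivAt u hu'), hπ.eventually hsu] with z h1 h2
    refine h1.prodMk ?_
    have := ((hB z.2.1 h2.2).2.1 z.1 h2.1).clm_comp (hasDerivAt_const z.1 z.2.2)
    simpa [frameField, ContinuousLinearMap.comp_assoc] using this

theorem fst_knight_frame_lift {θ : ℕ → ℝ → E → E}
    {Θ : ℕ → ℝ → E × (E →L[ℝ] E) → E × (E →L[ℝ] E)} {m : ℕ}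
    (h : ∀ i, 1 ≤ i → i ≤ m → ∀ t w, (Θ i t w).1 = θ i t w.1) (t : ℝ) (w : E × (E →L[ℝ] E)) :
    (knight Θ m t w).1 = knight θ m t w.1 := by
  induction m with
  | zero => rfl
  | succ m ih =>
    simp only [knight]
    rw [h (m + 1) (by omega) le_rfl, ih fun i h1 h2 => h i h1 (by omega)]

/-- Finitely many flows lift simultaneously. -/
theorem exists_frame_lifts [CompleteSpace E] {X : ℕ → E → E} {θ : ℕ → ℝ → E → E} {U : Set E}
    {m : ℕ} (hθ : ∀ i, 1 ≤ i → i ≤ m → IsLocalFlowOn (X i) (θ i) U) (hU : IsOpen U)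
    (hX : ∀ i, 1 ≤ i → i ≤ m → ContDiffOn ℝ 1 (X i) U) {u₀ : E} (hu₀ : u₀ ∈ U) :
    ∃ U' ⊆ U, IsOpen U' ∧ u₀ ∈ U' ∧ ∃ Θ : ℕ → ℝ → E × (E →L[ℝ] E) → E × (E →L[ℝ] E),
      ∀ i, 1 ≤ i → i ≤ m → IsLocalFlowOn (frameField (X i)) (Θ i) (U' ×ˢ univ) ∧
        ∀ t w, (Θ i t w).1 = θ i t w.1 := by
  induction m with
  | zero => exact ⟨U, Subset.rfl, hU, hu₀, fun _ _ w => w, fun i h1 h2 => by omega⟩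
  | succ m ih =>
    obtain ⟨U₁, hU₁, hU₁o, hu₁, Θ, hΘ⟩ := ih (fun i h1 h2 => hθ i h1 (by omega))
      (fun i h1 h2 => hX i h1 (by omega))
    obtain ⟨U₂, hU₂, hU₂o, hu₂, Θ', hΘ', hΘ''⟩ := (hθ (m + 1) (by omega) le_rfl).exists_frame_lift
      hU (hX (m + 1) (by omega) le_rfl) hu₀
    refine ⟨U₁ ∩ U₂, inter_subset_left.trans hU₁, hU₁o.inter hU₂o, ⟨hu₁, hu₂⟩,
      fun i => if i = m + 1 then Θ' else Θ i, fun i h1 h2 => ?_⟩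
    by_cases hi : i = m + 1
    · subst hi
      simp only [if_true]
      exact ⟨hΘ'.mono (prod_mono inter_subset_right Subset.rfl), hΘ''⟩
    · simp only [hi, if_false]
      exact ⟨(hΘ i h1 (by omega)).1.mono (prod_mono inter_subset_left Subset.rfl),
        (hΘ i h1 (by omega)).2⟩

end LiftFlow

section LocalTheorem

theorem isBigO_sub_of_contDiffAt {E F : Type*} [NormedAddCommGroup E] [NormedSpace ℝ E]
    [NormedAddCommGroup F] [NormedSpace ℝ F] {G : E → F} {w : E} (hG : ContDiffAt ℝ 1 G w)
    {ι : Type*} {l : Filter ι} {a b : ι → E} (ha : Tendsto a l (𝓝 w)) (hb : Tendsto b l (𝓝 w)) :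
    (fun t => G (a t) - G (b t)) =O[l] fun t => a t - b t := by
  obtain ⟨K, s, hs, hK⟩ := hG.exists_lipschitzOnWith
  refine IsBigO.of_bound K ?_
  filter_upwards [ha.eventually hs, hb.eventually hs] with t h1 h2 using hK.norm_sub_le h1 h2

theorem sum_sum_range_rearrange {F : Type*} [AddCommGroup F] [Module ℝ F] (N : ℕ) (t : ℝ)
    (C : ℕ → ℕ → F) :
    ∑ i ∈ Finset.range (N + 1), t ^ i • ((1 / (Nat.factorial i : ℝ)) •
      ∑ k ∈ Finset.range (N - i + 1), t ^ k • C i k) =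
    ∑ K ∈ Finset.range (N + 1), t ^ K • ∑ l ∈ Finset.range (K + 1),
      (1 / (Nat.factorial (K - l) : ℝ)) • C (K - l) l := by
  simp_rw [Finset.smul_sum]
  rw [Finset.sum_sigma', Finset.sum_sigma']
  refine Finset.sum_bij' (fun x _ => ⟨x.1 + x.2, x.2⟩) (fun x _ => ⟨x.1 - x.2, x.2⟩)
    ?_ ?_ ?_ ?_ ?_
  · rintro ⟨i, k⟩ h
    simp only [Finset.mem_sigma, Finset.mem_range] at h ⊢
    omega
  · rintro ⟨K, l⟩ h
    simp only [Finset.mem_sigma, Finset.mem_range] at h ⊢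
    omega
  · rintro ⟨i, k⟩ _
    simp
  · rintro ⟨K, l⟩ h
    simp only [Finset.mem_sigma, Finset.mem_range] at h
    simp [Nat.sub_add_cancel (by omega : l ≤ K)]
  · rintro ⟨i, k⟩ _
    simp only [smul_smul, Nat.add_sub_cancel]
    congr 1
    ring

variable {r s : ℕ}
variable {E : Type*} [NormedAddCommGroup E] [NormedSpace ℝ E]
variable {n : ℕ} {X : ℕ → E → E} {θ : ℕ → ℝ → E → E} {U : Set E}

theorem tendsto_mk_nhds_zero {W : Type*} [TopologicalSpace W] (u : W) :
    Tendsto (fun t : ℝ => (t, u)) (𝓝 0) (𝓝 ((0 : ℝ), u)) :=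
  (by fun_prop : Continuous fun t : ℝ => (t, u)).tendsto' _ _ rfl

/-- Taylor coefficients are determined by an asymptotic expansion. -/
theorem iteratedDeriv_eq_of_expansion {F : Type*} [NormedAddCommGroup F] [NormedSpace ℝ F]
    {H : ℝ × E → F} {O : Set (ℝ × E)} (hO : IsOpen O) {m : ℕ} (hH : ContDiffOn ℝ m H O) {u : E}
    (hu : u ∈ zeroSlice O) {b : ℕ → F}
    (h : (fun t : ℝ => H (t, u) - ∑ k ∈ Finset.range (m + 1), t ^ k • b k) =o[𝓝 0]
      fun t => t ^ m) {k : ℕ} (hk : k ≤ m) :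
    iteratedDeriv k (fun t => H (t, u)) 0 = (Nat.factorial k : ℝ) • b k := by
  have h1 := (time_taylor hO hH hu).comp_tendsto (tendsto_mk_nhds_zero u)
  have h2 := eq_of_sum_pow_smul_isLittleO (N := m) (f := fun t => H (t, u))
    (a := fun k => (1 / (Nat.factorial k : ℝ)) • iteratedDeriv k (fun t => H (t, u)) 0)
    (b := b) h1 h k hk
  rw [← h2, smul_smul, mul_one_div_cancel (by positivity), one_smul]

/-- The Taylor coefficients of a family of maps that is approximated by a knight. -/
theorem iteratedDeriv_eq_knightCoeff (hn : 1 ≤ n) (hU : IsOpen U)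
    (hX : ∀ i, 1 ≤ i → i ≤ n - 1 → ContDiffOn ℝ (n - i : ℕ) (X i) U)
    (hθ : ∀ i, 1 ≤ i → i ≤ n - 1 → IsLocalFlowOn (X i) (θ i) U)
    {Φ : ℝ × E → E} {O : Set (ℝ × E)} (hO : IsOpen O) (hΦ : ContDiffOn ℝ n Φ O)
    {u : E} (hu : u ∈ U) (huO : u ∈ zeroSlice O)
    (happ : (fun t : ℝ => Φ (t, u) - knight θ (n - 1) t u) =o[𝓝 0] fun t => t ^ (n - 1))
    {k : ℕ} (hk : k < n) :
    (1 / (Nat.factorial k : ℝ)) • iteratedDeriv k (fun t => Φ (t, u)) 0 =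
      knightCoeff (fun i => along (X i)) (n - 1) k (id : E → E) u := by
  have h2 := (knight_expansion (M := n) (d := n - 1) hU hX hθ (by omega)
    contDiff_id.contDiffOn hu).comp_tendsto (tendsto_mk_nhds_zero u)
  rw [iteratedDeriv_eq_of_expansion hO (hΦ.of_le (m := (n - 1 : ℕ)) (by norm_cast; omega)) huO
    (b := fun k => knightCoeff (fun i => along (X i)) (n - 1) k (id : E → E) u)
    ((happ.add h2).congr_left fun t => by simp) (by omega : k ≤ n - 1), smul_smul,
    one_div_mul_cancel (by positivity), one_smul]

theorem contDiffOn_fderiv_slice {F : Type*} [NormedAddCommGroup F] [NormedSpace ℝ F]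
    {Φ : ℝ × E → F} {O : Set (ℝ × E)} (hO : IsOpen O) (hn : 1 ≤ n)
    (hΦ : ContDiffOn ℝ n Φ O) :
    ContDiffOn ℝ (n - 1 : ℕ) (fun z : ℝ × E => fderiv ℝ (fun v => Φ (z.1, v)) z.2) O := by
  have h1 : ContDiffOn ℝ (n - 1 : ℕ)
      (fun z : ℝ × E => (fderiv ℝ Φ z).comp (ContinuousLinearMap.inr ℝ ℝ E)) O :=
    (hΦ.fderiv_of_isOpen hO (by norm_cast; omega)).clm_comp contDiffOn_const
  refine h1.congr fun z hz => ?_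
  have hd : DifferentiableAt ℝ Φ z :=
    (hΦ.contDiffAt (hO.mem_nhds hz)).differentiableAt (by norm_cast; omega)
  exact (HasFDerivAt.comp z.2 (g := Φ) (f := fun v : E => (z.1, v)) hd.hasFDerivAt
    (hasFDerivAt_prodMk_right z.1 z.2)).fderiv

/-- The coefficients of a lifted knight, for the differential of a function. -/
theorem knightCoeff_frameDifferential {F : Type*} [NormedAddCommGroup F] [NormedSpace ℝ F]
    {m d k : ℕ} {G : E → F} (hU : IsOpen U)
    (hX : ∀ i, 1 ≤ i → i ≤ m → ContDiffOn ℝ (n - i : ℕ) (X i) U) (hd : d + 1 ≤ n)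
    (hG : ContDiffOn ℝ (d + 1 : ℕ) G U) (hk : k ≤ d) :
    EqOn (knightCoeff (fun i => along (frameField (X i))) m k (frameDifferential G))
      (frameDifferential (knightCoeff (fun i => along (X i)) m k G)) (U ×ˢ univ) := by
  refine (knightCoeff_rel (L := fun i => along (X i))
    (L' := fun i => along (F := E →L[ℝ] F) (frameField (X i))) (d := d)
    (R := fun d G G' => (d + 1 ≤ n ∧ ContDiffOn ℝ (d + 1 : ℕ) G U) ∧
      EqOn G' (frameDifferential G) (U ×ˢ univ)) ?_ ?_ ?_ ?_ ?_ hk ⟨⟨hd, hG⟩, fun _ _ => rfl⟩).2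
  · rintro d a a' ⟨⟨h1, h2⟩, h3⟩
    refine ⟨⟨h1, contDiffOn_const⟩, fun w hw => ?_⟩
    ext
    simp [frameDifferential]
  · rintro d a a' b b' ⟨⟨h1, h2⟩, h3⟩ ⟨⟨-, h2'⟩, h3'⟩
    refine ⟨⟨h1, h2.add h2'⟩, fun w hw => ?_⟩
    have e1 := (h2.contDiffAt (hU.mem_nhds hw.1)).differentiableAt (by norm_cast)
    have e2 := (h2'.contDiffAt (hU.mem_nhds hw.1)).differentiableAt (by norm_cast)
    simp [h3 hw, h3' hw, frameDifferential, fderiv_add e1 e2, ContinuousLinearMap.add_comp]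
  · rintro d c a a' ⟨⟨h1, h2⟩, h3⟩
    refine ⟨⟨h1, h2.const_smul c⟩, fun w hw => ?_⟩
    have e1 := (h2.contDiffAt (hU.mem_nhds hw.1)).differentiableAt (by norm_cast)
    simp [h3 hw, frameDifferential, fderiv_const_smul e1, ContinuousLinearMap.smul_comp]
  · rintro d e a a' hed ⟨⟨h1, h2⟩, h3⟩
    exact ⟨⟨by omega, h2.of_le (by norm_cast; omega)⟩, h3⟩
  · rintro i d a a' h1 h2 h3 ⟨⟨h4, h5⟩, h6⟩
    have h7 := contDiffOn_along hU (hX i h1 h2) h1 (by omega) h4 h5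
    rw [show d + 1 - i = d - i + 1 by omega] at h7
    refine ⟨⟨by omega, h7⟩, fun w hw => ?_⟩
    have hopen : U ×ˢ univ ∈ 𝓝 w := (hU.prod isOpen_univ).mem_nhds hw
    rw [along, (h6.eventuallyEq_of_mem hopen).fderiv_eq]
    refine along_frameField_frameDifferential ?_ ?_
    · exact (h5.contDiffAt (hU.mem_nhds hw.1)).of_le (by norm_cast; omega)
    · exact ((hX i h1 h2).contDiffAt (hU.mem_nhds hw.1)).differentiableAt (by norm_cast; omega)

theorem contDiffOn_lieDerivativeSpace [CompleteSpace E] {d i : ℕ} {X : E → E} {S : E → Tensor r s E}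
    (hU : IsOpen U) (hX : ContDiffOn ℝ (n - i : ℕ) X U) (hi : 1 ≤ i) (hid : i ≤ d)
    (hd : d + 1 ≤ n) (hS : ContDiffOn ℝ d S U) :
    ContDiffOn ℝ (d - i : ℕ) (lieDerivativeSpace X S) U := by
  have h1 : ContDiffOn ℝ (n - 1 - i : ℕ) (frameField X) (frameSet U) :=
    (contDiffOn_frameField hU (hX.of_le (by norm_cast; omega))).mono
      (prod_mono Subset.rfl (subset_univ _))
  have h2 := contDiffOn_along (isOpen_frameSet hU) h1 hi hid (by omega) (contDiffOn_frameTensor hS)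
  have h3 := h2.comp (f := fun u : E => (u, ContinuousLinearMap.id ℝ E))
    (contDiff_id.prodMk contDiff_const).contDiffOn fun u hu => ⟨hu, isInvertible_id⟩
  refine h3.congr fun u hu => ?_
  have h4 : DifferentiableAt ℝ S u :=
    (hS.contDiffAt (hU.mem_nhds hu)).differentiableAt (by norm_cast; omega)
  rw [Function.comp_apply, along_frameField_frameTensor h4 isInvertible_id, frameTensor,
    Tensor.pullback_id]

/-- The coefficients of a lifted knight, for tensor fields. -/
theorem knightCoeff_frameTensor [CompleteSpace E] {m d k : ℕ} {S : E → Tensor r s E}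
    (hU : IsOpen U) (hX : ∀ i, 1 ≤ i → i ≤ m → ContDiffOn ℝ (n - i : ℕ) (X i) U)
    (hd : d + 1 ≤ n) (hS : ContDiffOn ℝ d S U) (hk : k ≤ d) :
    EqOn (knightCoeff (fun i => along (frameField (X i))) m k (frameTensor S))
      (frameTensor (knightCoeff (fun i => lieDerivativeSpace (X i)) m k S)) (frameSet U) := by
  refine (knightCoeff_rel (L := fun i => lieDerivativeSpace (r := r) (s := s) (X i))
    (L' := fun i => along (F := Tensor r s E) (frameField (X i))) (d := d)
    (R := fun d S S' => (d + 1 ≤ n ∧ ContDiffOn ℝ d S U) ∧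
      EqOn S' (frameTensor S) (frameSet U)) ?_ ?_ ?_ ?_ ?_ hk ⟨⟨hd, hS⟩, fun _ _ => rfl⟩).2
  · rintro d a a' ⟨⟨h1, h2⟩, h3⟩
    refine ⟨⟨h1, contDiffOn_const⟩, fun w hw => ?_⟩
    simp [frameTensor, ← Tensor.pullbackL_apply]
  · rintro d a a' b b' ⟨⟨h1, h2⟩, h3⟩ ⟨⟨-, h2'⟩, h3'⟩
    refine ⟨⟨h1, h2.add h2'⟩, fun w hw => ?_⟩
    simp [h3 hw, h3' hw, frameTensor, ← Tensor.pullbackL_apply]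
  · rintro d c a a' ⟨⟨h1, h2⟩, h3⟩
    refine ⟨⟨h1, h2.const_smul c⟩, fun w hw => ?_⟩
    simp [h3 hw, frameTensor, ← Tensor.pullbackL_apply]
  · rintro d e a a' hed ⟨⟨h1, h2⟩, h3⟩
    exact ⟨⟨by omega, h2.of_le (by norm_cast)⟩, h3⟩
  · rintro i d a a' h1 h2 h3 ⟨⟨h4, h5⟩, h6⟩
    refine ⟨⟨by omega, contDiffOn_lieDerivativeSpace hU (hX i h1 h2) h1 h3 h4 h5⟩,
      fun w hw => ?_⟩
    rw [along, (h6.eventuallyEq_of_mem ((isOpen_frameSet hU).mem_nhds hw)).fderiv_eq]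
    refine along_frameField_frameTensor ?_ hw.2
    exact (h5.contDiffAt (hU.mem_nhds hw.1)).differentiableAt (by norm_cast; omega)

/-- The lift of a family of maps to the frame bundle is approximated by the lifted knight. -/
theorem frame_lift_sub_knight_isLittleO [CompleteSpace E] (hn : 1 ≤ n) (hU : IsOpen U)
    (hX : ∀ i, 1 ≤ i → i ≤ n - 1 → ContDiffOn ℝ (n - i : ℕ) (X i) U)
    (hθ : ∀ i, 1 ≤ i → i ≤ n - 1 → IsLocalFlowOn (X i) (θ i) U)
    {Φ : ℝ × E → E} {O : Set (ℝ × E)} (hO : IsOpen O) (hΦ : ContDiffOn ℝ n Φ O)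
    (hUO : U ⊆ zeroSlice O)
    (happ : ∀ u ∈ U,
      (fun t : ℝ => Φ (t, u) - knight θ (n - 1) t u) =o[𝓝 0] fun t => t ^ (n - 1))
    {U' : Set E} (hU'U : U' ⊆ U) (hU' : IsOpen U')
    {Θ : ℕ → ℝ → E × (E →L[ℝ] E) → E × (E →L[ℝ] E)}
    (hΘ : ∀ i, 1 ≤ i → i ≤ n - 1 → IsLocalFlowOn (frameField (X i)) (Θ i) (U' ×ˢ univ) ∧
        ∀ t w, (Θ i t w).1 = θ i t w.1) {u₀ : E} (hu₀ : u₀ ∈ U') :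
    (fun t : ℝ => (Φ (t, u₀), fderiv ℝ (fun v => Φ (t, v)) u₀) -
      knight Θ (n - 1) t (u₀, ContinuousLinearMap.id ℝ E)) =o[𝓝 0] fun t => t ^ (n - 1) := by
  refine IsLittleO.prod_left ((happ u₀ (hU'U hu₀)).congr_left fun t => ?_) ?_
  · rw [← fst_knight_frame_lift (fun i h1 h2 => (hΘ i h1 h2).2) t
      (u₀, ContinuousLinearMap.id ℝ E)]
  have h1 := (time_taylor hO (contDiffOn_fderiv_slice hO hn hΦ)
    (hUO (hU'U hu₀))).comp_tendsto (tendsto_mk_nhds_zero u₀)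
  have hX' : ∀ i, 1 ≤ i → i ≤ n - 1 →
      ContDiffOn ℝ (n - 1 - i : ℕ) (frameField (X i)) (U' ×ˢ univ) := fun i h1 h2 =>
    contDiffOn_frameField hU' (((hX i h1 h2).mono hU'U).of_le (by norm_cast; omega))
  have h2 := (knight_expansion (M := n - 1) (d := n - 1) (hU'.prod isOpen_univ) hX'
    (fun i h1 h2 => (hΘ i h1 h2).1) le_rfl (G := fun w : E × (E →L[ℝ] E) => w.2)
    contDiff_snd.contDiffOn (w := (u₀, ContinuousLinearMap.id ℝ E))
    ⟨hu₀, mem_univ _⟩).comp_tendsto (tendsto_mk_nhds_zero _)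
  refine (h1.sub h2).congr_left fun t => ?_
  simp only [Function.comp_apply]
  have hcoeff : ∀ k ∈ Finset.range (n - 1 + 1),
      (1 / (Nat.factorial k : ℝ)) • iteratedDeriv k (fun t => fderiv ℝ (fun v => Φ (t, v)) u₀) 0 =
      knightCoeff (fun i => along (frameField (X i))) (n - 1) k
        (fun w : E × (E →L[ℝ] E) => w.2) (u₀, ContinuousLinearMap.id ℝ E) := by
    intro k hk
    have hk' : k < n := by have := Finset.mem_range.1 hk; omega
    have hid : (fun w : E × (E →L[ℝ] E) => w.2) = frameDifferential (id : E → E) := by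
      funext w
      simp [frameDifferential, fderiv_id]
    rw [hid, knightCoeff_frameDifferential (n := n) (d := n - 1) hU hX (by omega)
      contDiff_id.contDiffOn (by omega) (show (u₀, _) ∈ U ×ˢ univ from ⟨hU'U hu₀, mem_univ _⟩),
      iteratedDeriv_fderiv_slice hO hΦ (by omega) (hUO (hU'U hu₀))]
    have e1 : knightCoeff (fun i => along (X i)) (n - 1) k (id : E → E) =ᶠ[𝓝 u₀]
        fun u => (1 / (Nat.factorial k : ℝ)) • iteratedDeriv k (fun t => Φ (t, u)) 0 := by
      filter_upwards [hU.mem_nhds (hU'U hu₀)] with u hu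
      exact (iteratedDeriv_eq_knightCoeff hn hU hX hθ hO hΦ hu (hUO hu) (happ u hu) hk').symm
    have e2 : DifferentiableAt ℝ (fun u => iteratedDeriv k (fun t => Φ (t, u)) 0) u₀ :=
      ((contDiffOn_iteratedDeriv_slice hO hΦ hk'.le).contDiffAt
        ((isOpen_zeroSlice hO).mem_nhds (hUO (hU'U hu₀)))).differentiableAt
        (by norm_cast; omega)
    simp [frameDifferential, e1.fderiv_eq, fderiv_fun_const_smul e2]
  rw [Finset.sum_congr rfl fun k hk => by rw [hcoeff k hk]]
  abel

/-- The expansion of the pull-back of a family of tensor fields, in terms of the frame bundle. -/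
theorem pullback_sub_sum_frameTensor_isLittleO [CompleteSpace E] {S : ℝ × E → Tensor r s E}
    {Q : Set (ℝ × E)} (hQ : IsOpen Q) {m : ℕ} (hS : ContDiffOn ℝ m S Q) {u₀ : E}
    (hu₀ : u₀ ∈ zeroSlice Q) {c : ℝ → E} {A : ℝ → E →L[ℝ] E} (hc : Tendsto c (𝓝 0) (𝓝 u₀))
    (hA : Tendsto A (𝓝 0) (𝓝 (ContinuousLinearMap.id ℝ E))) :
    (fun t : ℝ => (S (t, c t)).pullback (A t) -
      ∑ j ∈ Finset.range (m + 1), t ^ j • ((1 / (Nat.factorial j : ℝ)) •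
        frameTensor (fun u => iteratedDeriv j (fun t => S (t, u)) 0) (c t, A t)))
      =o[𝓝 0] fun t => t ^ m := by
  have h1 := (time_taylor hQ hS hu₀).comp_tendsto (tendsto_id.prodMk_nhds hc)
  have h2 : (fun t : ℝ => Tensor.pullbackL (r := r) (s := s) (A t)) =O[𝓝 0] fun _ => (1 : ℝ) :=
    ((Tensor.contDiffAt_pullbackL (n := 0) isInvertible_id).continuousAt.tendsto.comp
      hA).isBigO_one ℝ
  have h3 : (fun t : ℝ => ‖Tensor.pullbackL (r := r) (s := s) (A t)‖ * ‖S (t, c t) -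
      ∑ j ∈ Finset.range (m + 1), t ^ j • ((1 / (Nat.factorial j : ℝ)) •
        iteratedDeriv j (fun t' => S (t', c t)) 0)‖) =o[𝓝 0] fun t : ℝ => (1 : ℝ) * t ^ m :=
    h2.norm_left.mul_isLittleO h1.norm_left
  refine IsBigO.trans_isLittleO (IsBigO.of_bound 1 (Eventually.of_forall fun t => ?_))
    (h3.congr_right fun t => one_mul _)
  rw [one_mul, Real.norm_of_nonneg (by positivity)]
  refine le_trans (le_of_eq ?_) ((Tensor.pullbackL (r := r) (s := s) (A t)).le_opNorm _)
  simp only [map_sub, map_sum, map_smul, Tensor.pullbackL_apply, frameTensor]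

theorem contDiffOn_pullback_family [CompleteSpace E] {S : ℝ × E → Tensor r s E}
    {Q : Set (ℝ × E)} {m : ℕ} (hS : ContDiffOn ℝ m S Q) {Φ : ℝ × E → E}
    {A : ℝ × E → E →L[ℝ] E} {O : Set (ℝ × E)} (hΦ : ContDiffOn ℝ m Φ O) (hA : ContDiffOn ℝ m A O) :
    ContDiffOn ℝ m (fun z : ℝ × E => (S (z.1, Φ z)).pullback (A z))
      (O ∩ (fun z => ((z.1, Φ z), A z)) ⁻¹' (Q ×ˢ {A | A.IsInvertible})) := by
  have h1 : ContDiffOn ℝ m (fun z : ℝ × E => S (z.1, Φ z))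
      (O ∩ (fun z => ((z.1, Φ z), A z)) ⁻¹' (Q ×ˢ {A | A.IsInvertible})) :=
    hS.comp (contDiffOn_fst.prodMk (hΦ.mono inter_subset_left)) fun z hz => hz.2.1
  have h2 : ContDiffOn ℝ m (fun z : ℝ × E => Tensor.pullbackL (r := r) (s := s) (A z))
      (O ∩ (fun z => ((z.1, Φ z), A z)) ⁻¹' (Q ×ˢ {A | A.IsInvertible})) := fun z hz =>
    ContDiffAt.comp_contDiffWithinAt z (Tensor.contDiffAt_pullbackL hz.2.2)
      (hA.mono inter_subset_left z hz)
  exact h2.clm_apply h1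

/-- The expansion of a tensor field along a curve in the frame bundle that is approximated by a
lifted knight. -/
theorem frameTensor_sub_sum_isLittleO [CompleteSpace E] (hn : 1 ≤ n) (hU : IsOpen U)
    (hX : ∀ i, 1 ≤ i → i ≤ n - 1 → ContDiffOn ℝ (n - i : ℕ) (X i) U)
    {Θ : ℕ → ℝ → E × (E →L[ℝ] E) → E × (E →L[ℝ] E)}
    (hΘ : ∀ i, 1 ≤ i → i ≤ n - 1 → IsLocalFlowOn (frameField (X i)) (Θ i) (U ×ˢ univ))
    {u₀ : E} (hu₀ : u₀ ∈ U) {c : ℝ → E × (E →L[ℝ] E)}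
    (hc : Tendsto c (𝓝 0) (𝓝 (u₀, ContinuousLinearMap.id ℝ E)))
    (happ : (fun t => c t - knight Θ (n - 1) t (u₀, ContinuousLinearMap.id ℝ E))
      =o[𝓝 0] fun t => t ^ (n - 1))
    {d : ℕ} (hd : d + 1 ≤ n) {S : E → Tensor r s E} (hS : ContDiffOn ℝ (d + 1 : ℕ) S U) :
    (fun t : ℝ => frameTensor S (c t) - ∑ l ∈ Finset.range (d + 1), t ^ l •
      knightCoeff (fun i => lieDerivativeSpace (X i)) (n - 1) l S u₀) =o[𝓝 0] fun t => t ^ d := by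
  set w₀ : E × (E →L[ℝ] E) := (u₀, ContinuousLinearMap.id ℝ E) with hw₀
  have hw₀U : w₀ ∈ frameSet U := ⟨hu₀, isInvertible_id⟩
  have hX' : ∀ i, 1 ≤ i → i ≤ n - 1 →
      ContDiffOn ℝ (n - 1 - i : ℕ) (frameField (X i)) (frameSet U) := fun i h1 h2 =>
    (contDiffOn_frameField hU ((hX i h1 h2).of_le (by norm_cast; omega))).mono
      (prod_mono Subset.rfl (subset_univ _))
  have hΘ' : ∀ i, 1 ≤ i → i ≤ n - 1 → IsLocalFlowOn (frameField (X i)) (Θ i) (frameSet U) :=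
    fun i h1 h2 => (hΘ i h1 h2).mono (prod_mono Subset.rfl (subset_univ _))
  have hkn : Tendsto (fun t : ℝ => knight Θ (n - 1) t w₀) (𝓝 0) (𝓝 w₀) :=
    (tendsto_knight hΘ' hw₀U).comp (tendsto_mk_nhds_zero w₀)
  have hF : ContDiffOn ℝ (d + 1 : ℕ) (frameTensor S) (frameSet U) := contDiffOn_frameTensor hS
  have hF1 : ContDiffAt ℝ 1 (frameTensor S) w₀ :=
    (hF.contDiffAt ((isOpen_frameSet hU).mem_nhds hw₀U)).of_le (by norm_cast; omega)
  have h1 : (fun t : ℝ => frameTensor S (c t) - frameTensor S (knight Θ (n - 1) t w₀))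
      =o[𝓝 0] fun t : ℝ => t ^ d :=
    ((isBigO_sub_of_contDiffAt hF1 hc hkn).trans_isLittleO happ).trans_isBigO
      (isBigO_pow_pow_of_le tendsto_id (by omega))
  have h2 := (knight_expansion (M := n - 1) (d := d) (isOpen_frameSet hU) hX' hΘ'
    (by omega) (hF.of_le (by norm_cast; omega)) hw₀U).comp_tendsto (tendsto_mk_nhds_zero w₀)
  refine (h1.add h2).congr_left fun t => ?_
  simp only [Function.comp_apply, sub_add_sub_cancel]
  congr 1
  refine Finset.sum_congr rfl fun l hl => ?_
  have hl' : l ≤ d := Nat.lt_succ_iff.1 (Finset.mem_range.1 hl)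
  rw [knightCoeff_frameTensor (n := n) (d := d) hU hX (by omega)
    (hS.of_le (by norm_cast; omega)) hl' hw₀U, hw₀, frameTensor, Tensor.pullback_id]

/-- The Taylor coefficients of the pull-back of a family of tensor fields along a family of maps
that is approximated by a knight. -/
theorem iteratedDeriv_pullback_eq [CompleteSpace E] (hn : 1 ≤ n) (hU : IsOpen U)
    (hX : ∀ i, 1 ≤ i → i ≤ n - 1 → ContDiffOn ℝ (n - i : ℕ) (X i) U)
    (hθ : ∀ i, 1 ≤ i → i ≤ n - 1 → IsLocalFlowOn (X i) (θ i) U)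
    {Φ : ℝ × E → E} {O : Set (ℝ × E)} (hO : IsOpen O) (hΦ : ContDiffOn ℝ n Φ O)
    (hUO : U ⊆ zeroSlice O) (hΦ0 : ∀ u ∈ U, Φ (0, u) = u)
    (happ : ∀ u ∈ U,
      (fun t : ℝ => Φ (t, u) - knight θ (n - 1) t u) =o[𝓝 0] fun t => t ^ (n - 1))
    {S : ℝ × E → Tensor r s E} {Q : Set (ℝ × E)} (hQ : IsOpen Q) (hS : ContDiffOn ℝ n S Q)
    (hUQ : U ⊆ zeroSlice Q) {u₀ : E} (hu₀ : u₀ ∈ U) {k : ℕ} (hk : k < n) :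
    iteratedDeriv k (fun t => (S (t, Φ (t, u₀))).pullback (fderiv ℝ (fun v => Φ (t, v)) u₀)) 0 =
      ∑ l ∈ Finset.range (k + 1), ((Nat.factorial k : ℝ) / (Nat.factorial (k - l) : ℝ)) •
        knightCoeff (fun i => lieDerivativeSpace (X i)) (n - 1) l
          (fun u => iteratedDeriv (k - l) (fun t => S (t, u)) 0) u₀ := by
  obtain ⟨U', hU'U, hU', hu₀', Θ, hΘ⟩ := exists_frame_lifts hθ hU
    (fun i h1 h2 => (hX i h1 h2).of_le (by norm_cast; omega)) hu₀
  have hlift := frame_lift_sub_knight_isLittleO hn hU hX hθ hO hΦ hUO happ hU'U hU' hΘ hu₀'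
  set w₀ : E × (E →L[ℝ] E) := (u₀, ContinuousLinearMap.id ℝ E) with hw₀
  have hDΦ := contDiffOn_fderiv_slice hO hn hΦ
  have hDΦ0 : fderiv ℝ (fun v => Φ (0, v)) u₀ = ContinuousLinearMap.id ℝ E := by
    have : (fun v => Φ (0, v)) =ᶠ[𝓝 u₀] id := by
      filter_upwards [hU.mem_nhds hu₀] with u hu using hΦ0 u hu
    rw [this.fderiv_eq, fderiv_id]
  have hOnhds : O ∈ 𝓝 ((0 : ℝ), u₀) := hO.mem_nhds (hUO hu₀)
  have hΦt : Tendsto (fun t : ℝ => Φ (t, u₀)) (𝓝 0) (𝓝 u₀) := by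
    have := (hΦ.continuousOn.continuousAt hOnhds).tendsto.comp (tendsto_mk_nhds_zero u₀)
    rwa [hΦ0 u₀ hu₀] at this
  have hDΦt : Tendsto (fun t : ℝ => fderiv ℝ (fun v => Φ (t, v)) u₀) (𝓝 0)
      (𝓝 (ContinuousLinearMap.id ℝ E)) := by
    have := (hDΦ.continuousOn.continuousAt hOnhds).tendsto.comp (tendsto_mk_nhds_zero u₀)
    simpa [Function.comp_def, hDΦ0] using this
  have hc : Tendsto (fun t : ℝ => (Φ (t, u₀), fderiv ℝ (fun v => Φ (t, v)) u₀)) (𝓝 0) (𝓝 w₀) :=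
    hΦt.prodMk_nhds hDΦt
  set σ : ℕ → E → Tensor r s E := fun j u => iteratedDeriv j (fun t => S (t, u)) 0 with hσ
  have hσC : ∀ j ≤ n, ContDiffOn ℝ (n - j : ℕ) (σ j) U := fun j hj =>
    (contDiffOn_iteratedDeriv_slice hQ hS hj).mono hUQ
  -- expansion of the family of tensor fields
  have hA : (fun t : ℝ => (S (t, Φ (t, u₀))).pullback (fderiv ℝ (fun v => Φ (t, v)) u₀) -
      ∑ j ∈ Finset.range (n - 1 + 1), t ^ j • ((1 / (Nat.factorial j : ℝ)) •
        frameTensor (σ j) (Φ (t, u₀), fderiv ℝ (fun v => Φ (t, v)) u₀)))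
      =o[𝓝 0] fun t => t ^ (n - 1) := by
    exact pullback_sub_sum_frameTensor_isLittleO hQ (hS.of_le (by norm_cast; omega)) (hUQ hu₀)
      hΦt hDΦt
  have hB : (fun t : ℝ => ∑ j ∈ Finset.range (n - 1 + 1), t ^ j • ((1 / (Nat.factorial j : ℝ)) •
      (frameTensor (σ j) (Φ (t, u₀), fderiv ℝ (fun v => Φ (t, v)) u₀) -
        ∑ l ∈ Finset.range (n - 1 - j + 1), t ^ l •
          knightCoeff (fun i => lieDerivativeSpace (X i)) (n - 1) l (σ j) u₀)))
      =o[𝓝 0] fun t => t ^ (n - 1) := by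
    refine IsLittleO.fun_sum fun j hj => ?_
    have hj' : j ≤ n - 1 := Nat.lt_succ_iff.1 (Finset.mem_range.1 hj)
    have h1 := frameTensor_sub_sum_isLittleO hn hU' (fun i h1 h2 => (hX i h1 h2).mono hU'U)
      (fun i h1 h2 => (hΘ i h1 h2).1) hu₀' hc hlift (d := n - 1 - j) (by omega)
      (((hσC j (by omega)).mono hU'U).of_le (by norm_cast; omega))
    have h3 := (isBigO_refl (fun t : ℝ => t ^ j) (𝓝 0)).smul_isLittleO
      (h1.const_smul_left (1 / (Nat.factorial j : ℝ)))
    refine h3.congr_right fun t => ?_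
    rw [smul_eq_mul, ← pow_add, Nat.add_sub_cancel' hj']
  have hAB : (fun t : ℝ => (S (t, Φ (t, u₀))).pullback (fderiv ℝ (fun v => Φ (t, v)) u₀) -
      ∑ K ∈ Finset.range (n - 1 + 1), t ^ K • ∑ l ∈ Finset.range (K + 1),
        (1 / (Nat.factorial (K - l) : ℝ)) • knightCoeff (fun i => lieDerivativeSpace (X i)) (n - 1)
          l (σ (K - l)) u₀) =o[𝓝 0] fun t => t ^ (n - 1) := by
    refine (hA.add hB).congr_left fun t => ?_
    rw [← sum_sum_range_rearrange (n - 1) t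
      (fun j l => knightCoeff (fun i => lieDerivativeSpace (X i)) (n - 1) l (σ j) u₀)]
    simp only [smul_sub, Finset.sum_sub_distrib]
    rw [sub_add_sub_cancel]
  -- the Taylor expansion of the pull-back
  set Q' : Set (ℝ × E) := O ∩ (fun z => ((z.1, Φ z), fderiv ℝ (fun v => Φ (z.1, v)) z.2)) ⁻¹'
    (Q ×ˢ {A | A.IsInvertible}) with hQ'
  have hQ'o : IsOpen Q' :=
    ((continuousOn_fst.prodMk hΦ.continuousOn).prodMk hDΦ.continuousOn).isOpen_inter_preimage hO
      (hQ.prod isOpen_setOf_isInvertible)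
  have hP : ContDiffOn ℝ (n - 1 : ℕ)
      (fun z : ℝ × E => (S (z.1, Φ z)).pullback (fderiv ℝ (fun v => Φ (z.1, v)) z.2)) Q' := by
    exact contDiffOn_pullback_family (hS.of_le (by norm_cast; omega))
      (hΦ.of_le (by norm_cast; omega)) hDΦ
  have hu₀Q' : u₀ ∈ zeroSlice Q' := by
    refine ⟨hUO hu₀, ?_, ?_⟩
    · change (0, Φ (0, u₀)) ∈ Q
      rw [hΦ0 u₀ hu₀]
      exact hUQ hu₀
    · change (fderiv ℝ (fun v => Φ (0, v)) u₀).IsInvertible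
      rw [hDΦ0]
      exact isInvertible_id
  rw [iteratedDeriv_eq_of_expansion hQ'o hP hu₀Q' hAB (by omega), Finset.smul_sum]
  refine Finset.sum_congr rfl fun l _ => ?_
  rw [smul_smul, mul_one_div]

end LocalTheorem

section Charts

variable {r s : ℕ}
variable {E : Type*} [NormedAddCommGroup E] [NormedSpace ℝ E]
variable {M : Type*} [TopologicalSpace M] [ChartedSpace E M]
variable {N : Type*} [TopologicalSpace N] [ChartedSpace E N]
variable {N' : Type*} [TopologicalSpace N'] [ChartedSpace E N']

theorem pullbackField_congr {f g : N → M} {p : N} (h : f =ᶠ[𝓝 p] g) (T : M → Tensor r s E) :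
    pullbackField f T p = pullbackField g T p := by
  rw [pullbackField, pullbackField, h.mfderiv_eq, h.eq_of_nhds]

theorem pullbackField_congr_right {f : N → M} {p : N} {T T' : M → Tensor r s E}
    (h : T (f p) = T' (f p)) : pullbackField f T p = pullbackField f T' p := by
  rw [pullbackField, h, pullbackField]

theorem pullbackField_comp {f : N → M} {g : N' → N} {p : N'}
    (hg : MDifferentiableAt 𝓘(ℝ, E) 𝓘(ℝ, E) g p)
    (hf : MDifferentiableAt 𝓘(ℝ, E) 𝓘(ℝ, E) f (g p))
    (hinv : (mfderiv 𝓘(ℝ, E) 𝓘(ℝ, E) g p).IsInvertible) (T : M → Tensor r s E) :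
    pullbackField (f ∘ g) T p = pullbackField g (pullbackField f T) p := by
  rw [pullbackField, mfderiv_comp p hf hg]
  exact Tensor.pullback_comp (V := E) (W := E) hinv _

theorem pullbackField_eq_pullback_fderiv (g : E → E) (T : E → Tensor r s E) (u : E) :
    pullbackField g T u = (T (g u)).pullback (fderiv ℝ g u) := by
  rw [pullbackField, mfderiv_eq_fderiv]

theorem pullbackField_eq_of_eventuallyEq_id {f : M → M} {p : M} (h : f =ᶠ[𝓝 p] id)
    (T : M → Tensor r s E) : pullbackField f T p = T p := by
  rw [pullbackField_congr h, pullbackField, mfderiv_id]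
  exact Tensor.pullback_id _

/-- The change of coordinates from the preferred chart at `x` to that at `y`. -/
noncomputable def chartTransition (x y : M) : E → E := extChartAt 𝓘(ℝ, E) y ∘ (extChartAt 𝓘(ℝ, E) x).symm

/-- The part of the image of the preferred chart at `x` where `chartTransition x y` is a change of
coordinates. -/
def chartOverlap (x y : M) : Set E :=
  (extChartAt 𝓘(ℝ, E) x).target ∩
    (extChartAt 𝓘(ℝ, E) x).symm ⁻¹' (extChartAt 𝓘(ℝ, E) y).source

theorem isOpen_chartOverlap (x y : M) : IsOpen (chartOverlap (E := E) x y) :=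
  (continuousOn_extChartAt_symm x).isOpen_inter_preimage (isOpen_extChartAt_target x)
    (isOpen_extChartAt_source y)

theorem mapsTo_chartTransition (x y : M) :
    MapsTo (chartTransition x y) (chartOverlap (E := E) x y)
      (extChartAt 𝓘(ℝ, E) y).target := fun _ hu => (extChartAt 𝓘(ℝ, E) y).map_source hu.2

theorem symm_chartTransition {x y : M} {u : E} (hu : u ∈ chartOverlap x y) :
    (extChartAt 𝓘(ℝ, E) y).symm (chartTransition x y u) = (extChartAt 𝓘(ℝ, E) x).symm u :=
  (extChartAt 𝓘(ℝ, E) y).left_inv hu.2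

theorem mem_chartOverlap_of_mem_target {x : M} {u : E} (hu : u ∈ (extChartAt 𝓘(ℝ, E) x).target) :
    u ∈ chartOverlap x ((extChartAt 𝓘(ℝ, E) x).symm u) := ⟨hu, mem_extChartAt_source _⟩

theorem mdifferentiableAt_extChartAt_symm [IsManifold 𝓘(ℝ, E) 1 M] {x : M} {u : E}
    (hu : u ∈ (extChartAt 𝓘(ℝ, E) x).target) :
    MDifferentiableAt 𝓘(ℝ, E) 𝓘(ℝ, E) (extChartAt 𝓘(ℝ, E) x).symm u :=
  ((contMDiffOn_extChartAt_symm (n := 1) x).contMDiffAt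
    ((isOpen_extChartAt_target x).mem_nhds hu)).mdifferentiableAt (by simp)

theorem isInvertible_mfderiv_extChartAt_symm [IsManifold 𝓘(ℝ, E) 1 M] {x : M} {u : E}
    (hu : u ∈ (extChartAt 𝓘(ℝ, E) x).target) :
    (mfderiv 𝓘(ℝ, E) 𝓘(ℝ, E) (extChartAt 𝓘(ℝ, E) x).symm u).IsInvertible := by
  have := isInvertible_mfderivWithin_extChartAt_symm (I := 𝓘(ℝ, E)) hu
  simpa [mfderivWithin_univ] using this

theorem contDiffOn_chartTransition (x y : M) (n : WithTop ℕ∞) [IsManifold 𝓘(ℝ, E) n M] :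
    ContDiffOn ℝ n (chartTransition x y) (chartOverlap (E := E) x y) := by
  have := contDiffOn_ext_coord_change (I := 𝓘(ℝ, E)) (n := n) y x
  rwa [PartialEquiv.trans_source] at this

theorem contMDiffAt_extChartAt_symm {n : WithTop ℕ∞} [IsManifold 𝓘(ℝ, E) n M] {x : M} {u : E}
    (hu : u ∈ (extChartAt 𝓘(ℝ, E) x).target) :
    ContMDiffAt 𝓘(ℝ, E) 𝓘(ℝ, E) n (extChartAt 𝓘(ℝ, E) x).symm u :=
  (contMDiffOn_extChartAt_symm x).contMDiffAt ((isOpen_extChartAt_target x).mem_nhds hu)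

theorem contDiffAt_chartTransition {x y : M} {u : E} (hu : u ∈ chartOverlap x y)
    {n : WithTop ℕ∞} [IsManifold 𝓘(ℝ, E) n M] : ContDiffAt ℝ n (chartTransition x y) u :=
  (contDiffOn_chartTransition x y n).contDiffAt ((isOpen_chartOverlap x y).mem_nhds hu)

theorem symm_eventuallyEq_symm_comp_chartTransition {x y : M} {u : E}
    (hu : u ∈ chartOverlap x y) :
    (extChartAt 𝓘(ℝ, E) x).symm =ᶠ[𝓝 u] (extChartAt 𝓘(ℝ, E) y).symm ∘ chartTransition x y := by
  filter_upwards [(isOpen_chartOverlap x y).mem_nhds hu] with v hv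
    using (symm_chartTransition hv).symm

theorem isInvertible_fderiv_chartTransition [IsManifold 𝓘(ℝ, E) 1 M] {x y : M} {u : E}
    (hu : u ∈ chartOverlap x y) : (fderiv ℝ (chartTransition x y) u).IsInvertible := by
  rw [← mfderiv_eq_fderiv, chartTransition,
    mfderiv_comp u (mdifferentiableAt_extChartAt (by simpa using hu.2))
      (mdifferentiableAt_extChartAt_symm hu.1)]
  exact (isInvertible_mfderiv_extChartAt hu.2).comp (isInvertible_mfderiv_extChartAt_symm hu.1)

theorem tensorInChart_eq_pullback [IsManifold 𝓘(ℝ, E) 1 M] {x y : M} {u : E}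
    (hu : u ∈ chartOverlap x y) (T : M → Tensor r s E) :
    tensorInChart x T u = (tensorInChart y T (chartTransition x y u)).pullback
      (fderiv ℝ (chartTransition x y) u) := by
  have hd : DifferentiableAt ℝ (chartTransition x y) u :=
    (contDiffAt_chartTransition (n := 1) hu).differentiableAt one_ne_zero
  have hinv := isInvertible_fderiv_chartTransition hu
  rw [← mfderiv_eq_fderiv] at hinv
  rw [tensorInChart, pullbackField_congr (symm_eventuallyEq_symm_comp_chartTransition hu),
    pullbackField_comp hd.mdifferentiableAt
      (mdifferentiableAt_extChartAt_symm (mapsTo_chartTransition x y hu))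
      hinv,
    pullbackField_eq_pullback_fderiv]
  rfl

theorem vectorInChart_eq_inverse [IsManifold 𝓘(ℝ, E) 1 M] {x y : M} {u : E}
    (hu : u ∈ chartOverlap x y) (X : (p : M) → TangentSpace 𝓘(ℝ, E) p) :
    vectorInChart x X u = (fderiv ℝ (chartTransition x y) u).inverse
      (vectorInChart y X (chartTransition x y u)) := by
  have hd : DifferentiableAt ℝ (chartTransition x y) u :=
    (contDiffAt_chartTransition (n := 1) hu).differentiableAt one_ne_zero
  have h1 := (symm_eventuallyEq_symm_comp_chartTransition hu).mfderiv_eq (I := 𝓘(ℝ, E))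
    (I' := 𝓘(ℝ, E))
  rw [mfderiv_comp u (mdifferentiableAt_extChartAt_symm (mapsTo_chartTransition x y hu))
    hd.mdifferentiableAt, mfderiv_eq_fderiv] at h1
  rw [vectorInChart, VectorField.mpullback_apply, h1, vectorInChart, VectorField.mpullback_apply]
  rw [symm_chartTransition hu]
  exact congrFun (congrArg _ (ContinuousLinearMap.IsInvertible.inverse_comp_of_right (M := E) (M₂ := E) (M₃ := E)
    (isInvertible_fderiv_chartTransition hu))) _

theorem fderiv_chartTransition_vectorInChart [IsManifold 𝓘(ℝ, E) 1 M] {x y : M} {u : E}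
    (hu : u ∈ chartOverlap x y) (X : (p : M) → TangentSpace 𝓘(ℝ, E) p) :
    fderiv ℝ (chartTransition x y) u (vectorInChart x X u) =
      vectorInChart y X (chartTransition x y u) := by
  rw [vectorInChart_eq_inverse hu]
  exact (isInvertible_fderiv_chartTransition hu).self_apply_inverse _

theorem contDiffOn_vectorInChart [CompleteSpace E] [IsManifold 𝓘(ℝ, E) ∞ M] {k : ℕ}
    {X : (p : M) → TangentSpace 𝓘(ℝ, E) p}
    (hX : ContMDiff 𝓘(ℝ, E) (𝓘(ℝ, E).prod 𝓘(ℝ, E)) k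
      (fun p : M => (⟨p, X p⟩ : TangentBundle 𝓘(ℝ, E) M))) (x : M) :
    ContDiffOn ℝ k (vectorInChart x X) (extChartAt 𝓘(ℝ, E) x).target := by
  intro u hu
  have := ContMDiffAt.mpullback_vectorField_preimage (hX _)
    (contMDiffAt_extChartAt_symm (n := ∞) hu) (isInvertible_mfderiv_extChartAt_symm hu)
    (by norm_cast; exact le_top)
  exact (contMDiffAt_vectorSpace_iff_contDiffAt.1 this).contDiffWithinAt

theorem mpullback_extChartAt_vectorInChart [IsManifold 𝓘(ℝ, E) 1 M] {x q : M}
    (hq : q ∈ (extChartAt 𝓘(ℝ, E) x).source) (X : (p : M) → TangentSpace 𝓘(ℝ, E) p) :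
    VectorField.mpullback 𝓘(ℝ, E) 𝓘(ℝ, E) (extChartAt 𝓘(ℝ, E) x) (vectorInChart x X) q = X q := by
  have h1 := mfderivWithin_extChartAt_symm_comp_mfderiv_extChartAt' (I := 𝓘(ℝ, E)) hq
  simp only [modelWithCornersSelf_coe, range_id, mfderivWithin_univ] at h1
  have h2 := isInvertible_mfderiv_extChartAt (I := 𝓘(ℝ, E)) hq
  have h3 := isInvertible_mfderiv_extChartAt_symm ((extChartAt 𝓘(ℝ, E) x).map_source hq)
  have h4 : (extChartAt 𝓘(ℝ, E) x).symm (extChartAt 𝓘(ℝ, E) x q) = q :=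
    (extChartAt 𝓘(ℝ, E) x).left_inv hq
  change (mfderiv 𝓘(ℝ, E) 𝓘(ℝ, E) (extChartAt 𝓘(ℝ, E) x) q).inverse
    (vectorInChart (E := E) x X (extChartAt 𝓘(ℝ, E) x q)) = X q
  refine h2.inverse_apply_eq.2 ?_
  rw [vectorInChart, VectorField.mpullback_apply, h4]
  refine h3.inverse_apply_eq.2 ?_
  exact (DFunLike.congr_fun h1 (X q)).symm

theorem contMDiff_of_contDiffOn_vectorInChart [CompleteSpace E] [IsManifold 𝓘(ℝ, E) ∞ M] {k : ℕ}
    {X : (p : M) → TangentSpace 𝓘(ℝ, E) p}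
    (hX : ∀ x : M, ContDiffOn ℝ k (vectorInChart x X) (extChartAt 𝓘(ℝ, E) x).target) :
    ContMDiff 𝓘(ℝ, E) (𝓘(ℝ, E).prod 𝓘(ℝ, E)) k
      (fun p : M => (⟨p, X p⟩ : TangentBundle 𝓘(ℝ, E) M)) := by
  intro x
  have h1 := (hX x).contDiffAt ((isOpen_extChartAt_target x).mem_nhds (mem_extChartAt_target x))
  have := ContMDiffAt.mpullback_vectorField_preimage (I := 𝓘(ℝ, E)) (f := extChartAt 𝓘(ℝ, E) x)
    (contMDiffAt_vectorSpace_iff_contDiffAt.2 h1)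
    (contMDiffAt_extChartAt (I := 𝓘(ℝ, E)) (n := ∞) (x := x)) (isInvertible_mfderiv_extChartAt (mem_extChartAt_source x))
    (by norm_cast; exact le_top)
  refine this.congr_of_eventuallyEq ?_
  filter_upwards [extChartAt_source_mem_nhds (I := 𝓘(ℝ, E)) x] with q hq
  rw [mpullback_extChartAt_vectorInChart hq]

theorem tensorInChart_lieDerivative [CompleteSpace E] [IsManifold 𝓘(ℝ, E) ∞ M] {x : M} {u : E}
    (hu : u ∈ (extChartAt 𝓘(ℝ, E) x).target) {X : (p : M) → TangentSpace 𝓘(ℝ, E) p}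
    (hX : ∀ y : M, ContDiffOn ℝ 1 (vectorInChart y X) (extChartAt 𝓘(ℝ, E) y).target)
    {T : M → Tensor r s E}
    (hT : ∀ y : M, ContDiffOn ℝ 1 (tensorInChart y T) (extChartAt 𝓘(ℝ, E) y).target) :
    tensorInChart x (lieDerivative X T) u =
      lieDerivativeSpace (vectorInChart x X) (tensorInChart x T) u := by
  set p := (extChartAt 𝓘(ℝ, E) x).symm u with hp
  have hup : u ∈ chartOverlap x p := mem_chartOverlap_of_mem_target hu
  have hov : ∀ᶠ v in 𝓝 u, v ∈ chartOverlap x p := (isOpen_chartOverlap x p).mem_nhds hup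
  have hd : ∀ {y : M} {v : E}, v ∈ (extChartAt 𝓘(ℝ, E) y).target →
      DifferentiableAt ℝ (vectorInChart y X) v ∧ DifferentiableAt ℝ (tensorInChart y T) v :=
    fun {y v} hv => ⟨((hX y).contDiffAt ((isOpen_extChartAt_target y).mem_nhds hv)).differentiableAt
      one_ne_zero, ((hT y).contDiffAt ((isOpen_extChartAt_target y).mem_nhds hv)).differentiableAt
      one_ne_zero⟩
  rw [lieDerivativeSpace_pullback (contDiffAt_chartTransition hup)
    (isInvertible_fderiv_chartTransition hup)
    (hov.mono fun v hv => fderiv_chartTransition_vectorInChart hv X)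
    (hd (mapsTo_chartTransition x p hup)).1 (hd hu).1 (hd (mapsTo_chartTransition x p hup)).2
    (hov.mono fun v hv => tensorInChart_eq_pullback hv T)]
  rw [← pullbackField_eq_pullback_fderiv, chartTransition,
    pullbackField_comp (mdifferentiableAt_extChartAt_symm hu)
      (mdifferentiableAt_extChartAt (by simpa using hup.2))
      (isInvertible_mfderiv_extChartAt_symm hu), tensorInChart]
  exact pullbackField_congr_right (by rw [lieDerivative])

end Charts

section ChartFlows

variable {r s : ℕ}
variable {E : Type*} [NormedAddCommGroup E] [NormedSpace ℝ E]
variable {M : Type*} [TopologicalSpace M] [ChartedSpace E M]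

theorem tensorInChart_zero (x : M) : tensorInChart x (0 : M → Tensor r s E) = 0 := by
  funext u
  exact (Tensor.pullbackL (r := r) (s := s) (V := E) (W := E)
    (mfderiv 𝓘(ℝ, E) 𝓘(ℝ, E) (extChartAt 𝓘(ℝ, E) x).symm u)).map_zero

theorem tensorInChart_add (x : M) (S T : M → Tensor r s E) :
    tensorInChart x (S + T) = tensorInChart x S + tensorInChart x T := by
  funext u
  exact (Tensor.pullbackL (r := r) (s := s) (V := E) (W := E)
    (mfderiv 𝓘(ℝ, E) 𝓘(ℝ, E) (extChartAt 𝓘(ℝ, E) x).symm u)).map_add _ _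

theorem tensorInChart_smul (x : M) (c : ℝ) (T : M → Tensor r s E) :
    tensorInChart x (c • T) = c • tensorInChart x T := by
  funext u
  exact (Tensor.pullbackL (r := r) (s := s) (V := E) (W := E)
    (mfderiv 𝓘(ℝ, E) 𝓘(ℝ, E) (extChartAt 𝓘(ℝ, E) x).symm u)).map_smul _ _

/-- The coefficients of knights, acting on tensor fields, computed in a chart. -/
theorem tensorInChart_knightCoeff [CompleteSpace E] [IsManifold 𝓘(ℝ, E) ∞ M] {n m d k : ℕ}
    {ξ : ℕ → (p : M) → TangentSpace 𝓘(ℝ, E) p}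
    (hξ : ∀ i, 1 ≤ i → i ≤ m → ∀ y : M,
      ContDiffOn ℝ (n - i : ℕ) (vectorInChart y (ξ i)) (extChartAt 𝓘(ℝ, E) y).target)
    (hd : d + 1 ≤ n) {T : M → Tensor r s E}
    (hT : ∀ y : M, ContDiffOn ℝ d (tensorInChart y T) (extChartAt 𝓘(ℝ, E) y).target)
    (hk : k ≤ d) (x : M) :
    EqOn (tensorInChart x (knightCoeff (fun i => lieDerivative (ξ i)) m k T))
      (knightCoeff (fun i => lieDerivativeSpace (vectorInChart x (ξ i))) m k (tensorInChart x T))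
      (extChartAt 𝓘(ℝ, E) x).target := by
  refine (knightCoeff_rel (L := fun i => lieDerivative (r := r) (s := s) (ξ i))
    (L' := fun i => lieDerivativeSpace (r := r) (s := s) (vectorInChart x (ξ i)))
    (R := fun d T G => (d + 1 ≤ n ∧ ∀ y : M,
        ContDiffOn ℝ d (tensorInChart y T) (extChartAt 𝓘(ℝ, E) y).target) ∧
      EqOn (tensorInChart x T) G (extChartAt 𝓘(ℝ, E) x).target)
    ?_ ?_ ?_ ?_ ?_ hk ⟨⟨hd, hT⟩, fun _ _ => rfl⟩).2
  · rintro d a a' ⟨⟨h1, -⟩, -⟩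
    simp only [tensorInChart_zero]
    exact ⟨⟨h1, fun y => contDiffOn_const⟩, fun _ _ => rfl⟩
  · rintro d a a' b b' ⟨⟨h1, h2⟩, h3⟩ ⟨⟨-, h2'⟩, h3'⟩
    simp only [tensorInChart_add]
    exact ⟨⟨h1, fun y => (h2 y).add (h2' y)⟩, fun u hu => by simp [h3 hu, h3' hu]⟩
  · rintro d c a a' ⟨⟨h1, h2⟩, h3⟩
    simp only [tensorInChart_smul]
    exact ⟨⟨h1, fun y => (h2 y).const_smul c⟩, fun u hu => by simp [h3 hu]⟩
  · rintro d e a a' hed ⟨⟨h1, h2⟩, h3⟩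
    exact ⟨⟨by omega, fun y => (h2 y).of_le (by norm_cast)⟩, h3⟩
  · rintro i d a a' h1 h2 h3 ⟨⟨h4, h5⟩, h6⟩
    have key : ∀ y : M, EqOn (tensorInChart y (lieDerivative (ξ i) a))
        (lieDerivativeSpace (vectorInChart y (ξ i)) (tensorInChart y a))
        (extChartAt 𝓘(ℝ, E) y).target := fun y u hu =>
      tensorInChart_lieDerivative hu (fun z => (hξ i h1 h2 z).of_le (by norm_cast; omega))
        (fun z => (h5 z).of_le (by norm_cast; omega))
    refine ⟨⟨by omega, fun y => (contDiffOn_lieDerivativeSpace (isOpen_extChartAt_target y)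
      (hξ i h1 h2 y) h1 h3 h4 (h5 y)).congr (key y)⟩, fun u hu => (key x hu).trans ?_⟩
    rw [lieDerivativeSpace, lieDerivativeSpace, h6 hu,
      (h6.eventuallyEq_of_mem ((isOpen_extChartAt_target x).mem_nhds hu)).fderiv_eq]

theorem mfderiv_extChartAt_apply [IsManifold 𝓘(ℝ, E) 1 M] {x q : M}
    (hq : q ∈ (extChartAt 𝓘(ℝ, E) x).source) (X : (p : M) → TangentSpace 𝓘(ℝ, E) p) :
    mfderiv 𝓘(ℝ, E) 𝓘(ℝ, E) (extChartAt 𝓘(ℝ, E) x) q (X q) =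
      vectorInChart (E := E) x X (extChartAt 𝓘(ℝ, E) x q) := by
  rw [← mpullback_extChartAt_vectorInChart hq X]
  exact ContinuousLinearMap.IsInvertible.self_apply_inverse
    (isInvertible_mfderiv_extChartAt (I := 𝓘(ℝ, E)) hq) _

/-- The flow `φ` in the preferred chart at `x`. -/
noncomputable def flowInChart (x : M) (φ : ℝ → M → M) (t : ℝ) (u : E) : E :=
  extChartAt 𝓘(ℝ, E) x (φ t ((extChartAt 𝓘(ℝ, E) x).symm u))

theorem tendsto_mk_extChartAt_symm {x : M} {u : E} (hu : u ∈ (extChartAt 𝓘(ℝ, E) x).target)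
    (t : ℝ) : Tendsto (fun z : ℝ × E => (z.1, (extChartAt 𝓘(ℝ, E) x).symm z.2)) (𝓝 (t, u))
      (𝓝 (t, (extChartAt 𝓘(ℝ, E) x).symm u)) :=
  (continuousAt_fst (p := (t, u))).prodMk
    (ContinuousAt.comp (f := Prod.snd) (x := (t, u)) (continuousAt_extChartAt_symm'' hu)
      continuousAt_snd)

theorem IsFlowOn.tendsto {X : (p : M) → TangentSpace 𝓘(ℝ, E) p} {φ : ℝ → M → M}
    {D : Set (ℝ × M)} (h : IsFlowOn X φ D) (q : M) :
    Tendsto (fun z : ℝ × M => φ z.1 z.2) (𝓝 (0, q)) (𝓝 q) := by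
  have := (h.continuousOn.continuousAt (h.isOpen_domain.mem_nhds (h.zero_mem q))).tendsto
  rwa [h.map_zero] at this

theorem hasDerivAt_of_hasFDerivAt_comp_smulRight {f : ℝ → E} {A : E →L[ℝ] E} {v : E} {t : ℝ}
    (h : HasFDerivAt f (A.comp ((1 : ℝ →L[ℝ] ℝ).smulRight v)) t) : HasDerivAt f (A v) t := by
  simpa using h.hasDerivAt

theorem IsFlowOn.isLocalFlowOn [IsManifold 𝓘(ℝ, E) 1 M] {X : (p : M) → TangentSpace 𝓘(ℝ, E) p}
    {φ : ℝ → M → M} {D : Set (ℝ × M)} (h : IsFlowOn X φ D) (x : M) :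
    IsLocalFlowOn (vectorInChart x X) (flowInChart x φ) (extChartAt 𝓘(ℝ, E) x).target where
  tendsto u hu := by
    have h1 := (h.tendsto _).comp (tendsto_mk_extChartAt_symm hu 0)
    have h2 := continuousAt_extChartAt' (I := 𝓘(ℝ, E)) ((extChartAt 𝓘(ℝ, E) x).map_target hu)
    have := h2.tendsto.comp h1
    rwa [(extChartAt 𝓘(ℝ, E) x).right_inv hu] at this
  map_zero u hu := by
    rw [flowInChart, h.map_zero, (extChartAt 𝓘(ℝ, E) x).right_inv hu]
  hasDerivAt u hu := by
    have h1 := tendsto_mk_extChartAt_symm hu 0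
    filter_upwards [h1.eventually (h.isOpen_domain.mem_nhds (h.zero_mem _)),
      ((h.tendsto _).comp h1).eventually ((isOpen_extChartAt_source x).mem_nhds
        ((extChartAt 𝓘(ℝ, E) x).map_target hu))] with z hz1 hz2
    have hopen : {t : ℝ | (t, (extChartAt 𝓘(ℝ, E) x).symm z.2) ∈ D} ∈ 𝓝 z.1 :=
      (h.isOpen_domain.preimage (by fun_prop)).mem_nhds hz1
    have h2 := ((h.isMIntegralCurveOn ((extChartAt 𝓘(ℝ, E) x).symm z.2)) z.1 hz1).hasMFDerivAt
      hopen
    have h3 := (mdifferentiableAt_extChartAt (I := 𝓘(ℝ, E)) (x := x)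
      ((extChartAt_source 𝓘(ℝ, E) x) ▸ hz2)).hasMFDerivAt.comp z.1 h2
    exact (hasDerivAt_of_hasFDerivAt_comp_smulRight h3.hasFDerivAt).congr_deriv
      (mfderiv_extChartAt_apply hz2 X)

theorem tendsto_knight_manifold {φ : ℕ → ℝ → M → M} {m : ℕ}
    (hφ : ∀ i, 1 ≤ i → i ≤ m → ∀ q : M, Tendsto (fun z : ℝ × M => φ i z.1 z.2) (𝓝 (0, q)) (𝓝 q))
    (q : M) : Tendsto (fun t => knight φ m t q) (𝓝 0) (𝓝 q) := by
  induction m with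
  | zero => exact tendsto_const_nhds
  | succ m ih =>
    have h2 : Tendsto (fun t : ℝ => t ^ (m + 1) / (Nat.factorial (m + 1) : ℝ)) (𝓝 0) (𝓝 0) :=
      (by fun_prop : Continuous fun t : ℝ => t ^ (m + 1) / (Nat.factorial (m + 1) : ℝ)).tendsto' _ _
        (by simp)
    exact (hφ (m + 1) (by omega) le_rfl q).comp
      (h2.prodMk_nhds (ih fun i h1 h2 => hφ i h1 (by omega)))

theorem eventually_extChartAt_knight {φ : ℕ → ℝ → M → M} {m : ℕ}
    (hφ : ∀ i, 1 ≤ i → i ≤ m → ∀ q : M, Tendsto (fun z : ℝ × M => φ i z.1 z.2) (𝓝 (0, q)) (𝓝 q))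
    {x q : M} (hq : q ∈ (extChartAt 𝓘(ℝ, E) x).source) :
    ∀ᶠ t in 𝓝 (0 : ℝ), extChartAt 𝓘(ℝ, E) x (knight φ m t q) =
      knight (fun i => flowInChart x (φ i)) m t (extChartAt 𝓘(ℝ, E) x q) := by
  induction m with
  | zero => exact Eventually.of_forall fun _ => rfl
  | succ m ih =>
    have hφ' := fun i h1 (h2 : i ≤ m) => hφ i h1 (by omega)
    filter_upwards [ih hφ', (tendsto_knight_manifold hφ' q).eventually
      ((isOpen_extChartAt_source (I := 𝓘(ℝ, E)) x).mem_nhds hq)] with t h1 h2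
    rw [knight, knight, ← h1, flowInChart, (extChartAt 𝓘(ℝ, E) x).left_inv h2]

/-- The one-parameter family `Φ` in the preferred chart at `x`. -/
noncomputable def familyInChart (x : M) (Φ : ℝ → M → M) (z : ℝ × E) : E :=
  extChartAt 𝓘(ℝ, E) x (Φ z.1 ((extChartAt 𝓘(ℝ, E) x).symm z.2))

theorem IsDiffeoFamily.tendsto {n : ℕ} {Φ : ℝ → OpenPartialHomeomorph M M}
    (h : IsDiffeoFamily (E := E) n Φ) (q : M) :
    Tendsto (fun z : ℝ × M => Φ z.1 z.2) (𝓝 (0, q)) (𝓝 q) := by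
  have := (h.contMDiffOn.continuousOn.continuousAt
    (h.isOpen_domain.mem_nhds (h.zero_mem q))).tendsto
  rwa [h.map_zero] at this

theorem IsDiffeoFamily.exists_contDiffOn_familyInChart [IsManifold 𝓘(ℝ, E) ∞ M] {n : ℕ}
    {Φ : ℝ → OpenPartialHomeomorph M M} (h : IsDiffeoFamily (E := E) n Φ) (x : M) :
    ∃ O : Set (ℝ × E), IsOpen O ∧ ContDiffOn ℝ n (familyInChart x fun t => Φ t) O ∧
      (extChartAt 𝓘(ℝ, E) x).target ⊆ zeroSlice O := by
  set P : ℝ × E → ℝ × M := fun z => (z.1, (extChartAt 𝓘(ℝ, E) x).symm z.2) with hP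
  set V : Set (ℝ × E) := univ ×ˢ (extChartAt 𝓘(ℝ, E) x).target
  have hV : IsOpen V := isOpen_univ.prod (isOpen_extChartAt_target x)
  have hPc : ContinuousOn P V := continuousOn_fst.prodMk
    ((continuousOn_extChartAt_symm x).comp continuousOn_snd fun z hz => hz.2)
  have h1 : IsOpen (familyDomain Φ ∩ (fun z : ℝ × M => Φ z.1 z.2) ⁻¹'
      (extChartAt 𝓘(ℝ, E) x).source) :=
    h.contMDiffOn.continuousOn.isOpen_inter_preimage h.isOpen_domain (isOpen_extChartAt_source x)
  refine ⟨V ∩ P ⁻¹' _, hPc.isOpen_inter_preimage hV h1, ?_, ?_⟩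
  · rintro z ⟨hz1, hz2, hz3⟩
    have e1 : ContMDiffAt 𝓘(ℝ, ℝ × E) (𝓘(ℝ, ℝ).prod 𝓘(ℝ, E)) n P z :=
      ContMDiffAt.prodMk contDiff_fst.contMDiff.contMDiffAt
        (ContMDiffAt.comp z (contMDiffAt_extChartAt_symm hz1.2) contDiff_snd.contMDiff.contMDiffAt)
    have e2 := (h.contMDiffOn.contMDiffAt (h.isOpen_domain.mem_nhds hz2)).comp z e1
    have e3 := (contMDiffAt_extChartAt' (I := 𝓘(ℝ, E)) (n := n) (x := x)
      (by simpa using hz3)).comp z e2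
    exact e3.contDiffAt.contDiffWithinAt
  · intro u hu
    refine ⟨⟨trivial, hu⟩, h.zero_mem _, ?_⟩
    simp only [hP, mem_preimage, h.map_zero]
    exact (extChartAt 𝓘(ℝ, E) x).map_target hu

end ChartFlows

section FlowExistence

variable {E : Type*} [NormedAddCommGroup E] [NormedSpace ℝ E]

/-- A flow box in a vector space: the integral curves of a `C^1` vector field that start close to a
given point, and stay in a given neighbourhood. -/
theorem exists_flow_box_space [CompleteSpace E] {X : E → E} {u₀ : E} (hX : ContDiffAt ℝ 1 X u₀)
    {U : Set E} (hU : IsOpen U) (hu₀ : u₀ ∈ U) :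
    ∃ ε > 0, ∃ V : Set E, IsOpen V ∧ u₀ ∈ V ∧ V ⊆ U ∧ ∃ θ : ℝ → E → E,
      (∀ u ∈ V, θ 0 u = u) ∧
      (∀ t ∈ Ioo (-ε) ε, ∀ u ∈ V, θ t u ∈ U ∧ HasDerivAt (fun s => θ s u) (X (θ t u)) t) ∧
      ContinuousOn (fun z : ℝ × E => θ z.1 z.2) (Ioo (-ε) ε ×ˢ V) := by
  obtain ⟨ε, hε, a, r, L, K, hr, hpl⟩ := IsPicardLindelof.of_contDiffAt_one hX
  have h0 := hpl 0
  have hIcc : Ioo (-ε) ε ⊆ Icc (0 - ε) (0 + ε) := fun t ht => ⟨by linarith [ht.1], by linarith [ht.2]⟩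
  obtain ⟨α, hα, hc⟩ := h0.exists_forall_mem_closedBall_eq_hasDerivWithinAt_continuousOn
  have hca : ContinuousAt α (u₀, 0) := hc.continuousAt
    (prod_mem_nhds (Metric.closedBall_mem_nhds _ (by exact_mod_cast hr))
      (Icc_mem_nhds (by linarith) (by linarith)))
  have hα0 : α (u₀, 0) = u₀ := (hα u₀ (Metric.mem_closedBall_self r.2)).1
  have hmem : ∀ᶠ z in 𝓝 (u₀, (0 : ℝ)), α z ∈ U :=
    hca.eventually (by rw [hα0]; exact hU.mem_nhds hu₀)
  obtain ⟨δ, hδ, hball⟩ := Metric.eventually_nhds_iff_ball.1 hmem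
  have hin : ∀ t ∈ Ioo (-min δ ε) (min δ ε), ∀ u ∈ U ∩ Metric.ball u₀ (min δ r),
      α (u, t) ∈ U ∧ t ∈ Ioo (-ε) ε ∧ u ∈ Metric.closedBall u₀ r := by
    rintro t ⟨ht1, ht2⟩ u ⟨-, hu⟩
    rw [Metric.mem_ball, lt_min_iff] at hu
    rw [neg_lt, lt_min_iff] at ht1
    rw [lt_min_iff] at ht2
    refine ⟨hball _ ?_, ⟨by linarith, ht2.2⟩, hu.2.le⟩
    rw [Metric.mem_ball, Prod.dist_eq, max_lt_iff, Real.dist_eq, sub_zero, abs_lt]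
    exact ⟨hu.1, by linarith, ht2.1⟩
  refine ⟨min δ ε, lt_min hδ hε, U ∩ Metric.ball u₀ (min δ r), hU.inter Metric.isOpen_ball,
    ⟨hu₀, Metric.mem_ball_self (lt_min hδ (by exact_mod_cast hr))⟩, inter_subset_left,
    fun t u => α (u, t), ?_, ?_, ?_⟩
  · intro u hu
    exact (hα u (hin 0 ⟨by simp [hδ, hε], by simp [hδ, hε]⟩ u hu).2.2).1
  · intro t ht u hu
    obtain ⟨h1, h2, h3⟩ := hin t ht u hu
    exact ⟨h1, ((hα u h3).2 t (hIcc h2)).hasDerivAt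
      (mem_of_superset (Ioo_mem_nhds h2.1 h2.2) hIcc)⟩
  · refine hc.comp (by fun_prop) ?_
    rintro ⟨t, u⟩ ⟨ht, hu⟩
    obtain ⟨h1, h2, h3⟩ := hin t ht u hu
    exact ⟨h3, hIcc h2⟩

variable {M : Type*} [TopologicalSpace M] [ChartedSpace E M]

theorem mfderiv_extChartAt_symm_apply [IsManifold 𝓘(ℝ, E) 1 M] {x : M} {u : E}
    (hu : u ∈ (extChartAt 𝓘(ℝ, E) x).target) (X : (p : M) → TangentSpace 𝓘(ℝ, E) p) :
    mfderiv 𝓘(ℝ, E) 𝓘(ℝ, E) (extChartAt 𝓘(ℝ, E) x).symm u (vectorInChart (E := E) x X u) =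
      X ((extChartAt 𝓘(ℝ, E) x).symm u) :=
  ContinuousLinearMap.IsInvertible.self_apply_inverse
    (isInvertible_mfderiv_extChartAt_symm (E := E) hu) _

/-- A flow box on a manifold. -/
theorem exists_flow_box [CompleteSpace E] [IsManifold 𝓘(ℝ, E) ∞ M]
    {X : (p : M) → TangentSpace 𝓘(ℝ, E) p}
    (hX : ContMDiff 𝓘(ℝ, E) (𝓘(ℝ, E).prod 𝓘(ℝ, E)) 1
      (fun p : M => (⟨p, X p⟩ : TangentBundle 𝓘(ℝ, E) M))) (p : M) :
    ∃ ε > 0, ∃ V : Set M, IsOpen V ∧ p ∈ V ∧ ∃ α : ℝ → M → M, (∀ q ∈ V, α 0 q = q) ∧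
      (∀ q ∈ V, IsMIntegralCurveOn (fun t => α t q) X (Ioo (-ε) ε)) ∧
      ContinuousOn (fun z : ℝ × M => α z.1 z.2) (Ioo (-ε) ε ×ˢ V) := by
  have hX1 := contDiffOn_vectorInChart (k := 1) hX p
  set χ := extChartAt 𝓘(ℝ, E) p with hχ
  obtain ⟨ε, hε, V, hV, hpV, hVU, θ, hθ0, hθ, hθc⟩ := exists_flow_box_space
    (hX1.contDiffAt ((isOpen_extChartAt_target p).mem_nhds (mem_extChartAt_target p)))
    (isOpen_extChartAt_target p) (mem_extChartAt_target p)
  have hχc : ContinuousOn χ χ.source := continuousOn_extChartAt p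
  refine ⟨ε, hε, χ.source ∩ χ ⁻¹' V, hχc.isOpen_inter_preimage (isOpen_extChartAt_source p) hV,
    ⟨mem_extChartAt_source p, hpV⟩, fun t q => χ.symm (θ t (χ q)), ?_, ?_, ?_⟩
  · rintro q ⟨hq1, hq2⟩
    simp only [hθ0 _ hq2]
    exact χ.left_inv hq1
  · rintro q ⟨hq1, hq2⟩ t ht
    obtain ⟨h1, h2⟩ := hθ t ht _ hq2
    have h3 := (mdifferentiableAt_extChartAt_symm (E := E) h1).hasMFDerivAt.comp t
      h2.hasFDerivAt.hasMFDerivAt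
    have h4 := mfderiv_extChartAt_symm_apply h1 X
    refine HasMFDerivAt.hasMFDerivWithinAt ?_
    refine h3.congr_mfderiv ?_
    ext
    exact (congrArg (mfderiv 𝓘(ℝ, E) 𝓘(ℝ, E) χ.symm (θ t (χ q))) (one_smul ℝ _)).trans
      (h4.trans (one_smul ℝ (X (χ.symm (θ t (χ q))))).symm)
  · refine (continuousOn_extChartAt_symm p).comp (hθc.comp (f := fun z : ℝ × M => (z.1, χ z.2))
      (continuousOn_fst.prodMk (hχc.comp continuousOn_snd fun z hz => hz.2.1)) ?_) ?_
    · exact fun z hz => ⟨hz.1, hz.2.2⟩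
    · exact fun z hz => (hθ _ hz.1 _ hz.2.2).1

theorem hasMFDerivAt_smulRight_congr {X : (p : M) → TangentSpace 𝓘(ℝ, E) p} {γ γ' : ℝ → M} {t : ℝ}
    (h : HasMFDerivAt 𝓘(ℝ, ℝ) 𝓘(ℝ, E) γ t ((1 : ℝ →L[ℝ] ℝ).smulRight (X (γ t))))
    (h' : γ' =ᶠ[𝓝 t] γ) :
    HasMFDerivAt 𝓘(ℝ, ℝ) 𝓘(ℝ, E) γ' t ((1 : ℝ →L[ℝ] ℝ).smulRight (X (γ' t))) := by
  have h1 : (X (γ t) : E) = X (γ' t) := congrArg (fun p => (X p : E)) h'.eq_of_nhds.symm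
  have h2 : ∀ v w : E, v = w → HasMFDerivAt 𝓘(ℝ, ℝ) 𝓘(ℝ, E) γ' t ((1 : ℝ →L[ℝ] ℝ).smulRight v) →
      HasMFDerivAt 𝓘(ℝ, ℝ) 𝓘(ℝ, E) γ' t ((1 : ℝ →L[ℝ] ℝ).smulRight w) := by
    rintro v w rfl h
    exact h
  exact h2 _ _ h1 (h.congr_of_eventuallyEq h')

/-- Every `C^1` vector field on a Hausdorff manifold generates a local flow. -/
theorem exists_isFlowOn [CompleteSpace E] [T2Space M] [IsManifold 𝓘(ℝ, E) ∞ M]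
    {X : (p : M) → TangentSpace 𝓘(ℝ, E) p}
    (hX : ContMDiff 𝓘(ℝ, E) (𝓘(ℝ, E).prod 𝓘(ℝ, E)) 1
      (fun p : M => (⟨p, X p⟩ : TangentBundle 𝓘(ℝ, E) M))) :
    ∃ (φ : ℝ → M → M) (D : Set (ℝ × M)), IsFlowOn X φ D := by
  choose ε hε V hV hpV α hα0 hα hαc using exists_flow_box hX
  classical
  set B : M → Set (ℝ × M) := fun p => Ioo (-ε p) (ε p) ×ˢ V p with hB
  have hBo : ∀ p, IsOpen (B p) := fun p => isOpen_Ioo.prod (hV p)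
  have hB0 : ∀ p, ((0 : ℝ), p) ∈ B p := fun p => ⟨⟨by simp [hε p], hε p⟩, hpV p⟩
  have huniq : ∀ p p' t q, (t, q) ∈ B p → (t, q) ∈ B p' → α p t q = α p' t q := by
    rintro p p' t q ⟨ht, hq⟩ ⟨ht', hq'⟩
    have hsub : ∀ a, min (ε p) (ε p') ≤ a →
        Ioo (-min (ε p) (ε p')) (min (ε p) (ε p')) ⊆ Ioo (-a) a :=
      fun a ha => Ioo_subset_Ioo (neg_le_neg ha) ha
    refine isMIntegralCurveOn_Ioo_eqOn_of_contMDiff_boundaryless (t₀ := 0)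
      (a := -min (ε p) (ε p')) (b := min (ε p) (ε p')) (by simp [hε]) hX
      ((hα p q hq).mono (hsub _ (min_le_left _ _))) ((hα p' q hq').mono (hsub _ (min_le_right _ _)))
      (by rw [hα0 p q hq, hα0 p' q hq']) ⟨?_, ?_⟩
    · rw [neg_lt, lt_min_iff]
      exact ⟨by linarith [ht.1], by linarith [ht'.1]⟩
    · exact lt_min ht.2 ht'.2
  set φ : ℝ → M → M := fun t q => if h : ∃ p, (t, q) ∈ B p then α h.choose t q else q with hφ
  have hφα : ∀ p t q, (t, q) ∈ B p → φ t q = α p t q := by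
    intro p t q h
    have hex : ∃ p, (t, q) ∈ B p := ⟨p, h⟩
    simp only [hφ, dif_pos hex]
    exact huniq _ _ _ _ hex.choose_spec h
  refine ⟨φ, ⋃ p, B p, isOpen_iUnion hBo, fun p => mem_iUnion.2 ⟨p, hB0 p⟩, ?_, ?_, ?_, ?_⟩
  · refine fun q => ⟨fun t ht t' ht' c hc => ?_⟩
    obtain ⟨p, hp1, hp2⟩ := mem_iUnion.1 ht
    obtain ⟨p', hp1', hp2'⟩ := mem_iUnion.1 ht'
    rcases le_total 0 c with h0 | h0
    · exact mem_iUnion.2 ⟨p', ⟨by linarith [hε p'], hc.2.trans_lt hp1'.2⟩, hp2'⟩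
    · exact mem_iUnion.2 ⟨p, ⟨hp1.1.trans_le hc.1, by linarith [hε p]⟩, hp2⟩
  · exact fun q => (hφα q 0 q (hB0 q)).trans (hα0 q q (hpV q))
  · intro z hz
    obtain ⟨p, hp⟩ := mem_iUnion.1 hz
    refine ContinuousAt.continuousWithinAt (((hαc p).continuousAt ((hBo p).mem_nhds hp)).congr ?_)
    filter_upwards [(hBo p).mem_nhds hp] with z' hz' using (hφα p _ _ hz').symm
  · intro q t ht
    obtain ⟨p, hp1, hp2⟩ := mem_iUnion.1 ht
    have h1 := (hα p q hp2 t hp1).hasMFDerivAt (isOpen_Ioo.mem_nhds hp1)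
    have h2 : (fun t => φ t q) =ᶠ[𝓝 t] fun t => α p t q := by
      filter_upwards [isOpen_Ioo.mem_nhds hp1] with t' ht' using hφα p _ _ ⟨ht', hp2⟩
    exact (hasMFDerivAt_smulRight_congr h1 h2).hasMFDerivWithinAt

end FlowExistence

section Approximation

variable {E : Type*} [NormedAddCommGroup E] [NormedSpace ℝ E]

theorem eq_of_sub_pow_smul_isLittleO {F : Type*} [NormedAddCommGroup F] [NormedSpace ℝ F]
    {N : ℕ} {a b : F} {f : ℝ → F}
    (ha : (fun t : ℝ => f t - t ^ N • a) =o[𝓝 0] fun t : ℝ => t ^ N)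
    (hb : (fun t : ℝ => f t - t ^ N • b) =o[𝓝 0] fun t : ℝ => t ^ N) : a = b := by
  have key : ∀ (c : F) (t : ℝ),
      ∑ k ∈ Finset.range (N + 1), t ^ k • (if k = N then c else 0) = t ^ N • c := by
    intro c t
    simp
  simpa using eq_of_sum_pow_smul_isLittleO (N := N) (a := fun k => if k = N then a else 0)
    (b := fun k => if k = N then b else 0) (f := f) (by simpa only [key] using ha)
    (by simpa only [key] using hb) N le_rfl

theorem isBigO_pow_of_expansion {F : Type*} [NormedAddCommGroup F] [NormedSpace ℝ F]
    {N : ℕ} {c : ℕ → F} {f : ℝ → F} (h : (fun t : ℝ => f t -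
      ∑ k ∈ Finset.range (N + 1 + 1), t ^ k • c k) =o[𝓝 0] fun t : ℝ => t ^ (N + 1))
    (hf : f =o[𝓝 0] fun t : ℝ => t ^ N) : f =O[𝓝 0] fun t : ℝ => t ^ (N + 1) := by
  have h2 : (fun t : ℝ => t ^ (N + 1) • c (N + 1)) =O[𝓝 0] fun t : ℝ => t ^ (N + 1) :=
    IsBigO.of_bound ‖c (N + 1)‖ (Eventually.of_forall fun t => by rw [norm_smul, mul_comm])
  have h3 : (fun t : ℝ => f t - ∑ k ∈ Finset.range (N + 1), t ^ k • c k) =O[𝓝 0]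
      fun t : ℝ => t ^ (N + 1) := by
    refine (h.isBigO.add h2).congr_left fun t => ?_
    rw [Finset.sum_range_succ _ (N + 1)]
    abel
  have h4 : ∀ k ≤ N, c k = 0 := eq_of_sum_pow_smul_isLittleO (b := fun _ => 0) (f := f)
    (h3.trans_isLittleO (isLittleO_pow_pow_of_lt tendsto_id (Nat.lt_succ_self N)))
    (by simpa using hf)
  refine h3.congr_left fun t => ?_
  rw [Finset.sum_eq_zero fun k hk => by
    rw [h4 k (by simpa [Nat.lt_succ_iff] using hk), smul_zero], sub_zero]

/-- The leading term of a difference is transformed by the derivative. -/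
theorem leadingTerm_comp {F : Type*} [NormedAddCommGroup F] [NormedSpace ℝ F] {g : E → F}
    {g' : E →L[ℝ] F} {w Z : E} (hg : HasStrictFDerivAt g g' w) {a b : ℝ → E}
    (ha : Tendsto a (𝓝 0) (𝓝 w)) (hb : Tendsto b (𝓝 0) (𝓝 w)) {N : ℕ}
    (h : (fun t => a t - b t - t ^ N • Z) =o[𝓝 0] fun t : ℝ => t ^ N) :
    (fun t => g (a t) - g (b t) - t ^ N • g' Z) =o[𝓝 0] fun t : ℝ => t ^ N := by
  have h1 : (fun t => a t - b t) =O[𝓝 0] fun t : ℝ => t ^ N := by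
    have h2 : (fun t : ℝ => t ^ N • Z) =O[𝓝 0] fun t : ℝ => t ^ N :=
      IsBigO.of_bound ‖Z‖ (Eventually.of_forall fun t => by rw [norm_smul, mul_comm])
    exact (h.isBigO.add h2).congr_left fun t => by abel
  have h2 := (hg.isLittleO.comp_tendsto (ha.prodMk_nhds hb)).trans_isBigO h1
  have h3 := (g'.isBigO_comp (fun t => a t - b t - t ^ N • Z) (𝓝 0)).trans_isLittleO h
  refine (h2.add h3).congr_left fun t => ?_
  simp only [Function.comp_apply, map_sub, map_smul]
  abel

variable {M : Type*} [TopologicalSpace M] [ChartedSpace E M]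

/-- The Taylor coefficients in time of a one-parameter family, in the preferred chart at `x`. -/
noncomputable def familyCoeff (x : M) (Φ : ℝ → M → M) (k : ℕ) (u : E) : E :=
  (1 / (Nat.factorial k : ℝ)) • iteratedDeriv k (fun t => familyInChart x Φ (t, u)) 0

/-- The coefficients of the knight generated by the vector fields `ξ i`, in the preferred chart
at `x`. -/
noncomputable def knightCoeffInChart (x : M) (ξ : ℕ → (p : M) → TangentSpace 𝓘(ℝ, E) p)
    (m k : ℕ) (u : E) : E :=
  knightCoeff (fun i => along (vectorInChart x (ξ i))) m k (id : E → E) u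

variable {n m : ℕ} {Φ : ℝ → OpenPartialHomeomorph M M}
  {ξ : ℕ → (p : M) → TangentSpace 𝓘(ℝ, E) p}

theorem contDiffOn_familyCoeff [IsManifold 𝓘(ℝ, E) ∞ M] (hΦ : IsDiffeoFamily (E := E) n Φ)
    (x : M) {k : ℕ} (hk : k ≤ n) :
    ContDiffOn ℝ (n - k : ℕ) (familyCoeff x (fun t => Φ t) k) (extChartAt 𝓘(ℝ, E) x).target := by
  obtain ⟨O, hO, hc, hsub⟩ := hΦ.exists_contDiffOn_familyInChart x
  exact ((contDiffOn_iteratedDeriv_slice hO hc hk).mono hsub).const_smul _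

theorem familyInChart_expansion [IsManifold 𝓘(ℝ, E) ∞ M] (hΦ : IsDiffeoFamily (E := E) n Φ)
    {x : M} {u : E} (hu : u ∈ (extChartAt 𝓘(ℝ, E) x).target) {N : ℕ} (hN : N ≤ n) :
    (fun t : ℝ => familyInChart x (fun t => Φ t) (t, u) - ∑ k ∈ Finset.range (N + 1),
      t ^ k • familyCoeff x (fun t => Φ t) k u) =o[𝓝 0] fun t => t ^ N := by
  obtain ⟨O, hO, hc, hsub⟩ := hΦ.exists_contDiffOn_familyInChart x
  exact (time_taylor hO (hc.of_le (by exact_mod_cast hN)) (hsub hu)).comp_tendsto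
    (tendsto_mk_nhds_zero u)

theorem knightInChart_expansion [IsManifold 𝓘(ℝ, E) ∞ M] {φ : ℕ → ℝ → M → M}
    {D : ℕ → Set (ℝ × M)} (hφ : ∀ i, 1 ≤ i → i ≤ m → IsFlowOn (ξ i) (φ i) (D i)) {x : M}
    (hξ : ∀ i, 1 ≤ i → i ≤ m →
      ContDiffOn ℝ (n - i : ℕ) (vectorInChart x (ξ i)) (extChartAt 𝓘(ℝ, E) x).target)
    {u : E} (hu : u ∈ (extChartAt 𝓘(ℝ, E) x).target) {N : ℕ} (hN : N ≤ n) :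
    (fun t : ℝ => knight (fun i => flowInChart x (φ i)) m t u - ∑ k ∈ Finset.range (N + 1),
      t ^ k • knightCoeffInChart x ξ m k u) =o[𝓝 0] fun t => t ^ N :=
  (knight_expansion (G := id) (isOpen_extChartAt_target x) hξ
    (fun i h1 h2 => (hφ i h1 h2).isLocalFlowOn x) hN contDiff_id.contDiffOn hu).comp_tendsto
    (tendsto_mk_nhds_zero u)

/-- The leading term of the difference between a family and a knight that approximates it. -/
theorem leadingTerm_family_sub_knight [IsManifold 𝓘(ℝ, E) ∞ M]
    (hΦ : IsDiffeoFamily (E := E) n Φ) {φ : ℕ → ℝ → M → M}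
    {D : ℕ → Set (ℝ × M)} (hφ : ∀ i, 1 ≤ i → i ≤ m → IsFlowOn (ξ i) (φ i) (D i)) (hm : m + 1 ≤ n)
    {x : M} (hξ : ∀ i, 1 ≤ i → i ≤ m →
      ContDiffOn ℝ (n - i : ℕ) (vectorInChart x (ξ i)) (extChartAt 𝓘(ℝ, E) x).target)
    {u : E} (hu : u ∈ (extChartAt 𝓘(ℝ, E) x).target)
    (hcoeff : ∀ k ≤ m, familyCoeff x (fun t => Φ t) k u = knightCoeffInChart x ξ m k u) :
    (fun t : ℝ => familyInChart x (fun t => Φ t) (t, u) -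
      knight (fun i => flowInChart x (φ i)) m t u - t ^ (m + 1) •
        (familyCoeff x (fun t => Φ t) (m + 1) u - knightCoeffInChart x ξ m (m + 1) u))
      =o[𝓝 0] fun t => t ^ (m + 1) := by
  refine ((familyInChart_expansion hΦ hu hm).sub
    (knightInChart_expansion hφ hξ hu hm)).congr_left fun t => ?_
  rw [Finset.sum_range_succ _ (m + 1), Finset.sum_range_succ _ (m + 1),
    Finset.sum_congr rfl fun k hk => by rw [hcoeff k (by simpa [Nat.lt_succ_iff] using hk)],
    smul_sub]
  abel

theorem exists_flows [IsManifold 𝓘(ℝ, E) ∞ M] [CompleteSpace E] [T2Space M] (hm : m + 1 ≤ n)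
    (hξ : ∀ i, 1 ≤ i → i ≤ m → ContMDiff 𝓘(ℝ, E) (𝓘(ℝ, E).prod 𝓘(ℝ, E))
      ((n - i : ℕ) : WithTop ℕ∞) (fun p : M => (⟨p, ξ i p⟩ : TangentBundle 𝓘(ℝ, E) M))) :
    ∃ (φ : ℕ → ℝ → M → M) (D : ℕ → Set (ℝ × M)),
      ∀ i, 1 ≤ i → i ≤ m → IsFlowOn (ξ i) (φ i) (D i) := by
  have hflow : ∀ i, ∃ (φ : ℝ → M → M) (D : Set (ℝ × M)), 1 ≤ i → i ≤ m → IsFlowOn (ξ i) φ D := by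
    intro i
    by_cases hi : 1 ≤ i ∧ i ≤ m
    · obtain ⟨φ, D, h⟩ := exists_isFlowOn ((hξ i hi.1 hi.2).of_le (by norm_cast; omega))
      exact ⟨φ, D, fun _ _ => h⟩
    · exact ⟨fun _ q => q, univ, fun h1 h2 => absurd ⟨h1, h2⟩ hi⟩
  choose φ D hφ using hflow
  exact ⟨φ, D, hφ⟩

/-- The next generator of the approximating knight is independent of the chart. -/
theorem exists_vectorField_of_coeff [IsManifold 𝓘(ℝ, E) ∞ M] [CompleteSpace E] [T2Space M]
    (hΦ : IsDiffeoFamily (E := E) n Φ) (hm : m + 1 ≤ n)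
    (hξ : ∀ i, 1 ≤ i → i ≤ m → ContMDiff 𝓘(ℝ, E) (𝓘(ℝ, E).prod 𝓘(ℝ, E))
      ((n - i : ℕ) : WithTop ℕ∞) (fun p : M => (⟨p, ξ i p⟩ : TangentBundle 𝓘(ℝ, E) M)))
    (hcoeff : ∀ x : M, ∀ u ∈ (extChartAt 𝓘(ℝ, E) x).target, ∀ k ≤ m,
      familyCoeff x (fun t => Φ t) k u = knightCoeffInChart x ξ m k u) :
    ∃ η : (p : M) → TangentSpace 𝓘(ℝ, E) p, ∀ x : M, ∀ u ∈ (extChartAt 𝓘(ℝ, E) x).target,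
      vectorInChart x η u = (Nat.factorial (m + 1) : ℝ) •
        (familyCoeff x (fun t => Φ t) (m + 1) u - knightCoeffInChart x ξ m (m + 1) u) := by
  obtain ⟨φ, D, hφ⟩ := exists_flows (by omega) hξ
  set Y : M → E → E := fun x u =>
    familyCoeff x (fun t => Φ t) (m + 1) u - knightCoeffInChart x ξ m (m + 1) u with hY
  have hlead := fun (x : M) {u : E} hu => leadingTerm_family_sub_knight hΦ hφ hm (x := x)
    (fun i h1 h2 => contDiffOn_vectorInChart (hξ i h1 h2) x) (u := u) hu (hcoeff x u hu)
  have hφt : ∀ i, 1 ≤ i → i ≤ m → ∀ q : M,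
      Tendsto (fun z : ℝ × M => φ i z.1 z.2) (𝓝 (0, q)) (𝓝 q) :=
    fun i h1 h2 q => (hφ i h1 h2).tendsto q
  have htrans : ∀ {x y : M} {u : E}, u ∈ chartOverlap x y →
      Y y (chartTransition x y u) = fderiv ℝ (chartTransition x y) u (Y x u) := by
    intro x y u hu
    set q := (extChartAt 𝓘(ℝ, E) x).symm u with hq
    have hqx : q ∈ (extChartAt 𝓘(ℝ, E) x).source := (extChartAt 𝓘(ℝ, E) x).map_target hu.1
    have hqu : extChartAt 𝓘(ℝ, E) x q = u := (extChartAt 𝓘(ℝ, E) x).right_inv hu.1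
    have hΦq : Tendsto (fun t => Φ t q) (𝓝 0) (𝓝 q) :=
      (hΦ.tendsto q).comp (tendsto_mk_nhds_zero q)
    have hKq := tendsto_knight_manifold hφt q
    have hχ : Tendsto (extChartAt 𝓘(ℝ, E) x) (𝓝 q) (𝓝 u) := by
      have := (continuousAt_extChartAt' (I := 𝓘(ℝ, E)) hqx).tendsto
      rwa [hqu] at this
    have hsrc := (isOpen_extChartAt_source (I := 𝓘(ℝ, E)) x).mem_nhds hqx
    have hs : HasStrictFDerivAt (chartTransition x y) (fderiv ℝ (chartTransition x y) u) u :=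
      (contDiffAt_chartTransition (n := 1) hu).hasStrictFDerivAt one_ne_zero
    have h1 := hlead x hu.1
    have h2 := hlead y (mapsTo_chartTransition x y hu)
    have hKx := eventually_extChartAt_knight (E := E) hφt hqx
    have hKy := eventually_extChartAt_knight (E := E) hφt (x := y) (q := q) hu.2
    rw [hqu] at hKx
    have h1' : (fun t : ℝ => extChartAt 𝓘(ℝ, E) x (Φ t q) -
        extChartAt 𝓘(ℝ, E) x (knight φ m t q) - t ^ (m + 1) • Y x u) =o[𝓝 0]
          fun t => t ^ (m + 1) := by
      refine h1.congr' ?_ EventuallyEq.rfl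
      filter_upwards [hKx] with t ht
      rw [ht]; rfl
    have h2' : (fun t : ℝ => extChartAt 𝓘(ℝ, E) y (Φ t q) -
        extChartAt 𝓘(ℝ, E) y (knight φ m t q) - t ^ (m + 1) • Y y (chartTransition x y u)) =o[𝓝 0]
          fun t => t ^ (m + 1) := by
      refine h2.congr' ?_ EventuallyEq.rfl
      filter_upwards [hKy] with t ht
      rw [ht, familyInChart, symm_chartTransition hu]; rfl
    refine eq_of_sub_pow_smul_isLittleO h2' ?_
    refine (leadingTerm_comp hs (hχ.comp hΦq) (hχ.comp hKq) h1').congr' ?_ EventuallyEq.rfl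
    filter_upwards [hΦq.eventually hsrc, hKq.eventually hsrc] with t ht1 ht2
    simp only [Function.comp_apply, chartTransition, (extChartAt 𝓘(ℝ, E) x).left_inv ht1,
      (extChartAt 𝓘(ℝ, E) x).left_inv ht2]
  refine ⟨fun q => (mfderiv 𝓘(ℝ, E) 𝓘(ℝ, E) (extChartAt 𝓘(ℝ, E) q) q).inverse
    ((Nat.factorial (m + 1) : ℝ) • Y q (extChartAt 𝓘(ℝ, E) q q) : E), fun x u hu => ?_⟩
  have hov := mem_chartOverlap_of_mem_target hu
  set q := (extChartAt 𝓘(ℝ, E) x).symm u with hq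
  have hg : chartTransition x q u = extChartAt 𝓘(ℝ, E) q q := rfl
  have e : ((mfderiv 𝓘(ℝ, E) 𝓘(ℝ, E) (extChartAt 𝓘(ℝ, E) q) q) : E →L[ℝ] E)
      (((mfderiv 𝓘(ℝ, E) 𝓘(ℝ, E) (extChartAt 𝓘(ℝ, E) q) q) : E →L[ℝ] E).inverse
        ((Nat.factorial (m + 1) : ℝ) • Y q (extChartAt 𝓘(ℝ, E) q q))) =
      fderiv ℝ (chartTransition x q) u ((Nat.factorial (m + 1) : ℝ) • Y x u) := by
    rw [map_smul (fderiv ℝ (chartTransition x q) u), ← htrans hov, hg]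
    exact ContinuousLinearMap.IsInvertible.self_apply_inverse
      (isInvertible_mfderiv_extChartAt (I := 𝓘(ℝ, E)) (mem_extChartAt_source q)) _
  rw [vectorInChart_eq_inverse hov, hg, ← mfderiv_extChartAt_apply (mem_extChartAt_source q)]
  exact (congrArg _ e).trans ((isInvertible_fderiv_chartTransition hov).inverse_apply_self _)

/-- There are vector fields whose knights approximate a given one-parameter family. -/
theorem exists_vectorFields_of_family [IsManifold 𝓘(ℝ, E) ∞ M] [CompleteSpace E] [T2Space M]
    (hΦ : IsDiffeoFamily (E := E) n Φ) (hm : m + 1 ≤ n) :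
    ∃ ξ : ℕ → (p : M) → TangentSpace 𝓘(ℝ, E) p,
      (∀ i, 1 ≤ i → i ≤ m → ContMDiff 𝓘(ℝ, E) (𝓘(ℝ, E).prod 𝓘(ℝ, E))
        ((n - i : ℕ) : WithTop ℕ∞) (fun p : M => (⟨p, ξ i p⟩ : TangentBundle 𝓘(ℝ, E) M))) ∧
      ∀ x : M, ∀ u ∈ (extChartAt 𝓘(ℝ, E) x).target, ∀ k ≤ m,
        familyCoeff x (fun t => Φ t) k u = knightCoeffInChart x ξ m k u := by
  induction m with
  | zero =>
    refine ⟨fun _ _ => 0, fun i h1 h2 => by omega, fun x u hu k hk => ?_⟩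
    obtain rfl : k = 0 := by omega
    simpa [familyCoeff, knightCoeffInChart, knightCoeff, familyInChart, hΦ.map_zero]
      using (extChartAt 𝓘(ℝ, E) x).right_inv hu
  | succ m ih =>
    obtain ⟨ξ, hξ, hcoeff⟩ := ih (by omega)
    obtain ⟨η, hη⟩ := exists_vectorField_of_coeff hΦ (by omega) hξ hcoeff
    have hlt : ∀ i, i ≤ m → Function.update ξ (m + 1) η i = ξ i :=
      fun i hi => Function.update_of_ne (by omega) _ _
    have hc : ∀ x k u, knightCoeffInChart x (Function.update ξ (m + 1) η) m k u =
        knightCoeffInChart x ξ m k u := fun x k u =>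
      congrFun (knightCoeff_congr (fun i h1 h2 => by rw [hlt i h2]) k _) u
    refine ⟨Function.update ξ (m + 1) η, fun i h1 h2 => ?_, fun x u hu k hk => ?_⟩
    · rcases Nat.lt_or_ge m i with h | h
      · obtain rfl : i = m + 1 := by omega
        rw [Function.update_self]
        refine contMDiff_of_contDiffOn_vectorInChart fun x => ContDiffOn.congr ?_ (hη x)
        refine ((contDiffOn_familyCoeff hΦ x (by omega)).sub ?_).const_smul _
        exact contDiffOn_knightCoeff (isOpen_extChartAt_target x)
          (fun i h1 h2 => contDiffOn_vectorInChart (hξ i h1 h2) x) le_rfl contDiff_id.contDiffOn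
          (by omega)
      · rw [hlt i h]
        exact hξ i h1 h
    · rcases Nat.lt_or_ge m k with h | h
      · obtain rfl : k = m + 1 := by omega
        have h1 : knightCoeffInChart x (Function.update ξ (m + 1) η) (m + 1) (m + 1) u =
            knightCoeffInChart x (Function.update ξ (m + 1) η) m (m + 1) u +
              (1 / (Nat.factorial (m + 1) : ℝ)) • vectorInChart x η u := by
          rw [knightCoeffInChart, knightCoeff_succ_self]
          simp [along, knightCoeffInChart]
        rw [h1, hc, hη x u hu, smul_smul, one_div_mul_cancel (by positivity), one_smul]
        abel
      · rw [hcoeff x u hu k h, ← hc]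
        exact (congrFun (knightCoeff_succ_of_le _ h _) u).symm

/-- A function along a family and along a knight with the same coefficients. -/
theorem isBigO_family_sub_knight [IsManifold 𝓘(ℝ, E) ∞ M] (hn : 1 ≤ n)
    (hΦ : IsDiffeoFamily (E := E) n Φ) {φ : ℕ → ℝ → M → M}
    {D : ℕ → Set (ℝ × M)} (hφ : ∀ i, 1 ≤ i → i ≤ n - 1 → IsFlowOn (ξ i) (φ i) (D i)) {q : M}
    (hξ : ∀ i, 1 ≤ i → i ≤ n - 1 →
      ContDiffOn ℝ (n - i : ℕ) (vectorInChart q (ξ i)) (extChartAt 𝓘(ℝ, E) q).target)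
    (hcoeff : ∀ k ≤ n - 1, familyCoeff q (fun t => Φ t) k (extChartAt 𝓘(ℝ, E) q q) =
      knightCoeffInChart q ξ (n - 1) k (extChartAt 𝓘(ℝ, E) q q))
    {f : M → ℝ} (hf : ContMDiff 𝓘(ℝ, E) 𝓘(ℝ, ℝ) n f) :
    (fun t : ℝ => f (Φ t q) - f (knight φ (n - 1) t q)) =O[𝓝 0] fun t : ℝ => t ^ n := by
  set u := extChartAt 𝓘(ℝ, E) q q with hu
  have hut := mem_extChartAt_target (I := 𝓘(ℝ, E)) q
  have hφt : ∀ i, 1 ≤ i → i ≤ n - 1 → ∀ q : M,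
      Tendsto (fun z : ℝ × M => φ i z.1 z.2) (𝓝 (0, q)) (𝓝 q) :=
    fun i h1 h2 q => (hφ i h1 h2).tendsto q
  have hU := isOpen_extChartAt_target (I := 𝓘(ℝ, E)) q
  set G : E → ℝ := f ∘ (extChartAt 𝓘(ℝ, E) q).symm with hG
  have hGc : ContDiffOn ℝ n G (extChartAt 𝓘(ℝ, E) q).target := fun v hv =>
    ((hf _).comp v (contMDiffAt_extChartAt_symm hv)).contDiffAt.contDiffWithinAt
  obtain ⟨O, hO, hc, hsub⟩ := hΦ.exists_contDiffOn_familyInChart q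
  set O' := O ∩ familyInChart q (fun t => Φ t) ⁻¹' (extChartAt 𝓘(ℝ, E) q).target
  have hO' : IsOpen O' := hc.continuousOn.isOpen_inter_preimage hO hU
  have hF0 : familyInChart q (fun t => Φ t) (0, u) = u := by
    simp [familyInChart, hu, hΦ.map_zero]
  have e1 := (time_taylor hO' (H := G ∘ familyInChart q fun t => Φ t)
    (hGc.comp (hc.mono inter_subset_left) fun z hz => hz.2) (u₀ := u)
    ⟨hsub hut, by simp only [mem_preimage, hF0]; exact hut⟩).comp_tendsto (tendsto_mk_nhds_zero u)
  have e2 := (knight_expansion hU hξ (fun i h1 h2 => (hφ i h1 h2).isLocalFlowOn q)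
    le_rfl hGc hut).comp_tendsto (tendsto_mk_nhds_zero u)
  have hΦq : Tendsto (fun t => Φ t q) (𝓝 0) (𝓝 q) :=
    (hΦ.tendsto q).comp (tendsto_mk_nhds_zero q)
  have hKq := tendsto_knight_manifold hφt q
  have hsrc := (isOpen_extChartAt_source (I := 𝓘(ℝ, E)) q).mem_nhds (mem_extChartAt_source q)
  have hq : (extChartAt 𝓘(ℝ, E) q).symm u = q := extChartAt_to_inv q
  have hKx := eventually_extChartAt_knight (E := E) hφt (mem_extChartAt_source q)
  have eqΦ : ∀ᶠ t in 𝓝 (0 : ℝ), G (familyInChart q (fun t => Φ t) (t, u)) = f (Φ t q) := by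
    filter_upwards [hΦq.eventually hsrc] with t ht
    simp only [hG, Function.comp_apply, familyInChart, hq, (extChartAt 𝓘(ℝ, E) q).left_inv ht]
  have eqK : ∀ᶠ t in 𝓝 (0 : ℝ), G (knight (fun i => flowInChart q (φ i)) (n - 1) t u) =
      f (knight φ (n - 1) t q) := by
    filter_upwards [hKx, hKq.eventually hsrc] with t ht ht'
    rw [← ht]
    simp only [hG, Function.comp_apply, (extChartAt 𝓘(ℝ, E) q).left_inv ht']
  have h1 : (fun t : ℝ => familyInChart q (fun t => Φ t) (t, u) -
      knight (fun i => flowInChart q (φ i)) (n - 1) t u) =o[𝓝 0] fun t => t ^ (n - 1) := by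
    refine ((familyInChart_expansion hΦ hut (N := n - 1) (by omega)).sub
      (knightInChart_expansion hφ hξ hut (by omega))).congr_left fun t => ?_
    rw [Finset.sum_congr rfl fun k hk => by
      rw [hcoeff k (by simpa [Nat.lt_succ_iff] using hk)], sub_sub_sub_cancel_right]
  have hFt : Tendsto (fun t : ℝ => familyInChart q (fun t => Φ t) (t, u)) (𝓝 0) (𝓝 u) := by
    have := (hc.continuousOn.continuousAt (hO.mem_nhds (hsub hut))).tendsto.comp
      (tendsto_mk_nhds_zero u)
    rwa [hF0] at this
  have hKt : Tendsto (fun t : ℝ => knight (fun i => flowInChart q (φ i)) (n - 1) t u) (𝓝 0)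
      (𝓝 u) := (tendsto_knight (fun i h1 h2 => (hφ i h1 h2).isLocalFlowOn q) hut).comp
    (tendsto_mk_nhds_zero u)
  have h2 := (isBigO_sub_of_contDiffAt ((hGc.contDiffAt (hU.mem_nhds hut)).of_le
    (by exact_mod_cast hn)) hFt hKt).trans_isLittleO h1
  obtain ⟨N, rfl⟩ : ∃ N, n = N + 1 := ⟨n - 1, by omega⟩
  refine (isBigO_pow_of_expansion (c := fun k => (1 / (Nat.factorial k : ℝ)) •
    iteratedDeriv k (fun t => (G ∘ familyInChart q fun t => Φ t) (t, u)) 0 -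
    knightCoeff (fun i => along (vectorInChart q (ξ i))) N k G u) ?_ h2).congr' ?_ EventuallyEq.rfl
  · refine (e1.sub e2).congr_left fun t => ?_
    simp only [Function.comp_apply, smul_sub, Finset.sum_sub_distrib, Nat.add_sub_cancel]
    abel
  · filter_upwards [eqΦ, eqK] with t h1 h2
    rw [h1, h2]

/-- Every one-parameter family of diffeomorphisms is approximated by a knight. -/
theorem exists_generatesApproximatingKnight [IsManifold 𝓘(ℝ, E) ∞ M] [CompleteSpace E] [T2Space M]
    (hn : 1 ≤ n) (hΦ : IsDiffeoFamily (E := E) n Φ) :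
    ∃ ξ : ℕ → (p : M) → TangentSpace 𝓘(ℝ, E) p, GeneratesApproximatingKnight n Φ ξ := by
  obtain ⟨ξ, hξ, hcoeff⟩ := exists_vectorFields_of_family (m := n - 1) hΦ (by omega)
  obtain ⟨φ, D, hφ⟩ := exists_flows (by omega) hξ
  exact ⟨ξ, fun l h1 h2 => hξ l h1 (by omega), φ, D, fun l h1 h2 => hφ l h1 (by omega),
    fun f hf p => isBigO_family_sub_knight hn hΦ hφ
      (fun i h1 h2 => contDiffOn_vectorInChart (hξ i h1 h2) p)
      (hcoeff p _ (mem_extChartAt_target p)) hf⟩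

end Approximation

section Perturbations

variable {r s : ℕ}
variable {E : Type*} [NormedAddCommGroup E] [NormedSpace ℝ E]
variable {M : Type*} [TopologicalSpace M] [ChartedSpace E M]

theorem mfderiv_extChartAt_symm_self [IsManifold 𝓘(ℝ, E) 1 M] (p : M) :
    mfderiv 𝓘(ℝ, E) 𝓘(ℝ, E) (extChartAt 𝓘(ℝ, E) p).symm (extChartAt 𝓘(ℝ, E) p p) =
      ContinuousLinearMap.id ℝ E := by
  rw [(mdifferentiableAt_extChartAt_symm (mem_extChartAt_target p)).mfderiv]
  simp only [modelWithCornersSelf_coe, range_id, fderivWithin_univ]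
  have h : writtenInExtChartAt 𝓘(ℝ, E) 𝓘(ℝ, E) (extChartAt 𝓘(ℝ, E) p p)
      (extChartAt 𝓘(ℝ, E) p).symm =ᶠ[𝓝 (extChartAt 𝓘(ℝ, E) p p)] id := by
    filter_upwards [(isOpen_extChartAt_target (I := 𝓘(ℝ, E)) p).mem_nhds (mem_extChartAt_target p)]
      with u hu
    have := (extChartAt 𝓘(ℝ, E) p).right_inv hu
    simpa only [writtenInExtChartAt, extChartAt_to_inv, extChartAt_model_space_eq_id,
      PartialEquiv.refl_symm, PartialEquiv.refl_coe, Function.comp_apply, id] using this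
  exact (h.fderiv_eq).trans fderiv_id

theorem tensorInChart_extChartAt_self [IsManifold 𝓘(ℝ, E) 1 M] (p : M) (T : M → Tensor r s E) :
    tensorInChart p T (extChartAt 𝓘(ℝ, E) p p) = T p := by
  have h : tensorInChart p T (extChartAt 𝓘(ℝ, E) p p) = Tensor.pullback (V := E) (W := E)
      (ContinuousLinearMap.id ℝ E) (T ((extChartAt 𝓘(ℝ, E) p).symm (extChartAt 𝓘(ℝ, E) p p))) := by
    rw [← mfderiv_extChartAt_symm_self p]; rfl
  rw [h, extChartAt_to_inv]
  exact Tensor.pullback_id _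

section Family

variable {n : ℕ} {Φ : ℝ → OpenPartialHomeomorph M M} (hΦ : IsDiffeoFamily (E := E) n Φ)
include hΦ

theorem IsDiffeoFamily.mdifferentiableAt (hn : 1 ≤ n) {t : ℝ} {p : M} (hp : p ∈ (Φ t).source) :
    MDifferentiableAt 𝓘(ℝ, E) 𝓘(ℝ, E) (Φ t) p := by
  have h1 := (hΦ.contMDiffOn.contMDiffAt (x := (t, p)) (hΦ.isOpen_domain.mem_nhds hp)).comp p
    (ContMDiffAt.prodMk (contMDiffAt_const (c := t)) contMDiffAt_id)
  exact h1.mdifferentiableAt (by norm_cast; omega)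

theorem IsDiffeoFamily.isInvertible_mfderiv (hn : 1 ≤ n) {t : ℝ} {p : M}
    (hp : p ∈ (Φ t).source) : (mfderiv 𝓘(ℝ, E) 𝓘(ℝ, E) (Φ t) p).IsInvertible := by
  have hp' := (Φ t).map_source hp
  have h1 := hΦ.mdifferentiableAt hn hp
  have h2 : MDifferentiableAt 𝓘(ℝ, E) 𝓘(ℝ, E) (Φ t).symm (Φ t p) :=
    ((hΦ.contMDiffOn_symm t).contMDiffAt ((Φ t).open_target.mem_nhds hp')).mdifferentiableAt
      (by norm_cast; omega)
  have h1' : MDifferentiableAt 𝓘(ℝ, E) 𝓘(ℝ, E) (Φ t) ((Φ t).symm (Φ t p)) := by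
    rwa [(Φ t).left_inv hp]
  have e1 := mfderiv_comp p h2 h1
  have e2 := mfderiv_comp (Φ t p) h1' h2
  have i1 : (Φ t).symm ∘ Φ t =ᶠ[𝓝 p] id := (Φ t).eventually_left_inverse hp
  have i2 : Φ t ∘ (Φ t).symm =ᶠ[𝓝 (Φ t p)] id := (Φ t).eventually_right_inverse hp'
  rw [i1.mfderiv_eq, mfderiv_id] at e1
  rw [i2.mfderiv_eq, mfderiv_id, (Φ t).left_inv hp] at e2
  exact ContinuousLinearMap.IsInvertible.of_inverse (M := E) (M₂ := E) e2.symm e1.symm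

/-- The pull-back along a one-parameter family, computed in a chart. -/
theorem IsDiffeoFamily.pullback_tensorInChart [IsManifold 𝓘(ℝ, E) 1 M] (hn : 1 ≤ n) {t : ℝ} {p : M}
    (hp : p ∈ (Φ t).source) (hp' : Φ t p ∈ (extChartAt 𝓘(ℝ, E) p).source) (T : M → Tensor r s E) :
    (tensorInChart p T (familyInChart p (fun t => Φ t) (t, extChartAt 𝓘(ℝ, E) p p))).pullback
      (fderiv ℝ (fun v => familyInChart p (fun t => Φ t) (t, v)) (extChartAt 𝓘(ℝ, E) p p)) =
      pullbackField (Φ t) T p := by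
  set u := extChartAt 𝓘(ℝ, E) p p with hu
  have hut := mem_extChartAt_target (I := 𝓘(ℝ, E)) p
  have hup : (extChartAt 𝓘(ℝ, E) p).symm u = p := extChartAt_to_inv p
  set χ := extChartAt 𝓘(ℝ, E) p with hχ
  have d1 : MDifferentiableAt 𝓘(ℝ, E) 𝓘(ℝ, E) χ.symm u := mdifferentiableAt_extChartAt_symm hut
  have d2 : MDifferentiableAt 𝓘(ℝ, E) 𝓘(ℝ, E) (Φ t) (χ.symm u) :=
    hΦ.mdifferentiableAt hn (by rwa [hup])
  have d3 : MDifferentiableAt 𝓘(ℝ, E) 𝓘(ℝ, E) χ (Φ t (χ.symm u)) :=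
    mdifferentiableAt_extChartAt (by rw [hup]; rwa [hχ, extChartAt_source] at hp')
  have v1 := isInvertible_mfderiv_extChartAt_symm (E := E) hut
  have v2 : (mfderiv 𝓘(ℝ, E) 𝓘(ℝ, E) (Φ t) (χ.symm u)).IsInvertible :=
    hΦ.isInvertible_mfderiv hn (by rwa [hup])
  have v3 : (mfderiv 𝓘(ℝ, E) 𝓘(ℝ, E) χ (Φ t (χ.symm u))).IsInvertible :=
    isInvertible_mfderiv_extChartAt (by rwa [hup])
  have d12 := d2.comp u d1
  have v12 : (mfderiv 𝓘(ℝ, E) 𝓘(ℝ, E) (Φ t ∘ χ.symm) u).IsInvertible := by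
    rw [mfderiv_comp u d2 d1]; exact v2.comp v1
  have v123 : (mfderiv 𝓘(ℝ, E) 𝓘(ℝ, E) (χ ∘ (Φ t ∘ χ.symm)) u).IsInvertible := by
    rw [mfderiv_comp u d3 d12]; exact v3.comp v12
  have hF : (fun v => familyInChart p (fun t => Φ t) (t, v)) = χ ∘ (Φ t ∘ χ.symm) := rfl
  have heq : χ.symm ∘ (χ ∘ (Φ t ∘ χ.symm)) =ᶠ[𝓝 u] Φ t ∘ χ.symm := by
    have hc : Tendsto (Φ t ∘ χ.symm) (𝓝 u) (𝓝 (Φ t p)) := by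
      have := d12.continuousAt.tendsto
      rwa [Function.comp_apply, hup] at this
    filter_upwards [hc.eventually ((isOpen_extChartAt_source p).mem_nhds hp')] with v hv
      using χ.left_inv hv
  calc _ = pullbackField (fun v => familyInChart p (fun t => Φ t) (t, v)) (tensorInChart p T) u :=
        (pullbackField_eq_pullback_fderiv _ _ _).symm
    _ = pullbackField (χ.symm ∘ (χ ∘ (Φ t ∘ χ.symm))) T u := by
        rw [hF, pullbackField_comp (d3.comp u d12) (mdifferentiableAt_extChartAt_symm
          (χ.map_source (by simpa only [Function.comp_apply, hup] using hp'))) v123]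
        rfl
    _ = tensorInChart p (pullbackField (Φ t) T) u := by
        rw [pullbackField_congr heq, pullbackField_comp d1 d2 v1]; rfl
    _ = _ := tensorInChart_extChartAt_self p _

end Family

theorem exists_contMDiff_eventuallyEq_extChartAt [FiniteDimensional ℝ E] [T2Space M]
    [IsManifold 𝓘(ℝ, E) ∞ M] (q : M) (ℓ : E →L[ℝ] ℝ) :
    ∃ f : M → ℝ, ContMDiff 𝓘(ℝ, E) 𝓘(ℝ, ℝ) ∞ f ∧
      ∀ᶠ q' in 𝓝 q, f q' = ℓ (extChartAt 𝓘(ℝ, E) q q') := by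
  obtain ⟨b⟩ : Nonempty (SmoothBumpFunction 𝓘(ℝ, E) q) := inferInstance
  refine ⟨fun q' => b q' • ℓ (extChartAt 𝓘(ℝ, E) q q'), b.contMDiff_smul ?_, ?_⟩
  · exact ℓ.contDiff.contMDiff.comp_contMDiffOn contMDiffOn_extChartAt
  · filter_upwards [b.eventuallyEq_one] with q' h
    simp [h]

theorem isBigO_extChartAt_of_forall [FiniteDimensional ℝ E] [T2Space M] [IsManifold 𝓘(ℝ, E) ∞ M]
    {n N : ℕ} {q : M} {a b : ℝ → M} (ha : Tendsto a (𝓝 0) (𝓝 q)) (hb : Tendsto b (𝓝 0) (𝓝 q))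
    (h : ∀ f : M → ℝ, ContMDiff 𝓘(ℝ, E) 𝓘(ℝ, ℝ) n f →
      (fun t : ℝ => f (a t) - f (b t)) =O[𝓝 0] fun t : ℝ => t ^ N) :
    (fun t : ℝ => extChartAt 𝓘(ℝ, E) q (a t) - extChartAt 𝓘(ℝ, E) q (b t)) =O[𝓝 0]
      fun t : ℝ => t ^ N := by
  let L := (Module.finBasis ℝ E).equivFunL
  refine (L.isBigO_comp_rev _ _).trans (isBigO_pi.2 fun i => ?_)
  obtain ⟨f, hf, hfe⟩ := exists_contMDiff_eventuallyEq_extChartAt q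
    ((ContinuousLinearMap.proj (R := ℝ) (φ := fun _ => ℝ) i).comp (L : E →L[ℝ] _))
  refine (h f (hf.of_le (by exact_mod_cast le_top))).congr' ?_ EventuallyEq.rfl
  filter_upwards [ha.eventually hfe, hb.eventually hfe] with t h1 h2
  simp [h1, h2]

/-- An approximating knight approximates the family in the charts of the manifold. -/
theorem GeneratesApproximatingKnight.isLittleO_chart [FiniteDimensional ℝ E] [T2Space M]
    [IsManifold 𝓘(ℝ, E) ∞ M] {n : ℕ} (hn : 1 ≤ n) {Φ : ℝ → OpenPartialHomeomorph M M}
    (hΦ : IsDiffeoFamily (E := E) n Φ) {φ : ℕ → ℝ → M → M}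
    (hφ : ∀ i, 1 ≤ i → i ≤ n - 1 → ∀ q : M,
      Tendsto (fun z : ℝ × M => φ i z.1 z.2) (𝓝 (0, q)) (𝓝 q))
    (h : ∀ f : M → ℝ, ContMDiff 𝓘(ℝ, E) 𝓘(ℝ, ℝ) n f → ∀ p : M,
      (fun t : ℝ => f (Φ t p) - f (knight φ (n - 1) t p)) =O[𝓝 0] (fun t : ℝ => t ^ n))
    {x : M} {u : E} (hu : u ∈ (extChartAt 𝓘(ℝ, E) x).target) :
    (fun t : ℝ => familyInChart x (fun t => Φ t) (t, u) -
      knight (fun i => flowInChart x (φ i)) (n - 1) t u) =o[𝓝 0] fun t => t ^ (n - 1) := by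
  set q := (extChartAt 𝓘(ℝ, E) x).symm u with hq
  have hqx : q ∈ (extChartAt 𝓘(ℝ, E) x).source := (extChartAt 𝓘(ℝ, E) x).map_target hu
  have hqu : extChartAt 𝓘(ℝ, E) x q = u := (extChartAt 𝓘(ℝ, E) x).right_inv hu
  have hΦq : Tendsto (fun t => Φ t q) (𝓝 0) (𝓝 q) :=
    (hΦ.tendsto q).comp (tendsto_mk_nhds_zero q)
  have hKq := tendsto_knight_manifold hφ q
  have h1 := isBigO_extChartAt_of_forall hΦq hKq fun f hf => h f hf q
  have hov : extChartAt 𝓘(ℝ, E) q q ∈ chartOverlap q x :=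
    ⟨mem_extChartAt_target q, by rw [mem_preimage, extChartAt_to_inv]; exact hqx⟩
  have hχ := (continuousAt_extChartAt (I := 𝓘(ℝ, E)) q).tendsto
  have h2 := (isBigO_sub_of_contDiffAt (contDiffAt_chartTransition (n := 1) hov)
    (hχ.comp hΦq) (hχ.comp hKq)).trans h1
  have hsrc := (isOpen_extChartAt_source (I := 𝓘(ℝ, E)) q).mem_nhds (mem_extChartAt_source q)
  have hKx := eventually_extChartAt_knight (E := E) hφ hqx
  rw [hqu] at hKx
  refine IsBigO.trans_isLittleO (h2.congr' ?_ EventuallyEq.rfl)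
    (isLittleO_pow_pow_of_lt tendsto_id (by omega))
  filter_upwards [hΦq.eventually hsrc, hKq.eventually hsrc, hKx] with t h1 h2 h3
  rw [← h3]
  simp only [Function.comp_apply, chartTransition, (extChartAt 𝓘(ℝ, E) q).left_inv h1,
    (extChartAt 𝓘(ℝ, E) q).left_inv h2]
  rfl

/-- The domain, in the preferred chart at `x`, of a family of tensor fields. -/
def domainInChart (x : M) (D : Set (ℝ × M)) : Set (ℝ × E) :=
  {z | z.2 ∈ (extChartAt 𝓘(ℝ, E) x).target ∧ (z.1, (extChartAt 𝓘(ℝ, E) x).symm z.2) ∈ D}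

theorem isOpen_domainInChart {D : Set (ℝ × M)} (hD : IsOpen D) (x : M) :
    IsOpen (domainInChart (E := E) x D) := by
  have hV : IsOpen (Prod.snd ⁻¹' (extChartAt 𝓘(ℝ, E) x).target : Set (ℝ × E)) :=
    (isOpen_extChartAt_target x).preimage continuous_snd
  exact ContinuousOn.isOpen_inter_preimage (continuousOn_fst.prodMk
    ((continuousOn_extChartAt_symm x).comp continuousOn_snd fun z hz => hz)) hV hD

theorem ContDiffTensorFamilyOn.contDiffAt [IsManifold 𝓘(ℝ, E) 1 M] {n : ℕ}
    {S : ℝ → M → Tensor r s E} {D : Set (ℝ × M)} (hS : ContDiffTensorFamilyOn n S D)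
    (hD : IsOpen D) {t : ℝ} {q : M} (hq : (t, q) ∈ D) : ContDiffAt ℝ n (fun t => S t q) t := by
  have h1 := (hS q).contDiffAt ((isOpen_domainInChart hD q).mem_nhds
    (x := (t, extChartAt 𝓘(ℝ, E) q q)) ⟨mem_extChartAt_target q, by rwa [extChartAt_to_inv]⟩)
  have h2 := h1.comp t (contDiffAt_id.prodMk (contDiffAt_const (c := extChartAt 𝓘(ℝ, E) q q)))
  simpa only [Function.comp_def, tensorInChart_extChartAt_self, id] using h2

theorem tensorInChart_iteratedDeriv [IsManifold 𝓘(ℝ, E) 1 M] {n k : ℕ} {S : ℝ → M → Tensor r s E}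
    {D : Set (ℝ × M)} (hS : ContDiffTensorFamilyOn n S D) (hD : IsOpen D)
    (hD0 : ∀ q, ((0 : ℝ), q) ∈ D) (hk : k ≤ n) (x : M) (u : E) :
    tensorInChart x (fun q => iteratedDeriv k (fun t => S t q) 0) u =
      iteratedDeriv k (fun t => tensorInChart x (S t) u) 0 := by
  have h1 := hS.contDiffAt hD (hD0 ((extChartAt 𝓘(ℝ, E) x).symm u))
  set L := Tensor.pullbackL (r := r) (s := s) (V := E) (W := E)
    (mfderiv 𝓘(ℝ, E) 𝓘(ℝ, E) (extChartAt 𝓘(ℝ, E) x).symm u) with hL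
  have h2 : (fun t => tensorInChart x (S t) u) =
      L ∘ fun t => S t ((extChartAt 𝓘(ℝ, E) x).symm u) := rfl
  rw [h2, iteratedDeriv_eq_iteratedFDeriv,
    L.iteratedFDeriv_comp_left h1 (by exact_mod_cast hk)]
  exact congrArg L iteratedDeriv_eq_iteratedFDeriv

theorem contDiffOn_tensorInChart_iteratedDeriv [IsManifold 𝓘(ℝ, E) 1 M] {n k : ℕ}
    {S : ℝ → M → Tensor r s E} {D : Set (ℝ × M)} (hS : ContDiffTensorFamilyOn n S D)
    (hD : IsOpen D) (hD0 : ∀ q, ((0 : ℝ), q) ∈ D) (hk : k ≤ n) (x : M) :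
    ContDiffOn ℝ (n - k : ℕ) (tensorInChart x (fun q => iteratedDeriv k (fun t => S t q) 0))
      (extChartAt 𝓘(ℝ, E) x).target := by
  refine ContDiffOn.congr ((contDiffOn_iteratedDeriv_slice (isOpen_domainInChart hD x) (hS x)
    hk).mono ?_) fun u hu => tensorInChart_iteratedDeriv hS hD hD0 hk x u
  exact fun u hu => ⟨hu, hD0 _⟩

theorem knightCoeff_lieDerivativeSpace_congr {X : ℕ → E → E} {m k : ℕ} {S S' : E → Tensor r s E}
    {U : Set E} (hU : IsOpen U) (h : EqOn S S' U) :
    EqOn (knightCoeff (fun i => lieDerivativeSpace (X i)) m k S)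
      (knightCoeff (fun i => lieDerivativeSpace (X i)) m k S') U := by
  refine knightCoeff_rel (L := fun i => lieDerivativeSpace (r := r) (s := s) (X i))
    (L' := fun i => lieDerivativeSpace (r := r) (s := s) (X i)) (R := fun _ S S' => EqOn S S' U)
    ?_ ?_ ?_ ?_ ?_ (le_refl k) h
  · exact fun _ _ _ _ => eqOn_refl _ _
  · exact fun d a a' b b' h h' u hu => by simp [h hu, h' hu]
  · exact fun d c a a' h u hu => by simp [h hu]
  · exact fun d e a a' _ h => h
  · intro i d a a' _ _ _ h u hu
    rw [lieDerivativeSpace, lieDerivativeSpace, h hu,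
      (h.eventuallyEq_of_mem (hU.mem_nhds hu)).fderiv_eq]

theorem perturbationOrder_eq_iteratedDeriv {n : ℕ} {φ : ℝ → OpenPartialHomeomorph M M}
    (hφ : IsDiffeoFamily (E := E) n φ) (T : ℝ → M → Tensor r s E) (k : ℕ) :
    perturbationOrder T φ k = fun q => iteratedDeriv k (fun t => pullbackField (φ t) (T t) q) 0 := by
  funext q
  cases k with
  | zero =>
    rw [perturbationOrder, iteratedDeriv_zero,
      pullbackField_eq_of_eventuallyEq_id (Eventually.of_forall hφ.map_zero)]
  | succ k =>
    rw [perturbationOrder, iteratedDeriv_succ', iteratedDeriv_succ']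
    simp only [perturbation, deriv_sub_const_fun]

theorem sum_iteratedLie_eq_knightCoeff (ξ : ℕ → (p : M) → TangentSpace 𝓘(ℝ, E) p) (k l : ℕ)
    (S : M → Tensor r s E) (p : M) :
    ∑ j ∈ weightedIndices k l, (1 / ∏ i : Fin k,
      ((Nat.factorial ((i : ℕ) + 1) : ℝ) ^ j i * (Nat.factorial (j i) : ℝ))) • iteratedLie ξ j S p =
      knightCoeff (fun i => lieDerivative (ξ i)) k l S p := by
  rw [← sum_weightedIndices_eq_knightCoeff, Finset.sum_apply]
  rfl

/-- The pull-back in the second gauge is obtained from that in the first by the change of gauge. -/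
theorem pullbackField_gaugeChange {n : ℕ} (hn : 1 ≤ n) {φ ψ : ℝ → OpenPartialHomeomorph M M}
    (hφ : IsDiffeoFamily (E := E) 1 φ) (hΦ : IsDiffeoFamily (E := E) n (gaugeChange φ ψ)) {t : ℝ}
    {p : M} (hp : p ∈ (gaugeChange φ ψ t).source) (T : M → Tensor r s E) :
    pullbackField (ψ t) T p = pullbackField (gaugeChange φ ψ t) (pullbackField (φ t) T) p := by
  have h1 : ψ t =ᶠ[𝓝 p] φ t ∘ gaugeChange φ ψ t := by
    filter_upwards [(gaugeChange φ ψ t).open_source.mem_nhds hp] with q hq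
    exact ((φ t).right_inv hq.2).symm
  have h2 : gaugeChange φ ψ t p ∈ (φ t).source := (φ t).map_target hp.2
  rw [pullbackField_congr h1, pullbackField_comp (hΦ.mdifferentiableAt hn hp)
    (hφ.mdifferentiableAt le_rfl h2) (hΦ.isInvertible_mfderiv hn hp)]

/-- The transformation of perturbations under a change of gauge. -/
theorem perturbationOrder_gaugeChange [FiniteDimensional ℝ E] [T2Space M]
    [IsManifold 𝓘(ℝ, E) ∞ M] {n : ℕ} (hn : 1 ≤ n) {φ ψ : ℝ → OpenPartialHomeomorph M M}
    (hφ : IsDiffeoFamily (E := E) 1 φ) (hψ : IsDiffeoFamily (E := E) 1 ψ)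
    (hΦ : IsDiffeoFamily (E := E) n (gaugeChange φ ψ))
    {ξ : ℕ → (p : M) → TangentSpace 𝓘(ℝ, E) p}
    (hξ : GeneratesApproximatingKnight n (gaugeChange φ ψ) ξ) {T : ℝ → M → Tensor r s E}
    (hT : ContDiffTensorFamilyOn n (fun t => pullbackField (φ t) (T t)) (familyDomain φ))
    {k : ℕ} (hk : k < n) (p : M) :
    perturbationOrder T ψ k p =
      ∑ l ∈ Finset.range (k + 1), ((Nat.factorial k : ℝ) / (Nat.factorial (k - l) : ℝ)) •
        knightCoeff (fun i => lieDerivative (ξ i)) k l (perturbationOrder T φ (k - l)) p := by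
  have : CompleteSpace E := FiniteDimensional.complete ℝ E
  obtain ⟨hξc, θ, D, hθ, happ⟩ := hξ
  have hX : ∀ i, 1 ≤ i → i ≤ n - 1 → ∀ y : M,
      ContDiffOn ℝ (n - i : ℕ) (vectorInChart y (ξ i)) (extChartAt 𝓘(ℝ, E) y).target :=
    fun i h1 h2 y => contDiffOn_vectorInChart (hξc i h1 (by omega)) y
  have hθ' : ∀ i, 1 ≤ i → i ≤ n - 1 → IsFlowOn (ξ i) (θ i) (D i) :=
    fun i h1 h2 => hθ i h1 (by omega)
  obtain ⟨O, hO, hOc, hsub⟩ := hΦ.exists_contDiffOn_familyInChart p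
  have key := iteratedDeriv_pullback_eq hn (isOpen_extChartAt_target p)
    (fun i h1 h2 => hX i h1 h2 p) (fun i h1 h2 => (hθ' i h1 h2).isLocalFlowOn p) hO hOc hsub
    (fun u hu => by rw [familyInChart, hΦ.map_zero]; exact (extChartAt 𝓘(ℝ, E) p).right_inv hu)
    (fun u hu => GeneratesApproximatingKnight.isLittleO_chart hn hΦ
      (fun i h1 h2 q => (hθ' i h1 h2).tendsto q) happ hu)
    (isOpen_domainInChart hφ.isOpen_domain p) (hT p) (fun u hu => ⟨hu, hφ.zero_mem _⟩)
    (mem_extChartAt_target p) hk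
  have hleft : (fun t => pullbackField (ψ t) (T t) p) =ᶠ[𝓝 0] fun t =>
      (tensorInChart p (pullbackField (φ t) (T t)) (familyInChart p
        (fun t => gaugeChange φ ψ t) (t, extChartAt 𝓘(ℝ, E) p p))).pullback
      (fderiv ℝ (fun v => familyInChart p (fun t => gaugeChange φ ψ t) (t, v))
        (extChartAt 𝓘(ℝ, E) p p)) := by
    have ht := tendsto_mk_nhds_zero p
    filter_upwards [ht.eventually (hΦ.isOpen_domain.mem_nhds (hΦ.zero_mem p)),
      ((hΦ.tendsto p).comp ht).eventually ((isOpen_extChartAt_source (I := 𝓘(ℝ, E)) p).mem_nhds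
        (mem_extChartAt_source p))] with t h1 h2
    rw [hΦ.pullback_tensorInChart hn h1 h2, pullbackField_gaugeChange hn hφ hΦ h1]
  rw [perturbationOrder_eq_iteratedDeriv hψ]
  beta_reduce
  rw [hleft.iteratedDeriv_eq, key]
  refine Finset.sum_congr rfl fun l hl => ?_
  have hlk : l ≤ k := by simpa [Nat.lt_succ_iff] using hl
  congr 1
  have hreg : ∀ y : M, ContDiffOn ℝ l (tensorInChart y (perturbationOrder T φ (k - l)))
      (extChartAt 𝓘(ℝ, E) y).target := by
    intro y
    rw [perturbationOrder_eq_iteratedDeriv hφ]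
    exact (contDiffOn_tensorInChart_iteratedDeriv hT hφ.isOpen_domain hφ.zero_mem
      (by omega) y).of_le (by norm_cast; omega)
  rw [← knightCoeff_of_le _ hlk (by omega : k ≤ n - 1), ← tensorInChart_extChartAt_self p
    (knightCoeff _ _ _ _), tensorInChart_knightCoeff hX (by omega) hreg le_rfl p
    (mem_extChartAt_target p)]
  refine knightCoeff_lieDerivativeSpace_congr (isOpen_extChartAt_target p) (fun u hu => ?_)
    (mem_extChartAt_target p)
  rw [perturbationOrder_eq_iteratedDeriv hφ]
  exact (tensorInChart_iteratedDeriv hT hφ.isOpen_domain hφ.zero_mem (by omega) p u).symm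

end Perturbations
end GaugePerturbation

open GaugePerturbation in
theorem mainTheorem3
    {E : Type*} [NormedAddCommGroup E] [NormedSpace ℝ E] [FiniteDimensional ℝ E]
    {M : Type*} [TopologicalSpace M] [T2Space M] [ChartedSpace E M] [IsManifold 𝓘(ℝ, E) ∞ M]
    (r s n : ℕ) (hn : 1 ≤ n)
    (φ ψ : ℝ → OpenPartialHomeomorph M M)
    (hφ : IsDiffeoFamily (E := E) 1 φ) (hψ : IsDiffeoFamily (E := E) 1 ψ)
    (hΦ : IsDiffeoFamily (E := E) n (gaugeChange φ ψ)) :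
    (∃ ξ : ℕ → (p : M) → TangentSpace 𝓘(ℝ, E) p,
      GeneratesApproximatingKnight n (gaugeChange φ ψ) ξ) ∧
    ∀ ξ : ℕ → (p : M) → TangentSpace 𝓘(ℝ, E) p,
      GeneratesApproximatingKnight n (gaugeChange φ ψ) ξ →
      ∀ T : ℝ → M → Tensor r s E,
        ContDiffTensorFamilyOn n (fun t => pullbackField (φ t) (T t)) (familyDomain φ) →
        ∀ k < n, ∀ p : M,
          perturbationOrder T ψ k p =
            ∑ l ∈ Finset.range (k + 1),
              ((Nat.factorial k : ℝ) / (Nat.factorial (k - l) : ℝ)) •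
                ∑ j ∈ weightedIndices k l,
                  (1 / ∏ i : Fin k,
                    ((Nat.factorial ((i : ℕ) + 1) : ℝ) ^ j i * (Nat.factorial (j i) : ℝ))) •
                    iteratedLie ξ j (perturbationOrder T φ (k - l)) p := by
  have : CompleteSpace E := FiniteDimensional.complete ℝ E
  refine ⟨exists_generatesApproximatingKnight hn hΦ, fun ξ hξ T hT k hk p => ?_⟩
  simp only [sum_iteratedLie_eq_knightCoeff]
  exact perturbationOrder_gaugeChange hn hφ hψ hΦ hξ hT hk p
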